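/- All graphs are finite and simple, and $\log$ is the logarithm to base $2$. For a graph $G$ on $n$ vertices with adjacency matrix $A$ and reals $\beta,t$, say that $G$ is $(\beta,t)$-sparse if $u^{T}Av\le\beta\|u\|\,\|v\|$ for all $u,v\in\{0,1\}^n$ with $|\mathrm{supp}(u)\cup\mathrm{supp}(v)|\le t$. A signing of $G$ is a function $s:E(G)\to\{-1,1\}$; its signed adjacency matrix $A_s$ has $(x,y)$ entry $s(xy)$ if $xy\in E(G)$ and $0$ otherwise; its spectral radius is that of $A_s$. The $2$-lift of $G$ associated with $s$ is the graph $\hat G$ with two vertices $x_0,x_1$ for every vertex $x$ of $G$ and, for every edge $xy$ of $G$, the edges $x_0y_0,\,x_1y_1$ if $s(xy)=1$ and $x_0y_1,\,x_1y_0$ if $s(xy)=-1$. If $\lambda_1\ge\dots\ge\lambda_n$ are the eigenvalues of $A$, put $\lambda(G)=\max_{i\ge2}|\lambda_i|$. Let $\gamma(d)=10\sqrt{d\log d}$. **Corollary 3.1.** There are an absolute constant $C>0$ and a deterministic algorithm $M$ such that, for every $d\ge2$, the following hold. 1. On every $d$-regular $(\gamma(d),\log n)$-sparse graph $G$ on $n$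 vertices, $M$ halts in time polynomial in $n$ (the polynomial may depend on $d$) and outputs a signing $s$ of $G$ such that the spectral radius of $A_s$ is at most $C\sqrt{d\log^3 d}$ and the $2$-lift $\hat G$ associated with $s$ is $(\gamma(d),1+\log n)$-sparse. 2. Iterating $M$ gives a polynomial-time construction: there is a deterministic algorithm, the same for all $d$, which on input $k\ge0$ and a $d$-regular $(\gamma(d),\log n_0)$-sparse graph $G_0$ on $n_0$ vertices halts in time polynomial in $N=2^kn_0$ (the polynomial may depend on $d$) and outputs a graph $G_k$ on $N$ vertices obtained from $G_0$ by $k$ successive $2$-lifts, up to a numbering of the vertices, each by the signing that $M$ outputs on the current graph. The graph $G_k$ is $d$-regular and $(\gamma(d),\log N)$-sparse, and $\lambda(G_k)\le\max\{\lambda(G_0),\,C\sqrt{d\log^3 d}\}$. 3. In particular there is a deterministic algorithm, the same for all $d$, which on input $d$ and $k\ge0$ halts in time polynomial in $N=2^k(d+1)$ (the polynomial may depend on $d$) and outputs a $d$-regular graph $G$ on $N$ vertices with $\lambda(G)\le C\sqrt{d\log^3 d}$, obtained in the same way by $k$ successive $2$-lifts from the complete graph $K_{d+1}$. -/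

import Mathlib

/-!
# Graphs, signings and 2-lifts; random access machine programs with a step count

Graphs are finite and simple. All logarithms are to base 2.
-/

namespace TwoLift

/-! ### Signings, lifts, sparsity, second eigenvalue -/

section Graphs

open Classical

/-- A signing of the edges of `G`: a function from `E(G)` to `{-1, 1}`. -/
abbrev Signing {V : Type*} (G : SimpleGraph V) : Type _ := G.edgeSet → ℤˣ

/-- The sign of the edge joining two adjacent vertices. -/
def Signing.sign {V : Type*} {G : SimpleGraph V} (s : Signing G) {x y : V} (h : G.Adj x y) : ℤˣ :=
  s ⟨s(x, y), h⟩

/-- The adjacency matrix of `G`, over the reals. -/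
noncomputable def adj {V : Type*} (G : SimpleGraph V) : Matrix V V ℝ := G.adjMatrix ℝ

/-- The signed adjacency matrix: the `(x, y)` entry is `s(x, y)` on edges, and `0` elsewhere. -/
noncomputable def signedAdj {V : Type*} {G : SimpleGraph V} (s : Signing G) : Matrix V V ℝ :=
  Matrix.of fun x y => if h : G.Adj x y then (((s.sign h : ℤˣ) : ℤ) : ℝ) else 0

/-- The 2-lift of `G` associated with `s`. The fiber of `x` is `{(x, false), (x, true)}`; an edge
of sign `1` lifts to the two edges inside the layers, an edge of sign `-1` to the two edges between
the layers. -/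
def lift {V : Type*} {G : SimpleGraph V} (s : Signing G) : SimpleGraph (V × Bool) where
  Adj p q := ∃ h : G.Adj p.1 q.1, (s.sign h = 1 ∧ p.2 = q.2) ∨ (s.sign h = -1 ∧ p.2 ≠ q.2)
  symm := ⟨by
    rintro p q ⟨h, h'⟩
    have e : s.sign h.symm = s.sign h := congrArg s (Subtype.ext Sym2.eq_swap)
    exact ⟨h.symm, by rw [e]; exact h'.imp (fun t => ⟨t.1, t.2.symm⟩) fun t => ⟨t.1, t.2.symm⟩⟩⟩
  loopless := ⟨fun p h => G.loopless.irrefl p.1 h.1⟩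

/-- `G` is `(β, t)`-sparse: `u A v ≤ β ‖u‖ ‖v‖` (Euclidean norms) for all 0-1 vectors `u`, `v`
such that `supp u ∪ supp v` has at most `t` elements. -/
def IsSparse {V : Type*} [Fintype V] (G : SimpleGraph V) (β t : ℝ) : Prop :=
  ∀ u v : V → ℝ, (∀ x, u x = 0 ∨ u x = 1) → (∀ x, v x = 0 ∨ v x = 1) →
    ((Function.support u ∪ Function.support v).ncard : ℝ) ≤ t →
    u ⬝ᵥ (adj G).mulVec v ≤ β * ‖WithLp.toLp 2 u‖ * ‖WithLp.toLp 2 v‖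

theorem adj_isHermitian {V : Type*} (G : SimpleGraph V) : (adj G).IsHermitian := by
  ext x y
  simp [adj, SimpleGraph.adjMatrix_apply, G.adj_comm]

/-- `λ(G) = max_{i ≥ 2} |λ_i|`, where `λ₁ ≥ λ₂ ≥ … ≥ λₙ` are the eigenvalues of the adjacency
matrix with multiplicity (`eigenvalues₀` lists them in decreasing order, from index `0`). -/
noncomputable def secondEigenvalue {V : Type*} [Fintype V] (G : SimpleGraph V) : ℝ :=
  ⨆ i : {i : Fin (Fintype.card V) // 0 < i.val}, |(adj_isHermitian G).eigenvalues₀ i|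

/-- `G` is `d`-regular. -/
def IsRegular {V : Type*} [Fintype V] (G : SimpleGraph V) (d : ℕ) : Prop :=
  G.IsRegularOfDegree d

/-- `γ(d) = 10 √(d log d)`. -/
noncomputable def gamma (d : ℕ) : ℝ := 10 * √(d * Real.logb 2 d)

/-- `√(d log³ d)`. -/
noncomputable def quasiBound (d : ℕ) : ℝ := √(d * Real.logb 2 d ^ 3)

end Graphs

/-! ### Random access machine programs

A structured programming language for the random access machine: finitely many registers named in
the program, a memory of cells with indirect addressing, each holding a natural number; arithmetic
is addition and truncated subtraction only. Every operation costs one step. Without multiplication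
a number grows by at most one bit per step, so this is polynomially equivalent to Turing machines. -/

/-- A machine state: the contents of the registers and of the memory cells. -/
structure State where
  reg : ℕ → ℕ
  mem : ℕ → ℕ

/-- Expressions: a literal, a register, the cell with a given address, sum, truncated difference. -/
inductive Expr where
  | lit (c : ℕ)
  | reg (r : ℕ)
  | cell (a : Expr)
  | add (a b : Expr)
  | sub (a b : Expr)

/-- The value of an expression in a state. -/
def Expr.eval (σ : State) : Expr → ℕ
  | lit c => c
  | reg r => σ.reg r
  | cell a => σ.mem (a.eval σ)
  | add a b => a.eval σ + b.eval σ
  | sub a b => a.eval σ - b.eval σ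

/-- The number of steps needed to evaluate an expression: one for each operation in it. -/
def Expr.cost : Expr → ℕ
  | lit _ => 1
  | reg _ => 1
  | cell a => a.cost + 1
  | add a b => a.cost + b.cost + 1
  | sub a b => a.cost + b.cost + 1

/-- Programs: assignment to a register, assignment `mem[a] := b` to a memory cell, composition,
branching on `e ≠ 0`, and the loop `while e ≠ 0 do p`. -/
inductive Prog where
  | set (r : ℕ) (e : Expr)
  | store (a b : Expr)
  | seq (p q : Prog)
  | ite (e : Expr) (p q : Prog)
  | loop (e : Expr) (p : Prog)

/-- `Exec p σ t σ'`: started in the state `σ`, the program `p` halts after exactly `t` steps, in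
the state `σ'`. -/
inductive Exec : Prog → State → ℕ → State → Prop
  | set (r : ℕ) (e : Expr) (σ : State) :
      Exec (.set r e) σ (e.cost + 1) ⟨Function.update σ.reg r (e.eval σ), σ.mem⟩
  | store (a b : Expr) (σ : State) :
      Exec (.store a b) σ (a.cost + b.cost + 1)
        ⟨σ.reg, Function.update σ.mem (a.eval σ) (b.eval σ)⟩
  | seq {p q : Prog} {σ σ' σ'' : State} {t t' : ℕ} :
      Exec p σ t σ' → Exec q σ' t' σ'' → Exec (.seq p q) σ (t + t') σ''
  | iteTrue {e : Expr} {p q : Prog} {σ σ' : State} {t : ℕ} :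
      e.eval σ ≠ 0 → Exec p σ t σ' → Exec (.ite e p q) σ (e.cost + 1 + t) σ'
  | iteFalse {e : Expr} {p q : Prog} {σ σ' : State} {t : ℕ} :
      e.eval σ = 0 → Exec q σ t σ' → Exec (.ite e p q) σ (e.cost + 1 + t) σ'
  | loopDone {e : Expr} {p : Prog} {σ : State} :
      e.eval σ = 0 → Exec (.loop e p) σ (e.cost + 1) σ
  | loopStep {e : Expr} {p : Prog} {σ σ' σ'' : State} {t t' : ℕ} :
      e.eval σ ≠ 0 → Exec p σ t σ' → Exec (.loop e p) σ' t' σ'' →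
        Exec (.loop e p) σ (e.cost + 1 + t + t') σ''

/-- Programs are deterministic: final state and running time depend only on the initial state. -/
theorem Exec.deterministic {p : Prog} {σ σ₁ σ₂ : State} {t₁ t₂ : ℕ}
    (h₁ : Exec p σ t₁ σ₁) (h₂ : Exec p σ t₂ σ₂) : t₁ = t₂ ∧ σ₁ = σ₂ := by
  induction h₁ generalizing t₂ σ₂ with
  | set => cases h₂; exact ⟨rfl, rfl⟩
  | store => cases h₂; exact ⟨rfl, rfl⟩
  | seq _ _ ih ih' =>
    cases h₂ with
    | seq a b =>
      obtain ⟨rfl, rfl⟩ := ih a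
      obtain ⟨rfl, rfl⟩ := ih' b
      exact ⟨rfl, rfl⟩
  | iteTrue h _ ih =>
    cases h₂ with
    | iteTrue _ a => obtain ⟨rfl, rfl⟩ := ih a; exact ⟨rfl, rfl⟩
    | iteFalse h' _ => exact absurd h' h
  | iteFalse h _ ih =>
    cases h₂ with
    | iteTrue h' _ => exact absurd h h'
    | iteFalse _ a => obtain ⟨rfl, rfl⟩ := ih a; exact ⟨rfl, rfl⟩
  | loopDone h =>
    cases h₂ with
    | loopDone _ => exact ⟨rfl, rfl⟩
    | loopStep h' _ _ => exact absurd h h'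
  | loopStep h _ _ ih ih' =>
    cases h₂ with
    | loopDone h' => exact absurd h' h
    | loopStep _ a b =>
      obtain ⟨rfl, rfl⟩ := ih a
      obtain ⟨rfl, rfl⟩ := ih' b
      exact ⟨rfl, rfl⟩

/-- The initial state on an input list: its length is in register `0`, its entries are in the
memory cells `0, 1, 2, …`, and all else is `0`. -/
def initState (input : List ℕ) : State where
  reg r := if r = 0 then input.length else 0
  mem i := input.getD i 0

/-- The output of a final state, in the same format: register `0` holds the length of the list and
the cells `0, 1, 2, …` hold its entries (registers and cells beyond these are ignored). -/
def State.Holds (σ : State) (output : List ℕ) : Prop :=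
  σ.reg 0 = output.length ∧ ∀ i (h : i < output.length), σ.mem i = output[i]

/-- On the given input, `p` halts after at most `T` steps with the given output. -/
def Prog.OutputsWithin (p : Prog) (input output : List ℕ) (T : ℕ) : Prop :=
  ∃ t ≤ T, ∃ σ, Exec p (initState input) t σ ∧ σ.Holds output

/-- On the given input, `p` halts with the given output. -/
def Prog.Outputs (p : Prog) (input output : List ℕ) : Prop :=
  ∃ T, p.OutputsWithin input output T

/-! ### Encodings -/

/-- An `n × n` matrix as a list: the number `n`, then the entries row by row. -/
def encodeMatrix {n : ℕ} (f : Fin n → Fin n → ℕ) : List ℕ :=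
  n :: List.ofFn fun i : Fin (n * n) => f i.divNat i.modNat

open Classical in
/-- A graph on `{0, …, n - 1}`, encoded by its adjacency matrix. -/
noncomputable def encodeGraph {n : ℕ} (G : SimpleGraph (Fin n)) : List ℕ :=
  encodeMatrix fun x y => if G.Adj x y then 1 else 0

open Classical in
/-- A signing, encoded by its signed adjacency matrix, with the entry `-1` written as `2`. -/
noncomputable def encodeSigning {n : ℕ} {G : SimpleGraph (Fin n)} (s : Signing G) : List ℕ :=
  encodeMatrix fun x y => if h : G.Adj x y then (if s.sign h = 1 then 1 else 2) else 0

/-- `IteratedLift M G₀ k G`: there are graphs `G₀, G₁, …, G_k = G` such that each `G_{i+1}` is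
(up to a numbering of its vertices) the 2-lift of `G_i` by the signing that `M` outputs on `G_i`. -/
inductive IteratedLift (M : Prog) {n₀ : ℕ} (G₀ : SimpleGraph (Fin n₀)) :
    ℕ → ∀ {n : ℕ}, SimpleGraph (Fin n) → Prop
  | base : IteratedLift M G₀ 0 G₀
  | step {k n n' : ℕ} {G : SimpleGraph (Fin n)} {G' : SimpleGraph (Fin n')} (s : Signing G) :
      IteratedLift M G₀ k G → M.Outputs (encodeGraph G) (encodeSigning s) →
      Nonempty (G' ≃g lift s) → IteratedLift M G₀ (k + 1) G'

end TwoLift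

/-! In sum and difference coordinates on each fiber, the adjacency form of a 2-lift is the form of A
plus the form of A_s (`quadratic_lift`). So λ of the lift is at most the larger of λ(G) and the norm
of A_s, and everything rests on one deterministic signing whose matrix has norm O(√(d log³ d)) and
whose lift is again sparse.

The signing comes from the method of conditional expectations. Put m = `lg n` = 1 + ⌊log n⌋. The
potential of a partial signing has two parts. One is the conditional expectation of the trace of
A_s^(2m), written as a sum over closed walks. The other sums, over coded pairs (u, v) of vectors
with entries 0, 1, -1, the products ∏ (1 + (u_x v_y + u_y v_x) s_xy / 4), an affine substitute for
exp(u A_s v / 4). Each sign enters affinely, so one of its two values does not increase the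
potential (`pot_add_pot`, `pot_step`); a scaling and an offset make it a natural number. A connected
set of at most m vertices lies on a walk with 2m vertices, and a label from 0, …, 8 at each vertex
of the walk records u and v. Hence n(9d)^(2m) codes suffice, polynomially many in n for fixed d
(`exists_code`, `loopBound_le`). The outcome is `greedySigning_inequality`, which is used twice.

Spectrum. The products are nonnegative, so dropping them bounds the trace of A_s^(2m) by 1 plus its
mean over random signs. The mean is estimated by a probabilistic argument that the algorithm never
runs. It suffices to treat connected supports (`sum_kernel_le_of_linked`); those with fewer than m
vertices are controlled by sparsity of G, larger ones by a Chernoff bound and a union bound over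
codes (`card_isBad_le`). A signing with u A v ≤ γ‖u‖‖v‖ on all ternary vectors satisfies such a
bound on all integer vectors up to a factor of order log d, by signed binary digits
(`abs_bilinear_int_le`), and this bounds traces of powers (`trace_pow_le`). Since n < 2^m, the
factor n costs only a constant in the 2m-th root.

Sparsity. The trace is nonnegative, so dropping it shows that each single product is below d^(7m)
(`pairWeight_le`). Vertex sets of the lift that project to fewer than m vertices inherit sparsity
from G. The remaining sets meet each fiber at most once; a violation on one of them would force a
product of at least d^(7m) (`fiberwise_linked_le`).

Running time. A small calculus of functions and memory transformations (`Comp`, `Trans`) follows the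
cost in terms of one number B bounding all loop lengths. The numbers handled may be large, but every
operation costs one step. -/

namespace TwoLift

/-! ### Polynomial-time computable functions of the memory and of finitely many registers -/

/-- The program `p`, started in `σ`, halts within `T` steps in a state satisfying `Q`. -/
def Runs (p : Prog) (σ : State) (T : ℕ) (Q : State → Prop) : Prop :=
  ∃ t ≤ T, ∃ σ', Exec p σ t σ' ∧ Q σ'

theorem Runs.mono {p : Prog} {σ : State} {T T' : ℕ} {Q Q' : State → Prop} (h : Runs p σ T Q)
    (hT : T ≤ T') (hQ : ∀ σ', Q σ' → Q' σ') : Runs p σ T' Q' := by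
  obtain ⟨t, ht, σ', h1, h2⟩ := h
  exact ⟨t, ht.trans hT, σ', h1, hQ _ h2⟩

theorem Runs.seq {p q : Prog} {σ : State} {T T' : ℕ} {Q Q' : State → Prop} (h : Runs p σ T Q)
    (h' : ∀ σ', Q σ' → Runs q σ' T' Q') : Runs (.seq p q) σ (T + T') Q' := by
  obtain ⟨t, ht, σ', h1, h2⟩ := h
  obtain ⟨t', ht', σ'', h1', h2'⟩ := h' _ h2
  exact ⟨t + t', by omega, σ'', .seq h1 h1', h2'⟩

theorem Runs.set {r : ℕ} {e : Expr} {σ : State} {Q : State → Prop}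
    (h : Q ⟨Function.update σ.reg r (e.eval σ), σ.mem⟩) : Runs (.set r e) σ (e.cost + 1) Q :=
  ⟨_, le_rfl, _, .set r e σ, h⟩

theorem Runs.store {a b : Expr} {σ : State} {Q : State → Prop}
    (h : Q ⟨σ.reg, Function.update σ.mem (a.eval σ) (b.eval σ)⟩) :
    Runs (.store a b) σ (a.cost + b.cost + 1) Q :=
  ⟨_, le_rfl, _, .store a b σ, h⟩

theorem Runs.ite {e : Expr} {p q : Prog} {σ : State} {T : ℕ} {Q : State → Prop}
    (h1 : e.eval σ ≠ 0 → Runs p σ T Q) (h2 : e.eval σ = 0 → Runs q σ T Q) :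
    Runs (.ite e p q) σ (e.cost + 1 + T) Q := by
  by_cases h : e.eval σ = 0
  · obtain ⟨t, ht, σ', h1, h2⟩ := h2 h
    exact ⟨_, by omega, σ', .iteFalse h h1, h2⟩
  · obtain ⟨t, ht, σ', h1, h2⟩ := h1 h
    exact ⟨_, by omega, σ', .iteTrue h h1, h2⟩

/-- A counting loop, with an invariant indexed by the number of completed rounds. -/
theorem Runs.loop {e : Expr} {p : Prog} {T N : ℕ} (I : ℕ → State → Prop)
    (hstep : ∀ j σ, j < N → I j σ → e.eval σ ≠ 0 ∧ Runs p σ T (I (j + 1)))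
    (hend : ∀ σ, I N σ → e.eval σ = 0) {σ : State} (h0 : I 0 σ) :
    Runs (.loop e p) σ (N * (e.cost + 1 + T) + (e.cost + 1)) (I N) := by
  suffices H : ∀ i j σ, j + i = N → I j σ →
      Runs (.loop e p) σ (i * (e.cost + 1 + T) + (e.cost + 1)) (I N) from H N 0 σ (by omega) h0
  intro i
  induction i with
  | zero =>
    intro j σ hj h
    obtain rfl : j = N := by omega
    exact ⟨_, by omega, σ, .loopDone (hend _ h), h⟩
  | succ i ih =>
    intro j σ hj h
    obtain ⟨hne, t, ht, σ', h1, h2⟩ := hstep j σ (by omega) h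
    obtain ⟨t', ht', σ'', h1', h2'⟩ := ih (j + 1) σ' (by omega) h2
    refine ⟨_, ?_, σ'', .loopStep hne h1 h1', h2'⟩
    rw [Nat.succ_mul]
    omega

/-- Contexts: the memory together with the contents of finitely many registers. A layout says in
which registers these are found. -/
class Ctx (α : Type) where
  Lay : Type
  below : Lay → ℕ → Prop
  read : Lay → State → α
  mem : α → ℕ → ℕ
  upd : α → (ℕ → ℕ) → α
  below_mono : ∀ {l k k'}, below l k → k ≤ k' → below l k'
  read_congr : ∀ {l k σ σ'}, below l k → (∀ j < k, σ'.reg j = σ.reg j) → σ'.mem = σ.mem →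
    read l σ' = read l σ
  mem_read : ∀ l σ, mem (read l σ) = σ.mem
  read_upd : ∀ {l k σ σ'}, below l k → (∀ j < k, σ'.reg j = σ.reg j) →
    read l σ' = upd (read l σ) σ'.mem
  mem_upd : ∀ x M, mem (upd x M) = M

instance : Ctx (ℕ → ℕ) where
  Lay := Unit
  below _ _ := True
  read _ σ := σ.mem
  mem x := x
  upd _ M := M
  below_mono _ _ := trivial
  read_congr _ _ h := h
  mem_read _ _ := rfl
  read_upd _ _ := rfl
  mem_upd _ _ := rfl

instance {α : Type} [Ctx α] : Ctx (α × ℕ) where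
  Lay := Ctx.Lay α × ℕ
  below l k := Ctx.below l.1 k ∧ l.2 < k
  read l σ := (Ctx.read l.1 σ, σ.reg l.2)
  mem x := Ctx.mem x.1
  upd x M := (Ctx.upd x.1 M, x.2)
  below_mono h h' := ⟨Ctx.below_mono h.1 h', by omega⟩
  read_congr h h1 h2 := by rw [Ctx.read_congr h.1 h1 h2, h1 _ h.2]
  mem_read l σ := Ctx.mem_read l.1 σ
  read_upd h h1 := by rw [Ctx.read_upd h.1 h1, h1 _ h.2]
  mem_upd x M := Ctx.mem_upd x.1 M

/-- `σ'` agrees with `σ` on the memory and on the registers below `k`. -/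
def Agree (k : ℕ) (σ σ' : State) : Prop := σ'.mem = σ.mem ∧ ∀ j < k, σ'.reg j = σ.reg j

theorem Agree.trans {k k' : ℕ} {σ σ' σ'' : State} (h : Agree k σ σ') (h' : Agree k' σ' σ'')
    (hk : k ≤ k') : Agree k σ σ'' :=
  ⟨h'.1.trans h.1, fun j hj => (h'.2 j (by omega)).trans (h.2 j hj)⟩

theorem Agree.update {k r : ℕ} {σ : State} (v : ℕ) (h : k ≤ r) :
    Agree k σ ⟨Function.update σ.reg r v, σ.mem⟩ :=
  ⟨rfl, fun j hj => Function.update_of_ne (by omega) _ _⟩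

theorem Agree.read {α : Type} [Ctx α] {k : ℕ} {l : Ctx.Lay α} {σ σ' : State} (h : Agree k σ σ')
    (hl : Ctx.below l k) : Ctx.read l σ' = Ctx.read l σ :=
  Ctx.read_congr hl h.2 h.1

/-- `f` is computable, at every place in the registers, in time polynomial in `B` on the arguments
`x` with `D x B`. -/
def Comp {α : Type} [Ctx α] (D : α → ℕ → Prop) (f : α → ℕ) : Prop :=
  ∃ c h : ℕ, ∀ (l : Ctx.Lay α) (k : ℕ), Ctx.below l k → ∃ p : Prog, ∀ σ B, D (Ctx.read l σ) B →
    Runs p σ (c * (B + 1) ^ h) fun σ' => Agree k σ σ' ∧ σ'.reg k = f (Ctx.read l σ)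

section Closure

variable {α : Type} [Ctx α] {D : α → ℕ → Prop}

theorem Comp.mono {D' : α → ℕ → Prop} {f : α → ℕ} (hf : Comp D f) (h : ∀ x B, D' x B → D x B) :
    Comp D' f := by
  obtain ⟨c, e, H⟩ := hf
  refine ⟨c, e, fun l k hl => ?_⟩
  obtain ⟨p, hp⟩ := H l k hl
  exact ⟨p, fun σ B hD => hp σ B (h _ _ hD)⟩

theorem Comp.congr {f g : α → ℕ} (hf : Comp D f) (h : ∀ x B, D x B → g x = f x) :
    Comp D g := by
  obtain ⟨c, e, H⟩ := hf
  refine ⟨c, e, fun l k hl => ?_⟩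
  obtain ⟨p, hp⟩ := H l k hl
  exact ⟨p, fun σ B hD => (hp σ B hD).mono le_rfl fun σ' h' => ⟨h'.1, h'.2.trans (h _ _ hD).symm⟩⟩

theorem Comp.fst {D' : α × ℕ → ℕ → Prop} {f : α → ℕ} (hf : Comp D f)
    (h : ∀ x B, D' x B → D x.1 B) : Comp D' fun x => f x.1 := by
  obtain ⟨c, e, H⟩ := hf
  refine ⟨c, e, fun l k hl => ?_⟩
  obtain ⟨p, hp⟩ := H l.1 k hl.1
  exact ⟨p, fun σ B hD => hp σ B (h _ _ hD)⟩

theorem Comp.snd {D' : α × ℕ → ℕ → Prop} : Comp D' fun x => x.2 := by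
  refine ⟨2, 0, fun l k hl => ⟨.set k (.reg l.2), fun σ B hD => ?_⟩⟩
  refine (Runs.set ⟨Agree.update _ le_rfl, ?_⟩).mono (by simp [Expr.cost]) fun _ h => h
  simp [Expr.eval, Ctx.read]

theorem Comp.lit (v : ℕ) : Comp D fun _ => v := by
  refine ⟨2, 0, fun l k hl => ⟨.set k (.lit v), fun σ B hD => ?_⟩⟩
  refine (Runs.set ⟨Agree.update _ le_rfl, ?_⟩).mono (by simp [Expr.cost]) fun _ h => h
  simp [Expr.eval]

/-- Costs of consecutive programs add up. The base `B + 1` is at least 1, so raising an exponent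
never lowers a bound, and a sum of two polynomial bounds and a constant returns to the form that
`Comp` asks for. -/
theorem poly_add_le (c c' h h' e B : ℕ) :
    c * (B + 1) ^ h + (c' * (B + 1) ^ h' + e) ≤ (c + c' + e) * (B + 1) ^ (h + h') := by
  have h1 : (B + 1) ^ h ≤ (B + 1) ^ (h + h') := Nat.pow_le_pow_right (by omega) (by omega)
  have h2 : (B + 1) ^ h' ≤ (B + 1) ^ (h + h') := Nat.pow_le_pow_right (by omega) (by omega)
  have h3 : 1 ≤ (B + 1) ^ (h + h') := Nat.one_le_pow _ _ (by omega)
  nlinarith [Nat.mul_le_mul_left c h1, Nat.mul_le_mul_left c' h2, Nat.mul_le_mul_left e h3]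

theorem Comp.cell {f : α → ℕ} (hf : Comp D f) : Comp D fun x => Ctx.mem x (f x) := by
  obtain ⟨c, h, H⟩ := hf
  refine ⟨c + 0 + 3, h + 0, fun l k hl => ?_⟩
  obtain ⟨p, hp⟩ := H l k hl
  refine ⟨.seq p (.set k (.cell (.reg k))), fun σ B hD => ?_⟩
  refine (Runs.seq (hp σ B hD) fun σ' hσ' => Runs.set ⟨hσ'.1.trans (Agree.update _ le_rfl) le_rfl,
    ?_⟩).mono ?_ fun _ h => h
  · refine le_trans ?_ (poly_add_le c 0 h 0 3 B)
    simp [Expr.cost]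
  · simp [Expr.eval, hσ'.2, hσ'.1.1, Ctx.mem_read]

/-- Operations on two values. -/
theorem Comp.op {f g : α → ℕ} (hf : Comp D f) (hg : Comp D g) (e : Expr → Expr → Expr)
    (o : ℕ → ℕ → ℕ) (hc : ∀ a b, (e a b).cost = a.cost + b.cost + 1)
    (ho : ∀ σ a b, (e a b).eval σ = o (a.eval σ) (b.eval σ)) : Comp D fun x => o (f x) (g x) := by
  obtain ⟨c, h, H⟩ := hf
  obtain ⟨c', h', H'⟩ := hg
  refine ⟨c + c' + 4, h + h', fun l k hl => ?_⟩
  obtain ⟨p, hp⟩ := H l k hl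
  obtain ⟨q, hq⟩ := H' l (k + 1) (Ctx.below_mono hl (by omega))
  refine ⟨.seq p (.seq q (.set k (e (.reg k) (.reg (k + 1))))), fun σ B hD => ?_⟩
  refine (Runs.seq (hp σ B hD) fun σ' hσ' => Runs.seq (hq σ' B ?_) fun σ'' hσ'' =>
    Runs.set ⟨(hσ'.1.trans hσ''.1 (by omega)).trans (Agree.update _ le_rfl) le_rfl,
    ?_⟩).mono ?_ fun _ h => h
  · rw [hσ'.1.read hl]; exact hD
  · refine le_trans ?_ (poly_add_le c c' h h' 4 B)
    simp [hc, Expr.cost]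
  · simp [ho, Expr.eval, hσ''.2, hσ'.2, hσ''.1.2 k (by omega), hσ'.1.read hl]

theorem Comp.add {f g : α → ℕ} (hf : Comp D f) (hg : Comp D g) : Comp D fun x => f x + g x :=
  hf.op hg .add (· + ·) (fun _ _ => rfl) (fun _ _ _ => rfl)

theorem Comp.sub {f g : α → ℕ} (hf : Comp D f) (hg : Comp D g) : Comp D fun x => f x - g x :=
  hf.op hg .sub (· - ·) (fun _ _ => rfl) (fun _ _ _ => rfl)

/-- Branching on `f x ≠ 0`; each branch is computed only where it is taken. -/
theorem Comp.cases {f g g' : α → ℕ} (hf : Comp D f) (hg : Comp (fun x B => D x B ∧ f x ≠ 0) g)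
    (hg' : Comp (fun x B => D x B ∧ f x = 0) g') : Comp D fun x => if f x ≠ 0 then g x else g' x := by
  obtain ⟨c, h, H⟩ := hf
  obtain ⟨c', h', H'⟩ := hg
  obtain ⟨c'', h'', H''⟩ := hg'
  refine ⟨c + (c' + c'' + 0) + 2, h + (h' + h''), fun l k hl => ?_⟩
  obtain ⟨p, hp⟩ := H l k hl
  obtain ⟨q, hq⟩ := H' l k hl
  obtain ⟨r, hr⟩ := H'' l k hl
  refine ⟨.seq p (.ite (.reg k) q r), fun σ B hD => ?_⟩
  refine (Runs.seq (hp σ B hD) fun σ' hσ' => Runs.ite (T := (c' + c'' + 0) * (B + 1) ^ (h' + h''))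
    ?_ ?_).mono ?_ fun _ h => h
  · intro h1
    simp only [Expr.eval, hσ'.2] at h1
    simp only [if_pos h1]
    refine (hq σ' B ?_).mono ?_ fun σ'' hσ'' => ⟨hσ'.1.trans hσ''.1 le_rfl, ?_⟩
    · rw [hσ'.1.read hl]; exact ⟨hD, h1⟩
    · refine le_trans ?_ (poly_add_le c' c'' h' h'' 0 B); omega
    · rw [hσ''.2, hσ'.1.read hl]
  · intro h1
    simp only [Expr.eval, hσ'.2] at h1
    simp only [if_neg (not_not.mpr h1)]
    refine (hr σ' B ?_).mono ?_ fun σ'' hσ'' => ⟨hσ'.1.trans hσ''.1 le_rfl, ?_⟩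
    · rw [hσ'.1.read hl]; exact ⟨hD, h1⟩
    · refine le_trans ?_ (poly_add_le c' c'' h' h'' 0 B); omega
    · rw [hσ''.2, hσ'.1.read hl]
  · refine le_trans ?_ (poly_add_le c (c' + c'' + 0) h (h' + h'') 2 B)
    simp [Expr.cost]; omega

/-- Bounded recursion. -/
theorem Comp.nrec {b i : α → ℕ} {g : α → ℕ → ℕ → ℕ} (hb : Comp D b) (hi : Comp D i)
    (hB : ∀ x B, D x B → b x ≤ B)
    (hg : Comp (fun (y : (α × ℕ) × ℕ) B => D y.1.1 B ∧ y.1.2 < b y.1.1 ∧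
      y.2 = Nat.rec (i y.1.1) (g y.1.1) y.1.2) fun y => g y.1.1 y.1.2 y.2) :
    Comp D fun x => (Nat.rec (i x) (g x) (b x) : ℕ) := by
  obtain ⟨c, h, H⟩ := hb
  obtain ⟨c', h', H'⟩ := hi
  obtain ⟨c'', h'', H''⟩ := hg
  refine ⟨c + (c' + (c'' + 15) + 0) + 10, h + (h' + (h'' + 1)), fun l k hl => ?_⟩
  obtain ⟨p, hp⟩ := H l k hl
  obtain ⟨q, hq⟩ := H' l (k + 1) (Ctx.below_mono hl (by omega))
  -- registers: `k` bound, `k + 1` accumulator, `k + 2` counter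
  obtain ⟨r, hr⟩ := H'' ((l, k + 2), k + 1) (k + 3)
    ⟨⟨Ctx.below_mono hl (by omega), by change k + 2 < k + 3; omega⟩, by change k + 1 < k + 3; omega⟩
  refine ⟨.seq p (.seq q (.seq (.set (k + 2) (.lit 0)) (.seq
    (.loop (.sub (.reg k) (.reg (k + 2))) (.seq r (.seq (.set (k + 1) (.reg (k + 3)))
      (.set (k + 2) (.add (.reg (k + 2)) (.lit 1))))))
    (.set k (.reg (k + 1)))))), fun σ B hD => ?_⟩
  set x := Ctx.read l σ with hx
  refine (Runs.seq (hp σ B hD) fun σ₁ h₁ => Runs.seq (hq σ₁ B ?_) fun σ₂ h₂ =>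
    Runs.seq (Q := fun σ₃ => Agree k σ σ₃ ∧ σ₃.reg k = b x ∧ σ₃.reg (k + 1) = i x ∧
      σ₃.reg (k + 2) = 0) (Runs.set ?_) fun σ₃ h₃ => Runs.seq (Runs.loop (T := c'' * (B + 1) ^ h'' + 6)
      (N := b x) (fun j τ => Agree k σ τ ∧ τ.reg k = b x ∧ τ.reg (k + 2) = j ∧
        τ.reg (k + 1) = Nat.rec (i x) (g x) j) ?_ ?_ ?_)
      fun σ₄ h₄ => Runs.set ⟨h₄.1.trans (Agree.update _ le_rfl) le_rfl, ?_⟩).mono ?_ fun _ h => h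
  · rw [h₁.1.read hl]; exact hD
  · refine ⟨(h₁.1.trans h₂.1 (by omega)).trans (Agree.update _ (by omega)) le_rfl, ?_, ?_, ?_⟩
    · simp [h₂.1.2 k (by omega), h₁.2, ← hx]
    · simp [h₂.2, h₁.1.read hl, ← hx]
    · simp [Expr.eval]
  · rintro j τ hj ⟨ha, hb', hc, hd⟩
    refine ⟨by simp [Expr.eval, hb', hc]; omega, ?_⟩
    refine (Runs.seq (hr τ B ?_) fun τ₁ t₁ => Runs.seq (Q := fun τ₂ => Agree k σ τ₂ ∧
      τ₂.reg k = b x ∧ τ₂.reg (k + 2) = j ∧ τ₂.reg (k + 1) = Nat.rec (i x) (g x) (j + 1))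
      (Runs.set ?_) fun τ₂ t₂ => Runs.set ?_).mono ?_ fun _ h => h
    · simp only [Ctx.read]
      rw [ha.read hl, ← hx, hc, hd]
      exact ⟨hD, hj, rfl⟩
    · refine ⟨(ha.trans t₁.1 (by omega)).trans (Agree.update _ (by omega)) le_rfl, ?_, ?_, ?_⟩
      · simp [t₁.1.2 k (by omega), hb']
      · simp [t₁.1.2 (k + 2) (by omega), hc]
      · have := t₁.2
        simp only [Ctx.read] at this
        change _ = g (Ctx.read l τ) (τ.reg (k + 2)) (τ.reg (k + 1)) at this
        rw [ha.read hl, ← hx, hc, hd] at this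
        simp [Expr.eval, this]
    · refine ⟨t₂.1.trans (Agree.update _ (by omega)) le_rfl, ?_, ?_, ?_⟩
      · simp [t₂.2.1]
      · simp [Expr.eval, t₂.2.2.1]
      · simp [t₂.2.2.2]
    · simp [Expr.cost]
  · rintro τ ⟨ha, hb', hc, hd⟩
    simp [Expr.eval, hb', hc]
  · exact ⟨h₃.1, h₃.2.1, h₃.2.2.2, h₃.2.2.1⟩
  · have hbB := hB x B hD
    -- A round costs the body, 6 for the two register updates and 4 for the loop test. There are at
    -- most `B` rounds, which raises the exponent by one.
    have h1 : b x * (c'' * (B + 1) ^ h'' + 6 + 4) ≤ (c'' + 10) * (B + 1) ^ (h'' + 1) := by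
      have h3 : 1 ≤ (B + 1) ^ h'' := Nat.one_le_pow _ _ (by omega)
      rw [pow_succ]
      nlinarith [Nat.mul_le_mul hbB (le_refl (c'' * (B + 1) ^ h'' + 10)),
        Nat.mul_le_mul_left (10 * B) h3]
    refine le_trans ?_ (poly_add_le c (c' + (c'' + 15) + 0) h (h' + (h'' + 1)) 10 B)
    have h2 := poly_add_le c' (c'' + 15) h' (h'' + 1) 0 B
    have h4 : 1 ≤ (B + 1) ^ (h'' + 1) := Nat.one_le_pow _ _ (by omega)
    simp only [Expr.cost]
    nlinarith
  · simp [Expr.eval, h₄.2.2.2]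

end Closure

end TwoLift

/-! ### Decisions and arithmetic in polynomial time -/

namespace TwoLift

section Closure

variable {α : Type} [Ctx α] {D : α → ℕ → Prop}

/-- `p` is decidable in polynomial time. -/
def CompP {α : Type} [Ctx α] (D : α → ℕ → Prop) (p : α → Prop) [DecidablePred p] : Prop :=
  Comp D fun x => if p x then 1 else 0

theorem Comp.ite_of {p : α → Prop} [DecidablePred p] {f g : α → ℕ} (hp : CompP D p)
    (hf : Comp (fun x B => D x B ∧ p x) f) (hg : Comp (fun x B => D x B ∧ ¬ p x) g) :
    Comp D fun x => if p x then f x else g x := by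
  refine (Comp.cases hp (g := f) (g' := g) (hf.mono ?_) (hg.mono ?_)).congr ?_
  · intro x B h; refine ⟨h.1, ?_⟩; by_contra h'; simp [h'] at h
  · intro x B h; refine ⟨h.1, ?_⟩; by_contra h'; simp [h'] at h
  · intro x B h; by_cases h' : p x <;> simp [h']

theorem Comp.ite {p : α → Prop} [DecidablePred p] {f g : α → ℕ} (hp : CompP D p)
    (hf : Comp D f) (hg : Comp D g) : Comp D fun x => if p x then f x else g x :=
  Comp.ite_of hp (hf.mono fun _ _ h => h.1) (hg.mono fun _ _ h => h.1)

/-- Truncated subtraction decides the order: `g x - f x` is nonzero exactly when `f x < g x`. -/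
theorem CompP.lt {f g : α → ℕ} (hf : Comp D f) (hg : Comp D g) : CompP D fun x => f x < g x := by
  refine ((hg.sub hf).cases (Comp.lit 1) (Comp.lit 0)).congr fun x B _ => ?_
  by_cases h : f x < g x
  · rw [if_pos h, if_pos (by omega)]
  · rw [if_neg h, if_neg (by omega)]

theorem CompP.not {p : α → Prop} [DecidablePred p] (hp : CompP D p) : CompP D fun x => ¬ p x := by
  refine (Comp.ite hp (Comp.lit 0) (Comp.lit 1)).congr fun x B _ => ?_
  by_cases h : p x <;> simp [h]

theorem CompP.and {p q : α → Prop} [DecidablePred p] [DecidablePred q] (hp : CompP D p)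
    (hq : CompP D q) : CompP D fun x => p x ∧ q x := by
  refine (Comp.ite hp hq (Comp.lit 0)).congr fun x B _ => ?_
  by_cases h : p x <;> simp [h]

theorem CompP.or {p q : α → Prop} [DecidablePred p] [DecidablePred q] (hp : CompP D p)
    (hq : CompP D q) : CompP D fun x => p x ∨ q x := by
  refine (Comp.ite hp (Comp.lit 1) hq).congr fun x B _ => ?_
  by_cases h : p x <;> simp [h]

theorem CompP.congr {p q : α → Prop} [DecidablePred p] [DecidablePred q] (hp : CompP D p)
    (h : ∀ x B, D x B → (q x ↔ p x)) : CompP D q :=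
  Comp.congr hp fun x B hD => by simp [h x B hD]

theorem CompP.le {f g : α → ℕ} (hf : Comp D f) (hg : Comp D g) : CompP D fun x => f x ≤ g x :=
  (CompP.lt hg hf).not.congr fun _ _ _ => not_lt.symm

theorem CompP.eq {f g : α → ℕ} (hf : Comp D f) (hg : Comp D g) : CompP D fun x => f x = g x :=
  ((CompP.le hf hg).and (CompP.le hg hf)).congr fun _ _ _ => le_antisymm_iff

theorem CompP.ne {f g : α → ℕ} (hf : Comp D f) (hg : Comp D g) : CompP D fun x => f x ≠ g x :=
  (CompP.eq hf hg).not

theorem sum_range_eq_rec (f : ℕ → ℕ) (n : ℕ) :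
    ∑ i ∈ Finset.range n, f i = Nat.rec 0 (fun i acc => acc + f i) n := by
  induction n with
  | zero => rfl
  | succ n ih => rw [Finset.sum_range_succ, ih]

/-- Weakening by an accumulator. -/
theorem Comp.acc {D' : α × ℕ → ℕ → Prop} {D'' : (α × ℕ) × ℕ → ℕ → Prop} {f : α → ℕ → ℕ}
    (hf : Comp D' fun y => f y.1 y.2) (h : ∀ x B, D'' x B → D' x.1 B) :
    Comp D'' fun y => f y.1.1 y.1.2 :=
  hf.fst h

theorem Comp.sum {b : α → ℕ} {f : α → ℕ → ℕ} (hb : Comp D b) (hB : ∀ x B, D x B → b x ≤ B)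
    (hf : Comp (fun (y : α × ℕ) B => D y.1 B ∧ y.2 < b y.1) fun y => f y.1 y.2) :
    Comp D fun x => ∑ i ∈ Finset.range (b x), f x i := by
  simp only [sum_range_eq_rec]
  exact Comp.nrec (g := fun x i acc => acc + f x i) hb (Comp.lit 0) hB
    (Comp.snd.add (hf.acc fun x B h => ⟨h.1, h.2.1⟩))

/-- The machine only adds, so a product is a repeated addition. One factor is the length of that
loop and must be at most `B`; the other may be arbitrarily large. -/
theorem Comp.mul {f g : α → ℕ} (hf : Comp D f) (hg : Comp D g) (hB : ∀ x B, D x B → f x ≤ B) :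
    Comp D fun x => f x * g x := by
  refine (Comp.sum (f := fun x _ => g x) hf hB (hg.fst fun x B h => h.1)).congr fun x B _ => ?_
  simp

theorem Comp.mul_right {f g : α → ℕ} (hf : Comp D f) (hg : Comp D g)
    (hB : ∀ x B, D x B → g x ≤ B) : Comp D fun x => f x * g x :=
  (Comp.mul hg hf hB).congr fun _ _ _ => mul_comm _ _

theorem prod_range_eq_rec (f : ℕ → ℕ) (n : ℕ) :
    ∏ i ∈ Finset.range n, f i = Nat.rec 1 (fun i acc => acc * f i) n := by
  induction n with
  | zero => rfl
  | succ n ih => rw [Finset.prod_range_succ, ih]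

theorem Comp.prod {b : α → ℕ} {f : α → ℕ → ℕ} (hb : Comp D b) (hB : ∀ x B, D x B → b x ≤ B)
    (hf : Comp (fun (y : α × ℕ) B => D y.1 B ∧ y.2 < b y.1) fun y => f y.1 y.2)
    (hfB : ∀ x B i, D x B → i < b x → f x i ≤ B) :
    Comp D fun x => ∏ i ∈ Finset.range (b x), f x i := by
  simp only [prod_range_eq_rec]
  exact Comp.nrec (g := fun x i acc => acc * f x i) hb (Comp.lit 1) hB
    (Comp.mul_right Comp.snd (hf.acc fun x B h => ⟨h.1, h.2.1⟩)
      fun x B h => hfB _ _ _ h.1 h.2.1)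

theorem Comp.pow {f g : α → ℕ} (hf : Comp D f) (hg : Comp D g) (hB : ∀ x B, D x B → f x ≤ B)
    (hB' : ∀ x B, D x B → g x ≤ B) : Comp D fun x => f x ^ g x := by
  refine (Comp.prod (f := fun x _ => f x) hg hB' (hf.fst fun x B h => h.1)
    fun x B _ h _ => hB x B h).congr fun x B _ => ?_
  simp

/-- The quotient counts the positive multiples of `b` up to `a`, which turns division into a bounded
sum. -/
theorem div_eq_sum {a b : ℕ} (hb : 0 < b) :
    a / b = ∑ t ∈ Finset.range a, if (t + 1) * b ≤ a then 1 else 0 := by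
  rw [← Finset.sum_filter, Finset.sum_const, smul_eq_mul, mul_one]
  have : (Finset.range a).filter (fun t => (t + 1) * b ≤ a) = Finset.range (a / b) := by
    ext t
    simp only [Finset.mem_filter, Finset.mem_range, ← Nat.le_div_iff_mul_le hb]
    have := Nat.div_le_self a b
    omega
  rw [this, Finset.card_range]

theorem Comp.div {f g : α → ℕ} (hf : Comp D f) (hg : Comp D g) (hB : ∀ x B, D x B → f x ≤ B)
    (h0 : ∀ x B, D x B → 0 < g x) : Comp D fun x => f x / g x := by
  refine (Comp.sum (f := fun x t => if (t + 1) * g x ≤ f x then 1 else 0) hf hB ?_).congr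
    fun x B h => div_eq_sum (h0 x B h)
  refine Comp.ite (CompP.le (Comp.mul (Comp.snd.add (Comp.lit 1)) (hg.fst fun x B h => h.1) ?_)
    (hf.fst fun x B h => h.1)) (Comp.lit 1) (Comp.lit 0)
  intro x B h
  have := hB _ _ h.1
  omega

theorem Comp.mod {f g : α → ℕ} (hf : Comp D f) (hg : Comp D g) (hB : ∀ x B, D x B → f x ≤ B)
    (h0 : ∀ x B, D x B → 0 < g x) : Comp D fun x => f x % g x := by
  refine (hf.sub (Comp.mul (hf.div hg hB h0) hg ?_)).congr fun x B h => ?_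
  · exact fun x B h => (Nat.div_le_self _ _).trans (hB x B h)
  · rw [Nat.mod_eq_sub_div_mul]

theorem prod_mod_eq_rec (f : ℕ → ℕ) (n : ℕ) {w : ℕ} (hw : 1 < w) :
    (∏ i ∈ Finset.range n, f i) % w = Nat.rec 1 (fun i acc => acc * f i % w) n := by
  induction n with
  | zero => simp [Nat.mod_eq_of_lt hw]
  | succ n ih => rw [Finset.prod_range_succ, Nat.mul_mod, ih]; simp [Nat.mul_mod]

/-- Division is a loop as long as its dividend, and a full product could exceed every admissible
loop length. Reducing after each factor keeps the accumulator below `w`. -/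
theorem Comp.prod_mod {b : α → ℕ} {f : α → ℕ → ℕ} {w : ℕ} (hw : 1 < w) (hb : Comp D b)
    (hB : ∀ x B, D x B → b x ≤ B)
    (hf : Comp (fun (y : α × ℕ) B => D y.1 B ∧ y.2 < b y.1) fun y => f y.1 y.2)
    (hfB : ∀ x B i, D x B → i < b x → w * (f x i + 1) ≤ B) :
    Comp D fun x => (∏ i ∈ Finset.range (b x), f x i) % w := by
  simp only [prod_mod_eq_rec _ _ hw]
  refine Comp.nrec (g := fun x i acc => acc * f x i % w) hb (Comp.lit 1) hB
    (Comp.mod (Comp.mul Comp.snd (hf.acc fun x B h => ⟨h.1, h.2.1⟩) ?_) (Comp.lit w) ?_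
      fun _ _ _ => by omega)
  all_goals
    intro x B h
    have h1 := hfB _ _ _ h.1 h.2.1
    have h2 : x.2 < w := by rw [h.2.2, ← prod_mod_eq_rec _ _ hw]; exact Nat.mod_lt _ (by omega)
  · nlinarith
  · nlinarith [Nat.mul_le_mul_right (f x.1.1 x.1.2) h2.le]

/-! ### Polynomial-time transformations of the memory -/

/-- `F` gives the memory contents after a polynomial-time program. -/
def Trans {α : Type} [Ctx α] (D : α → ℕ → Prop) (F : α → ℕ → ℕ) : Prop :=
  ∃ c h : ℕ, ∀ (l : Ctx.Lay α) (k : ℕ), Ctx.below l k → ∃ p : Prog, ∀ σ B, D (Ctx.read l σ) B →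
    Runs p σ (c * (B + 1) ^ h) fun σ' => σ'.mem = F (Ctx.read l σ) ∧ ∀ j < k, σ'.reg j = σ.reg j

theorem Trans.mono {D' : α → ℕ → Prop} {F : α → ℕ → ℕ} (hF : Trans D F)
    (h : ∀ x B, D' x B → D x B) : Trans D' F := by
  obtain ⟨c, e, H⟩ := hF
  refine ⟨c, e, fun l k hl => ?_⟩
  obtain ⟨p, hp⟩ := H l k hl
  exact ⟨p, fun σ B hD => hp σ B (h _ _ hD)⟩

theorem Trans.congr {F G : α → ℕ → ℕ} (hF : Trans D F) (h : ∀ x B, D x B → G x = F x) :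
    Trans D G := by
  obtain ⟨c, e, H⟩ := hF
  refine ⟨c, e, fun l k hl => ?_⟩
  obtain ⟨p, hp⟩ := H l k hl
  exact ⟨p, fun σ B hD => (hp σ B hD).mono le_rfl fun σ' h' => ⟨h'.1.trans (h _ _ hD).symm, h'.2⟩⟩

theorem Trans.store {a v : α → ℕ} (ha : Comp D a) (hv : Comp D v) :
    Trans D fun x => Function.update (Ctx.mem x) (a x) (v x) := by
  obtain ⟨c, h, H⟩ := ha
  obtain ⟨c', h', H'⟩ := hv
  refine ⟨c + c' + 3, h + h', fun l k hl => ?_⟩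
  obtain ⟨p, hp⟩ := H l k hl
  obtain ⟨q, hq⟩ := H' l (k + 1) (Ctx.below_mono hl (by omega))
  refine ⟨.seq p (.seq q (.store (.reg k) (.reg (k + 1)))), fun σ B hD => ?_⟩
  refine (Runs.seq (hp σ B hD) fun σ' hσ' => Runs.seq (hq σ' B ?_) fun σ'' hσ'' =>
    Runs.store ⟨?_, (hσ'.1.trans hσ''.1 (by omega)).2⟩).mono ?_ fun _ h => h
  · rw [hσ'.1.read hl]; exact hD
  · refine le_trans ?_ (poly_add_le c c' h h' 3 B)
    simp [Expr.cost]
  · simp [Expr.eval, hσ''.2, hσ'.2, hσ''.1.2 k (by omega), hσ'.1.read hl, hσ''.1.1, hσ'.1.1,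
      Ctx.mem_read]

/-- The second transformation reads a context whose memory has been replaced while its registers are
intact; `Ctx.upd` expresses this. -/
theorem Trans.seq {D' : α → ℕ → Prop} {F G : α → ℕ → ℕ} (hF : Trans D F) (hG : Trans D' G)
    (h : ∀ x B, D x B → D' (Ctx.upd x (F x)) B) : Trans D fun x => G (Ctx.upd x (F x)) := by
  obtain ⟨c, e, H⟩ := hF
  obtain ⟨c', e', H'⟩ := hG
  refine ⟨c + c' + 0, e + e', fun l k hl => ?_⟩
  obtain ⟨p, hp⟩ := H l k hl
  obtain ⟨q, hq⟩ := H' l k hl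
  refine ⟨.seq p q, fun σ B hD => ?_⟩
  refine (Runs.seq (hp σ B hD) fun σ' hσ' => (hq σ' B ?_).mono le_rfl fun σ'' hσ'' =>
    ⟨?_, fun j hj => (hσ''.2 j hj).trans (hσ'.2 j hj)⟩).mono ?_ fun _ h => h
  · rw [Ctx.read_upd hl hσ'.2, hσ'.1]; exact h _ _ hD
  · exact poly_add_le c c' e e' 0 B
  · rw [hσ''.1, Ctx.read_upd hl hσ'.2, hσ'.1]

/-- Computing a value first, and keeping it in a register. -/
theorem Trans.bind {D' : α × ℕ → ℕ → Prop} {v : α → ℕ} {G : α × ℕ → ℕ → ℕ} (hv : Comp D v)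
    (hG : Trans D' G) (h : ∀ x B, D x B → D' (x, v x) B) : Trans D fun x => G (x, v x) := by
  obtain ⟨c, e, H⟩ := hv
  obtain ⟨c', e', H'⟩ := hG
  refine ⟨c + c' + 0, e + e', fun l k hl => ?_⟩
  obtain ⟨p, hp⟩ := H l k hl
  obtain ⟨q, hq⟩ := H' (l, k) (k + 1) ⟨Ctx.below_mono hl (by omega), by change k < k + 1; omega⟩
  refine ⟨.seq p q, fun σ B hD => ?_⟩
  have key : ∀ σ' : State, Agree k σ σ' ∧ σ'.reg k = v (Ctx.read l σ) →
      Ctx.read (α := α × ℕ) (l, k) σ' = (Ctx.read l σ, v (Ctx.read l σ)) := by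
    intro σ' h'
    rw [← h'.2, ← h'.1.read hl]; rfl
  refine (Runs.seq (hp σ B hD) fun σ' hσ' => (hq σ' B ?_).mono le_rfl fun σ'' hσ'' =>
    ⟨?_, fun j hj => (hσ''.2 j (by omega)).trans (hσ'.1.2 j hj)⟩).mono ?_ fun _ h => h
  · rw [key σ' hσ']; exact h _ _ hD
  · exact poly_add_le c c' e e' 0 B
  · rw [hσ''.1, key σ' hσ']

/-- A counting loop that transforms the memory. -/
theorem Trans.iter {b : α → ℕ} {g : α × ℕ → ℕ → ℕ} (hb : Comp D b) (hB : ∀ x B, D x B → b x ≤ B)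
    (hg : Trans (fun (y : α × ℕ) B => ∃ x, D x B ∧ y.2 < b x ∧
      y.1 = Ctx.upd x (Nat.rec (Ctx.mem x) (fun q M => g (Ctx.upd x M, q)) y.2)) g) :
    Trans D fun x => (Nat.rec (Ctx.mem x) (fun q M => g (Ctx.upd x M, q)) (b x) : ℕ → ℕ) := by
  obtain ⟨c, h, H⟩ := hb
  obtain ⟨c'', h'', H''⟩ := hg
  refine ⟨c + (c'' + 15) + 10, h + (h'' + 1), fun l k hl => ?_⟩
  obtain ⟨p, hp⟩ := H l k hl
  -- registers: `k` bound, `k + 1` counter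
  obtain ⟨r, hr⟩ := H'' (l, k + 1) (k + 2)
    ⟨Ctx.below_mono hl (by omega), by change k + 1 < k + 2; omega⟩
  refine ⟨.seq p (.seq (.set (k + 1) (.lit 0))
    (.loop (.sub (.reg k) (.reg (k + 1))) (.seq r
      (.set (k + 1) (.add (.reg (k + 1)) (.lit 1)))))), fun σ B hD => ?_⟩
  set x := Ctx.read l σ with hx
  have key : ∀ τ : State, (∀ j < k, τ.reg j = σ.reg j) →
      Ctx.read (α := α × ℕ) (l, k + 1) τ = (Ctx.upd x τ.mem, τ.reg (k + 1)) := by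
    intro τ h'
    rw [hx, ← Ctx.read_upd hl h']; rfl
  refine (Runs.seq (hp σ B hD) fun σ₁ h₁ =>
    Runs.seq (Q := fun σ₃ => Agree k σ σ₃ ∧ σ₃.reg k = b x ∧ σ₃.reg (k + 1) = 0) (Runs.set ?_)
      fun σ₃ h₃ => (Runs.loop (T := c'' * (B + 1) ^ h'' + 4)
      (N := b x) (fun j τ => (∀ j < k, τ.reg j = σ.reg j) ∧ τ.reg k = b x ∧ τ.reg (k + 1) = j ∧
        τ.mem = Nat.rec (Ctx.mem x) (fun q M => g (Ctx.upd x M, q)) j) ?_ ?_ ?_).mono le_rfl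
      fun σ₄ h₄ => ⟨h₄.2.2.2, h₄.1⟩).mono ?_ fun _ h => h
  · refine ⟨h₁.1.trans (Agree.update _ (by omega)) le_rfl, ?_, ?_⟩
    · simp [h₁.2, ← hx]
    · simp [Expr.eval]
  · rintro j τ hj ⟨ha, hb', hc, hd⟩
    refine ⟨by simp [Expr.eval, hb', hc]; omega, ?_⟩
    refine (Runs.seq (hr τ B ?_) fun τ₁ t₁ => Runs.set ?_).mono ?_ fun _ h => h
    · rw [key τ ha]
      exact ⟨x, hD, by rw [hc]; exact hj, by rw [hc, hd]⟩
    · refine ⟨fun i hi => ?_, ?_, ?_, ?_⟩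
      · simp [show i ≠ k + 1 by omega, t₁.2 i (by omega), ha i hi]
      · simp [t₁.2 k (by omega), hb']
      · simp [Expr.eval, t₁.2 (k + 1) (by omega), hc]
      · simp only [t₁.1, key τ ha, hc, hd]
    · simp [Expr.cost]
  · rintro τ ⟨ha, hb', hc, hd⟩
    simp [Expr.eval, hb', hc]
  · refine ⟨h₃.1.2, h₃.2.1, h₃.2.2, ?_⟩
    rw [h₃.1.1, hx]; exact (Ctx.mem_read l σ).symm
  · have hbB := hB x B hD
    have h1 : b x * (c'' * (B + 1) ^ h'' + 4 + 4) ≤ (c'' + 10) * (B + 1) ^ (h'' + 1) := by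
      have h3 : 1 ≤ (B + 1) ^ h'' := Nat.one_le_pow _ _ (by omega)
      rw [pow_succ]
      nlinarith [Nat.mul_le_mul hbB (le_refl (c'' * (B + 1) ^ h'' + 8)),
        Nat.mul_le_mul_left (10 * B) h3]
    refine le_trans ?_ (poly_add_le c (c'' + 15) h (h'' + 1) 10 B)
    have h4 : 1 ≤ (B + 1) ^ (h'' + 1) := Nat.one_le_pow _ _ (by omega)
    simp only [Expr.cost]
    nlinarith

end Closure
end TwoLift

namespace TwoLift

/-! ### The potential function of a partial signing -/

/-- The `j`-th neighbor of `x`. -/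
def nbr (a : ℕ → ℕ → ℕ) (n x j : ℕ) : ℕ :=
  ∑ y ∈ Finset.range n,
    if a x y ≠ 0 ∧ (∑ z ∈ Finset.range y, if a x z ≠ 0 then 1 else 0) = j then y else 0

/-- The `i`-th digit of `e` in base `b`. -/
def dig (b e i : ℕ) : ℕ := e / b ^ i % b

/-- The `i`-th vertex of the walk with code `c`: the start vertex is `c % n`, and the digits of
`c / n` in base `b` give the steps, modulo `d`. -/
def walk (a : ℕ → ℕ → ℕ) (n d b c i : ℕ) : ℕ :=
  Nat.rec (c % n) (fun j v => nbr a n v (dig b (c / n) j % d)) i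

/-- The label that the walk of length `Q` with code `c` gives to the vertex `x`. -/
def lab (a : ℕ → ℕ → ℕ) (n d b c Q x : ℕ) : ℕ :=
  Nat.rec 0 (fun i v => if walk a n d b c i = x then dig b (c / n) i / d else v) Q

/-- `md z - 1` is the sign coded by `z`, where `0`, `1`, `2` code `0`, `1`, `-1`. -/
def md (z : ℕ) : ℕ := (z + 1) % 3

/-- The product attached to the labelled walk `c` and the partial signing `s`. -/
def labWeight (a s : ℕ → ℕ → ℕ) (n d Q c : ℕ) : ℕ :=
  ∏ x ∈ Finset.range n, ∏ y ∈ Finset.range n,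
    (2 + md (lab a n d (9 * d) c Q x % 3 * (lab a n d (9 * d) c Q y / 3) * s x y) +
      md (lab a n d (9 * d) c Q y % 3 * (lab a n d (9 * d) c Q x / 3) * s x y))

/-- The number of times that the walk `c` traverses the edge `xy`. -/
def visits (a : ℕ → ℕ → ℕ) (n d Q c x y : ℕ) : ℕ :=
  ∑ i ∈ Finset.range Q,
    if (walk a n d d c i = x ∧ walk a n d d c (i + 1) = y) ∨
      (walk a n d d c i = y ∧ walk a n d d c (i + 1) = x) then 1 else 0

/-- The code of the conditional expectation of the sign of the walk `c`. -/
def walkCode (a s : ℕ → ℕ → ℕ) (n d Q c : ℕ) : ℕ :=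
  (∏ x ∈ Finset.range n, (∏ y ∈ Finset.range n,
    if visits a n d Q c x y % 2 = 1 ∧ x < y then s x y else 1) % 3) % 3

/-- The potential of the partial signing `s` of the graph with adjacency matrix `a`. -/
def pot (a s : ℕ → ℕ → ℕ) (n d Q : ℕ) : ℕ :=
  (∑ c ∈ Finset.range (n * (9 * d) ^ Q), labWeight a s n d Q c) +
    n * (9 * d) ^ Q * ((∑ c ∈ Finset.range (n * d ^ Q),
      if walk a n d d c Q = walk a n d d c 0 then md (walkCode a s n d Q c) else 0) * 4 ^ (n * n))

/-- The part of the matrix `a` above the diagonal and before the position `q`, with `t` at `q`. -/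
def partialSign (a : ℕ → ℕ → ℕ) (n q t x y : ℕ) : ℕ :=
  if x < y then if n * x + y < q then a x y else if n * x + y = q then t else 0 else 0

/-- The degree of vertex `0`. -/
def deg0 (a : ℕ → ℕ → ℕ) (n : ℕ) : ℕ := ∑ y ∈ Finset.range n, if a 0 y ≠ 0 then 1 else 0

/-- `1 + ⌊log n⌋` for `n ≥ 1`. -/
def lg (n : ℕ) : ℕ := ∑ i ∈ Finset.range n, if 2 ^ i ≤ n then 1 else 0

/-- The matrix in memory. -/
def mat (M : ℕ → ℕ) (x y : ℕ) : ℕ := M (1 + (M 0 * x + y))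

/-- The potential with the pairs before the position `q` decided as in memory, and `t` at `q`. -/
def potAt (M : ℕ → ℕ) (q t : ℕ) : ℕ :=
  pot (mat M) (partialSign (mat M) (M 0) q t) (M 0) (deg0 (mat M) (M 0)) (2 * lg (M 0))

/-- The new entry at position `q`. -/
def newEntry (M : ℕ → ℕ) (q : ℕ) : ℕ :=
  if q / M 0 < q % M 0 then
    if M (1 + q) = 0 then 0 else if potAt M q 1 ≤ potAt M q 2 then 1 else 2
  else mat M (q % M 0) (q / M 0)

/-- The bounds that make the potential computable in polynomial time. -/
structure Small (M : ℕ → ℕ) (B : ℕ) : Prop where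
  n_pos : 0 < M 0
  d_pos : 0 < deg0 (mat M) (M 0)
  n_le : M 0 * M 0 ≤ B
  d_le : 9 * deg0 (mat M) (M 0) ≤ B
  walks_le : 2 * (M 0 * (9 * deg0 (mat M) (M 0)) ^ (2 * lg (M 0))) ≤ B
  le_two : ∀ x < M 0, ∀ y < M 0, mat M x y ≤ 2
  le : 100 ≤ B

theorem dig_lt {b e i : ℕ} (hb : 0 < b) : dig b e i < b := Nat.mod_lt _ hb

theorem lab_le {a : ℕ → ℕ → ℕ} {n d c Q x : ℕ} (hd : 0 < d) : lab a n d (9 * d) c Q x ≤ 8 := by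
  induction Q with
  | zero => simp [lab]
  | succ Q ih =>
    change (if walk a n d (9 * d) c Q = x then dig (9 * d) (c / n) Q / d else
      lab a n d (9 * d) c Q x) ≤ 8
    split_ifs
    · have := dig_lt (b := 9 * d) (e := c / n) (i := Q) (by omega)
      have : dig (9 * d) (c / n) Q / d < 9 := Nat.div_lt_of_lt_mul (by linarith)
      omega
    · exact ih

/-! ### Polynomial-time computation of walks and labels -/

section Computability

variable {α : Type} [Ctx α] {D : α → ℕ → Prop}

theorem Comp.fst₂ {D' : (α × ℕ) × ℕ → ℕ → Prop} {f : α → ℕ} (hf : Comp D f)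
    (h : ∀ x B, D' x B → D x.1.1 B) : Comp D' fun x => f x.1.1 :=
  (hf.fst (D' := fun x B => D x.1 B) fun _ _ h => h).fst h

theorem Comp.snd₂ {D' : (α × ℕ) × ℕ → ℕ → Prop} : Comp D' fun x => x.1.2 :=
  Comp.snd.fst (D := fun _ _ => True) fun _ _ _ => trivial

theorem comp_mem0 : Comp D fun x => Ctx.mem x 0 := Comp.cell (Comp.lit 0)

theorem comp_mat {u v : α → ℕ} (hu : Comp D u) (hv : Comp D v)
    (hD : ∀ x B, D x B → Ctx.mem x 0 ≤ B) : Comp D fun x => mat (Ctx.mem x) (u x) (v x) :=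
  Comp.cell ((Comp.lit 1).add ((Comp.mul comp_mem0 hu hD).add hv))

theorem comp_dig {b e i : α → ℕ} (hb : Comp D b) (he : Comp D e) (hi : Comp D i)
    (hB : ∀ x B, D x B → 0 < b x ∧ b x ≤ B ∧ e x ≤ B ∧ i x ≤ B) :
    Comp D fun x => dig (b x) (e x) (i x) :=
  Comp.mod (he.div (hb.pow hi (fun x B h => (hB x B h).2.1) fun x B h => (hB x B h).2.2.2)
    (fun x B h => (hB x B h).2.2.1) fun x B h => Nat.pow_pos (hB x B h).1) hb
    (fun x B h => (Nat.div_le_self _ _).trans (hB x B h).2.2.1) fun x B h => (hB x B h).1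

theorem comp_md {f : α → ℕ} (hf : Comp D f) (hB : ∀ x B, D x B → f x + 3 ≤ B) :
    Comp D fun x => md (f x) :=
  (hf.add (Comp.lit 1)).mod (Comp.lit 3) (fun x B h => by have := hB x B h; omega)
    fun _ _ _ => by norm_num

theorem Small.n_le' {M : ℕ → ℕ} {B : ℕ} (h : Small M B) : M 0 ≤ B :=
  (Nat.le_mul_self _).trans h.n_le

theorem Small.lg_le {M : ℕ → ℕ} {B : ℕ} (h : Small M B) : 2 * lg (M 0) + 1 ≤ B := by
  have := h.walks_le
  have h2 : 2 * lg (M 0) < (9 * deg0 (mat M) (M 0)) ^ (2 * lg (M 0)) :=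
    Nat.lt_pow_self (by have := h.d_pos; omega)
  have := h.n_pos
  nlinarith

variable (hD : ∀ x B, D x B → Small (Ctx.mem x) B)
include hD

theorem comp_deg0 : Comp D fun x => deg0 (mat (Ctx.mem x)) (Ctx.mem x 0) :=
  Comp.sum (f := fun x y => if mat (Ctx.mem x) 0 y ≠ 0 then 1 else 0) comp_mem0
    (fun x B h => (hD x B h).n_le')
    (Comp.ite (CompP.ne (comp_mat (Comp.lit 0) Comp.snd fun _ _ h => (hD _ _ h.1).n_le')
      (Comp.lit 0)) (Comp.lit 1) (Comp.lit 0))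

theorem comp_lg : Comp D fun x => lg (Ctx.mem x 0) :=
  Comp.sum (f := fun x i => if 2 ^ i ≤ Ctx.mem x 0 then 1 else 0) comp_mem0
    (fun x B h => (hD x B h).n_le')
    (Comp.ite (CompP.le (Comp.pow (Comp.lit 2) Comp.snd (fun x B h => by
      have := (hD _ _ h.1).le; omega) fun x B h => by
      have := (hD _ _ h.1).n_le'; have := h.2; omega) comp_mem0) (Comp.lit 1) (Comp.lit 0))

theorem comp_nbr {u j : α → ℕ} (hu : Comp D u) (hj : Comp D j) :
    Comp D fun x => nbr (mat (Ctx.mem x)) (Ctx.mem x 0) (u x) (j x) := by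
  refine Comp.sum (f := fun x y => if mat (Ctx.mem x) (u x) y ≠ 0 ∧
    (∑ z ∈ Finset.range y, if mat (Ctx.mem x) (u x) z ≠ 0 then 1 else 0) = j x then y else 0)
    comp_mem0 (fun x B h => (hD x B h).n_le') ?_
  refine Comp.ite (CompP.and (CompP.ne (comp_mat (hu.fst fun x B h => h.1) Comp.snd
    fun x B h => (hD _ _ h.1).n_le') (Comp.lit 0)) (CompP.eq ?_ (hj.fst fun x B h => h.1)))
    Comp.snd (Comp.lit 0)
  refine Comp.sum (f := fun x z => if mat (Ctx.mem x) (u x.1) z ≠ 0 then 1 else 0) Comp.snd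
    (fun x B h => ?_) ?_
  · have := (hD _ _ h.1).n_le'; have := h.2; omega
  · exact Comp.ite (CompP.ne (comp_mat (hu.fst₂ fun x B h => h.1.1) Comp.snd
      fun x B h => (hD _ _ h.1.1).n_le') (Comp.lit 0)) (Comp.lit 1) (Comp.lit 0)

theorem comp_walk {b c i : α → ℕ} (hb : Comp D b) (hc : Comp D c) (hi : Comp D i)
    (hB : ∀ x B, D x B → 0 < b x ∧ b x ≤ B ∧ c x ≤ B ∧ i x ≤ B) :
    Comp D fun x => walk (mat (Ctx.mem x)) (Ctx.mem x 0)
      (deg0 (mat (Ctx.mem x)) (Ctx.mem x 0)) (b x) (c x) (i x) := by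
  refine Comp.nrec (g := fun x j v => nbr (mat (Ctx.mem x)) (Ctx.mem x 0) v
    (dig (b x) (c x / Ctx.mem x 0) j % deg0 (mat (Ctx.mem x)) (Ctx.mem x 0))) hi
    (Comp.mod hc comp_mem0 (fun x B h => (hB x B h).2.2.1) fun x B h => (hD x B h).n_pos)
    (fun x B h => (hB x B h).2.2.2) ?_
  refine comp_nbr ?_ Comp.snd (Comp.mod (comp_dig (hb.fst₂ ?_)
    (Comp.div (hc.fst₂ ?_) comp_mem0 ?_ ?_) Comp.snd₂ ?_) (comp_deg0 ?_) ?_ ?_)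
  all_goals
    intro x B h
    have h0 := hD _ _ h.1
    have h1 := hB _ _ h.1
  · exact h0
  · exact h.1
  · exact h.1
  · exact h1.2.2.1
  · exact h0.n_pos
  · exact ⟨h1.1, h1.2.1, (Nat.div_le_self _ _).trans h1.2.2.1, h.2.1.le.trans h1.2.2.2⟩
  · exact h0
  · exact (dig_lt h1.1).le.trans h1.2.1
  · exact h0.d_pos

theorem comp_lab {c u : α → ℕ} (hc : Comp D c) (hu : Comp D u) (hB : ∀ x B, D x B → c x ≤ B) :
    Comp D fun x => lab (mat (Ctx.mem x)) (Ctx.mem x 0) (deg0 (mat (Ctx.mem x)) (Ctx.mem x 0))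
      (9 * deg0 (mat (Ctx.mem x)) (Ctx.mem x 0)) (c x) (2 * lg (Ctx.mem x 0)) (u x) := by
  refine Comp.nrec (i := fun _ => 0) (g := fun x i v => if walk (mat (Ctx.mem x))
    (Ctx.mem x 0) (deg0 (mat (Ctx.mem x)) (Ctx.mem x 0))
    (9 * deg0 (mat (Ctx.mem x)) (Ctx.mem x 0)) (c x) i = u x then
    dig (9 * deg0 (mat (Ctx.mem x)) (Ctx.mem x 0)) (c x / Ctx.mem x 0) i /
      deg0 (mat (Ctx.mem x)) (Ctx.mem x 0) else v)
    ((Comp.lit 2).mul (comp_lg hD) ?_) (Comp.lit 0) ?_ ?_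
  · intro x B h; have := (hD x B h).le; omega
  · intro x B h; have := (hD x B h).lg_le; omega
  refine Comp.ite (CompP.eq (comp_walk ?_ (Comp.mul (Comp.lit 9) (comp_deg0 ?_) ?_)
    (hc.fst₂ ?_) Comp.snd₂ ?_) (hu.fst₂ ?_))
    (Comp.div (comp_dig (Comp.mul (Comp.lit 9) (comp_deg0 ?_) ?_)
      (Comp.div (hc.fst₂ ?_) comp_mem0 ?_ ?_) Comp.snd₂ ?_) (comp_deg0 ?_) ?_ ?_) Comp.snd
  all_goals
    intro x B h
    have h0 := hD _ _ h.1
    have h2 := hB _ _ h.1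
    have h3 := h0.lg_le
    have h4 := h.2.1
    have h5 := h0.d_pos
    have h6 := h0.d_le
    have h7 := h0.le
    first
    | exact h0
    | exact h.1
    | exact h2
    | exact h5
    | exact h0.n_pos
    | exact (by omega : 9 ≤ B)
    | exact (dig_lt (by omega)).le.trans h6
    | exact ⟨by omega, h6, h2, by omega⟩
    | exact ⟨by omega, h6, (Nat.div_le_self _ _).trans h2, by omega⟩

theorem comp_visits {c u v : α → ℕ} (hc : Comp D c) (hu : Comp D u) (hv : Comp D v)
    (hB : ∀ x B, D x B → c x ≤ B) :
    Comp D fun x => visits (mat (Ctx.mem x)) (Ctx.mem x 0) (deg0 (mat (Ctx.mem x)) (Ctx.mem x 0))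
      (2 * lg (Ctx.mem x 0)) (c x) (u x) (v x) := by
  refine Comp.sum (f := fun x i =>
    if (walk (mat (Ctx.mem x)) (Ctx.mem x 0) (deg0 (mat (Ctx.mem x)) (Ctx.mem x 0))
          (deg0 (mat (Ctx.mem x)) (Ctx.mem x 0)) (c x) i = u x ∧
        walk (mat (Ctx.mem x)) (Ctx.mem x 0) (deg0 (mat (Ctx.mem x)) (Ctx.mem x 0))
          (deg0 (mat (Ctx.mem x)) (Ctx.mem x 0)) (c x) (i + 1) = v x) ∨
      (walk (mat (Ctx.mem x)) (Ctx.mem x 0) (deg0 (mat (Ctx.mem x)) (Ctx.mem x 0))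
          (deg0 (mat (Ctx.mem x)) (Ctx.mem x 0)) (c x) i = v x ∧
        walk (mat (Ctx.mem x)) (Ctx.mem x 0) (deg0 (mat (Ctx.mem x)) (Ctx.mem x 0))
          (deg0 (mat (Ctx.mem x)) (Ctx.mem x 0)) (c x) (i + 1) = u x) then 1 else 0)
    ((Comp.lit 2).mul (comp_lg hD) ?_) ?_ ?_
  · intro x B h; have := (hD x B h).le; omega
  · intro x B h; have := (hD x B h).lg_le; omega
  have hw : ∀ i : α × ℕ → ℕ, Comp (fun (y : α × ℕ) B => D y.1 B ∧ y.2 < 2 * lg (Ctx.mem y.1 0)) i →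
      (∀ y B, D y.1 B ∧ y.2 < 2 * lg (Ctx.mem y.1 0) → i y ≤ B) →
      Comp (fun (y : α × ℕ) B => D y.1 B ∧ y.2 < 2 * lg (Ctx.mem y.1 0)) fun y =>
        walk (mat (Ctx.mem y.1)) (Ctx.mem y.1 0) (deg0 (mat (Ctx.mem y.1)) (Ctx.mem y.1 0))
          (deg0 (mat (Ctx.mem y.1)) (Ctx.mem y.1 0)) (c y.1) (i y) := by
    intro i hi hiB
    refine comp_walk ?_ (comp_deg0 ?_) (hc.fst ?_) hi ?_
    all_goals
      intro x B h
      have h0 := hD _ _ h.1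
      have h2 := hB _ _ h.1
      have h6 := h0.d_le
      first
      | exact h0
      | exact h.1
      | exact ⟨h0.d_pos, by omega, h2, hiB _ _ h⟩
  have h1 := hw (fun y => y.2) Comp.snd fun y B h => by have := (hD _ _ h.1).lg_le; omega
  have h2 := hw (fun y => y.2 + 1) (Comp.snd.add (Comp.lit 1))
    fun y B h => by have := (hD _ _ h.1).lg_le; omega
  have hu' := hu.fst (D' := fun y B => D y.1 B ∧ y.2 < 2 * lg (Ctx.mem y.1 0)) fun x B h => h.1
  have hv' := hv.fst (D' := fun y B => D y.1 B ∧ y.2 < 2 * lg (Ctx.mem y.1 0)) fun x B h => h.1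
  exact Comp.ite (CompP.or (CompP.and (CompP.eq h1 hu') (CompP.eq h2 hv'))
    (CompP.and (CompP.eq h1 hv') (CompP.eq h2 hu'))) (Comp.lit 1) (Comp.lit 0)

end Computability
end TwoLift

/-! ### Polynomial-time computation of the potential -/

namespace TwoLift

section Computability

variable {α : Type} [Ctx α] {D : α → ℕ → Prop}

theorem mul_prod_range_eq_rec (f : ℕ → ℕ) (v n : ℕ) :
    v * ∏ i ∈ Finset.range n, f i = Nat.rec v (fun i acc => acc * f i) n := by
  induction n with
  | zero => simp
  | succ n ih => rw [Finset.prod_range_succ, ← mul_assoc, ih]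

/-- The product of a row is too large to be the short factor of a multiplication, so `Comp.prod`
cannot be nested. One accumulator runs through both loops instead, and only single entries, which
are at most `B`, are multiplied onto it. -/
theorem Comp.prod₂ {b b' : α → ℕ} {f : α → ℕ → ℕ → ℕ} (hb : Comp D b) (hb' : Comp D b')
    (hB : ∀ x B, D x B → b x ≤ B) (hB' : ∀ x B, D x B → b' x ≤ B)
    (hf : Comp (fun (y : (α × ℕ) × ℕ) B => D y.1.1 B ∧ y.1.2 < b y.1.1 ∧ y.2 < b' y.1.1)
      fun y => f y.1.1 y.1.2 y.2)
    (hfB : ∀ x B i j, D x B → i < b x → j < b' x → f x i j ≤ B) :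
    Comp D fun x => ∏ i ∈ Finset.range (b x), ∏ j ∈ Finset.range (b' x), f x i j := by
  simp only [prod_range_eq_rec (fun i => ∏ j ∈ Finset.range _, f _ i j), mul_prod_range_eq_rec]
  refine Comp.nrec (g := fun x i acc => Nat.rec acc (fun j v => v * f x i j) (b' x)) hb
    (Comp.lit 1) hB ?_
  refine Comp.nrec (b := fun y : (α × ℕ) × ℕ => b' y.1.1) (i := fun y => y.2)
    (g := fun y j v => v * f y.1.1 y.1.2 j) (hb'.fst₂ fun x B h => h.1) Comp.snd
    (fun x B h => hB' _ _ h.1) ?_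
  refine Comp.mul_right Comp.snd ?_ fun x B h => hfB _ _ _ _ h.1.1 h.1.2.1 h.2.1
  -- the accumulators of the two loops are dropped
  obtain ⟨c, e, H⟩ := hf
  refine ⟨c, e, fun l k hl => ?_⟩
  obtain ⟨p, hp⟩ := H ((l.1.1.1.1, l.1.1.1.2), l.1.2) k ⟨hl.1.1.1, hl.1.2⟩
  exact ⟨p, fun σ B h => hp σ B ⟨h.1.1, h.1.2.1, h.2.1⟩⟩

theorem comp_partialSign {q t u v : α → ℕ} (hq : Comp D q) (ht : Comp D t) (hu : Comp D u)
    (hv : Comp D v) (hD : ∀ x B, D x B → Ctx.mem x 0 ≤ B) :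
    Comp D fun x => partialSign (mat (Ctx.mem x)) (Ctx.mem x 0) (q x) (t x) (u x) (v x) := by
  have hi : Comp D fun x => Ctx.mem x 0 * u x + v x := (Comp.mul comp_mem0 hu hD).add hv
  exact Comp.ite (CompP.lt hu hv) (Comp.ite (CompP.lt hi hq) (comp_mat hu hv hD)
    (Comp.ite (CompP.eq hi hq) ht (Comp.lit 0))) (Comp.lit 0)

theorem partialSign_le {a : ℕ → ℕ → ℕ} {n q t x y : ℕ} (ha : a x y ≤ 2) (ht : t ≤ 2) :
    partialSign a n q t x y ≤ 2 := by
  unfold partialSign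
  split_ifs <;> omega

theorem md_le (z : ℕ) : md z ≤ 2 := Nat.le_of_lt_succ (Nat.mod_lt _ (by norm_num))

variable (hD : ∀ x B, D x B → Small (Ctx.mem x) B)
include hD

theorem comp_labWeight {c q t : α → ℕ} (hc : Comp D c) (hq : Comp D q) (ht : Comp D t)
    (hB : ∀ x B, D x B → c x ≤ B ∧ t x ≤ 2) :
    Comp D fun x => labWeight (mat (Ctx.mem x))
      (partialSign (mat (Ctx.mem x)) (Ctx.mem x 0) (q x) (t x)) (Ctx.mem x 0)
      (deg0 (mat (Ctx.mem x)) (Ctx.mem x 0)) (2 * lg (Ctx.mem x 0)) (c x) := by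
  refine Comp.prod₂ (b := fun x => Ctx.mem x 0) (b' := fun x => Ctx.mem x 0)
    (f := fun x u v =>
      (2 + md (lab (mat (Ctx.mem x)) (Ctx.mem x 0) (deg0 (mat (Ctx.mem x)) (Ctx.mem x 0))
          (9 * deg0 (mat (Ctx.mem x)) (Ctx.mem x 0)) (c x) (2 * lg (Ctx.mem x 0)) u % 3 *
        (lab (mat (Ctx.mem x)) (Ctx.mem x 0) (deg0 (mat (Ctx.mem x)) (Ctx.mem x 0))
          (9 * deg0 (mat (Ctx.mem x)) (Ctx.mem x 0)) (c x) (2 * lg (Ctx.mem x 0)) v / 3) *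
        partialSign (mat (Ctx.mem x)) (Ctx.mem x 0) (q x) (t x) u v) +
      md (lab (mat (Ctx.mem x)) (Ctx.mem x 0) (deg0 (mat (Ctx.mem x)) (Ctx.mem x 0))
          (9 * deg0 (mat (Ctx.mem x)) (Ctx.mem x 0)) (c x) (2 * lg (Ctx.mem x 0)) v % 3 *
        (lab (mat (Ctx.mem x)) (Ctx.mem x 0) (deg0 (mat (Ctx.mem x)) (Ctx.mem x 0))
          (9 * deg0 (mat (Ctx.mem x)) (Ctx.mem x 0)) (c x) (2 * lg (Ctx.mem x 0)) u / 3) *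
        partialSign (mat (Ctx.mem x)) (Ctx.mem x 0) (q x) (t x) u v)))
    comp_mem0 comp_mem0 (fun x B h => (hD _ _ h).n_le') (fun x B h => (hD _ _ h).n_le') ?_ ?_
  swap
  · intro x B i j h _ _
    refine le_trans (add_le_add (add_le_add le_rfl (md_le _)) (md_le _)) ?_
    have := (hD _ _ h).le
    omega
  set D' : (α × ℕ) × ℕ → ℕ → Prop :=
    fun y B => D y.1.1 B ∧ y.1.2 < Ctx.mem y.1.1 0 ∧ y.2 < Ctx.mem y.1.1 0 with hD'
  have hl : ∀ u : (α × ℕ) × ℕ → ℕ, Comp D' u → Comp D' fun y =>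
      lab (mat (Ctx.mem y.1.1)) (Ctx.mem y.1.1 0) (deg0 (mat (Ctx.mem y.1.1)) (Ctx.mem y.1.1 0))
        (9 * deg0 (mat (Ctx.mem y.1.1)) (Ctx.mem y.1.1 0)) (c y.1.1) (2 * lg (Ctx.mem y.1.1 0))
        (u y) := by
    intro u hu
    refine comp_lab ?_ (hc.fst₂ ?_) hu ?_
    exacts [fun y B h => hD _ _ h.1, fun x B h => h.1, fun y B h => (hB _ _ h.1).1]
  have hlB : ∀ (y : (α × ℕ) × ℕ) (B u : ℕ), D' y B →
      lab (mat (Ctx.mem y.1.1)) (Ctx.mem y.1.1 0) (deg0 (mat (Ctx.mem y.1.1)) (Ctx.mem y.1.1 0))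
        (9 * deg0 (mat (Ctx.mem y.1.1)) (Ctx.mem y.1.1 0)) (c y.1.1) (2 * lg (Ctx.mem y.1.1 0))
        u ≤ 8 := fun y B u h => lab_le (hD _ _ h.1).d_pos
  have hs : Comp D' fun y => partialSign (mat (Ctx.mem y.1.1)) (Ctx.mem y.1.1 0) (q y.1.1)
      (t y.1.1) y.1.2 y.2 := by
    refine comp_partialSign (α := (α × ℕ) × ℕ) (hq.fst₂ ?_) (ht.fst₂ ?_) Comp.snd₂ Comp.snd ?_
    exacts [fun x B h => h.1, fun x B h => h.1, fun y B h => (hD _ _ h.1).n_le']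
  have hm : ∀ u v : (α × ℕ) × ℕ → ℕ, Comp D' u → Comp D' v → Comp D' fun y =>
      md (lab (mat (Ctx.mem y.1.1)) (Ctx.mem y.1.1 0) (deg0 (mat (Ctx.mem y.1.1)) (Ctx.mem y.1.1 0))
          (9 * deg0 (mat (Ctx.mem y.1.1)) (Ctx.mem y.1.1 0)) (c y.1.1) (2 * lg (Ctx.mem y.1.1 0))
          (u y) % 3 *
        (lab (mat (Ctx.mem y.1.1)) (Ctx.mem y.1.1 0) (deg0 (mat (Ctx.mem y.1.1)) (Ctx.mem y.1.1 0))
          (9 * deg0 (mat (Ctx.mem y.1.1)) (Ctx.mem y.1.1 0)) (c y.1.1) (2 * lg (Ctx.mem y.1.1 0))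
          (v y) / 3) *
        partialSign (mat (Ctx.mem y.1.1)) (Ctx.mem y.1.1 0) (q y.1.1) (t y.1.1) y.1.2 y.2) := by
    intro u v hu hv
    refine comp_md (Comp.mul (Comp.mul (Comp.mod (hl u hu) (Comp.lit 3) ?_ ?_)
      (Comp.div (hl v hv) (Comp.lit 3) ?_ ?_) ?_) hs ?_) ?_
    all_goals
      intro y B h
      have h1 := hlB y B (u y) h
      have h2 := hlB y B (v y) h
      have h0 := hD _ _ h.1
      have h100 := h0.le
      have h3 : partialSign (mat (Ctx.mem y.1.1)) (Ctx.mem y.1.1 0) (q y.1.1) (t y.1.1) y.1.2 y.2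
        ≤ 2 := partialSign_le (h0.le_two _ h.2.1 _ h.2.2) (hB _ _ h.1).2
      generalize lab _ _ _ _ _ _ (u y) = p1 at *
      generalize lab _ _ _ _ _ _ (v y) = p2 at *
      try generalize partialSign _ _ _ _ _ _ = p3 at *
      have h4 : p1 % 3 ≤ 2 := by omega
      have h5 : p2 / 3 ≤ 2 := by omega
      first
      | omega
      | exact (Nat.mul_le_mul h4 h5).trans (by omega)
      | exact (Nat.add_le_add_right (Nat.mul_le_mul (Nat.mul_le_mul h4 h5) h3) 3).trans (by omega)
  exact ((Comp.lit 2).add (hm _ _ Comp.snd₂ Comp.snd)).add (hm _ _ Comp.snd Comp.snd₂)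

theorem comp_walkCode {c q t : α → ℕ} (hc : Comp D c) (hq : Comp D q) (ht : Comp D t)
    (hB : ∀ x B, D x B → c x ≤ B ∧ t x ≤ 2) :
    Comp D fun x => walkCode (mat (Ctx.mem x))
      (partialSign (mat (Ctx.mem x)) (Ctx.mem x 0) (q x) (t x)) (Ctx.mem x 0)
      (deg0 (mat (Ctx.mem x)) (Ctx.mem x 0)) (2 * lg (Ctx.mem x 0)) (c x) := by
  refine Comp.prod_mod (b := fun x => Ctx.mem x 0) (f := fun x u => (∏ v ∈ Finset.range (Ctx.mem x 0),
    if visits (mat (Ctx.mem x)) (Ctx.mem x 0) (deg0 (mat (Ctx.mem x)) (Ctx.mem x 0))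
      (2 * lg (Ctx.mem x 0)) (c x) u v % 2 = 1 ∧ u < v then
      partialSign (mat (Ctx.mem x)) (Ctx.mem x 0) (q x) (t x) u v else 1) % 3)
    (by norm_num) comp_mem0 (fun x B h => (hD _ _ h).n_le') ?_ ?_
  swap
  · intro x B i h _
    have := (hD _ _ h).le
    have := Nat.mod_lt (∏ v ∈ Finset.range (Ctx.mem x 0),
      if visits (mat (Ctx.mem x)) (Ctx.mem x 0) (deg0 (mat (Ctx.mem x)) (Ctx.mem x 0))
        (2 * lg (Ctx.mem x 0)) (c x) i v % 2 = 1 ∧ i < v then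
        partialSign (mat (Ctx.mem x)) (Ctx.mem x 0) (q x) (t x) i v else 1) (y := 3) (by norm_num)
    omega
  refine Comp.prod_mod (b := fun y : α × ℕ => Ctx.mem y.1 0) (f := fun y v =>
    if visits (mat (Ctx.mem y.1)) (Ctx.mem y.1 0) (deg0 (mat (Ctx.mem y.1)) (Ctx.mem y.1 0))
      (2 * lg (Ctx.mem y.1 0)) (c y.1) y.2 v % 2 = 1 ∧ y.2 < v then
      partialSign (mat (Ctx.mem y.1)) (Ctx.mem y.1 0) (q y.1) (t y.1) y.2 v else 1)
    (by norm_num) comp_mem0 (fun x B h => (hD _ _ h.1).n_le') ?_ ?_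
  swap
  · intro y B j h hj
    have h0 := hD _ _ h.1
    have h3 : partialSign (mat (Ctx.mem y.1)) (Ctx.mem y.1 0) (q y.1) (t y.1) y.2 j
        ≤ 2 := partialSign_le (h0.le_two _ h.2 _ hj) (hB _ _ h.1).2
    have := h0.le
    split_ifs <;> omega
  refine Comp.ite (CompP.and (CompP.eq (Comp.mod (comp_visits ?_ (hc.fst₂ ?_) Comp.snd₂ Comp.snd ?_)
    (Comp.lit 2) ?_ ?_) (Comp.lit 1)) (CompP.lt Comp.snd₂ Comp.snd))
    (comp_partialSign (α := (α × ℕ) × ℕ) (hq.fst₂ ?_) (ht.fst₂ ?_) Comp.snd₂ Comp.snd ?_) (Comp.lit 1)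
  all_goals
    intro y B h
    have h0 := hD _ _ h.1.1
    first
    | exact h0
    | exact h.1.1
    | exact (hB _ _ h.1.1).1
    | exact h0.n_le'
    | exact (by norm_num : 0 < 2)
    | refine le_trans ?_ (h0.lg_le.trans' (Nat.le_succ _))
      unfold visits
      refine (Finset.sum_le_sum (g := fun _ => 1) fun i _ => ?_).trans (by simp)
      split_ifs <;> simp

theorem comp_potAt {q t : α → ℕ} (hq : Comp D q) (ht : Comp D t) (hB : ∀ x B, D x B → t x ≤ 2) :
    Comp D fun x => potAt (Ctx.mem x) (q x) (t x) := by
  have hd : Comp D fun x => deg0 (mat (Ctx.mem x)) (Ctx.mem x 0) := comp_deg0 hD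
  have hlg : Comp D fun x => 2 * lg (Ctx.mem x 0) :=
    (Comp.lit 2).mul (comp_lg hD) fun x B h => by have := (hD x B h).le; omega
  have hQ : ∀ x B, D x B → 2 * lg (Ctx.mem x 0) ≤ B := fun x B h => by
    have := (hD x B h).lg_le; omega
  have hW : Comp D fun x =>
      Ctx.mem x 0 * (9 * deg0 (mat (Ctx.mem x)) (Ctx.mem x 0)) ^ (2 * lg (Ctx.mem x 0)) :=
    Comp.mul comp_mem0 (Comp.pow ((Comp.lit 9).mul hd fun x B h => by
      have := (hD x B h).le; omega) hlg (fun x B h => (hD x B h).d_le) hQ)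
      fun x B h => (hD x B h).n_le'
  have hW' : Comp D fun x =>
      Ctx.mem x 0 * deg0 (mat (Ctx.mem x)) (Ctx.mem x 0) ^ (2 * lg (Ctx.mem x 0)) :=
    Comp.mul comp_mem0 (Comp.pow hd hlg (fun x B h => by have := (hD x B h).d_le; omega) hQ)
      fun x B h => (hD x B h).n_le'
  -- The terms of the sum over closed walks are at most 2, so twice the number of walks bounds that
  -- sum. It can then be the short factor in the product with the huge number `4 ^ (n * n)`.
  have hWW : ∀ x B, D x B →
      2 * (Ctx.mem x 0 * deg0 (mat (Ctx.mem x)) (Ctx.mem x 0) ^ (2 * lg (Ctx.mem x 0))) ≤ B :=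
    fun x B h => le_trans (by gcongr; omega) (hD x B h).walks_le
  refine Comp.add (Comp.sum (f := fun x c => labWeight (mat (Ctx.mem x))
      (partialSign (mat (Ctx.mem x)) (Ctx.mem x 0) (q x) (t x)) (Ctx.mem x 0)
      (deg0 (mat (Ctx.mem x)) (Ctx.mem x 0)) (2 * lg (Ctx.mem x 0)) c) hW
      (fun x B h => by have := (hD x B h).walks_le; omega) ?_)
    (Comp.mul hW (Comp.mul (Comp.sum (f := fun x c =>
      if walk (mat (Ctx.mem x)) (Ctx.mem x 0) (deg0 (mat (Ctx.mem x)) (Ctx.mem x 0))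
          (deg0 (mat (Ctx.mem x)) (Ctx.mem x 0)) c (2 * lg (Ctx.mem x 0)) =
        walk (mat (Ctx.mem x)) (Ctx.mem x 0) (deg0 (mat (Ctx.mem x)) (Ctx.mem x 0))
          (deg0 (mat (Ctx.mem x)) (Ctx.mem x 0)) c 0 then md (walkCode (mat (Ctx.mem x))
      (partialSign (mat (Ctx.mem x)) (Ctx.mem x 0) (q x) (t x)) (Ctx.mem x 0)
      (deg0 (mat (Ctx.mem x)) (Ctx.mem x 0)) (2 * lg (Ctx.mem x 0)) c) else 0) hW'
      (fun x B h => by have := hWW x B h; omega) ?_) (Comp.pow (Comp.lit 4)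
      (Comp.mul comp_mem0 comp_mem0 fun x B h => (hD x B h).n_le')
      (fun x B h => by have := (hD x B h).le; omega) fun x B h => (hD x B h).n_le) ?_)
      fun x B h => by have := (hD x B h).walks_le; omega)
  · refine comp_labWeight ?_ Comp.snd (hq.fst ?_) (ht.fst ?_) ?_
    all_goals
      intro y B h
      have h0 := hD _ _ h.1
      have h1 := h0.walks_le
      have h2 := h.2
      first
      | exact h0
      | exact h.1
      | exact ⟨by omega, hB _ _ h.1⟩
  · have hwk : ∀ i : α × ℕ → ℕ, Comp (fun (y : α × ℕ) B => D y.1 B ∧ y.2 < Ctx.mem y.1 0 *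
        deg0 (mat (Ctx.mem y.1)) (Ctx.mem y.1 0) ^ (2 * lg (Ctx.mem y.1 0))) i →
        (∀ y B, D y.1 B → i y ≤ B) →
        Comp (fun (y : α × ℕ) B => D y.1 B ∧ y.2 < Ctx.mem y.1 0 *
        deg0 (mat (Ctx.mem y.1)) (Ctx.mem y.1 0) ^ (2 * lg (Ctx.mem y.1 0))) fun y =>
        walk (mat (Ctx.mem y.1)) (Ctx.mem y.1 0) (deg0 (mat (Ctx.mem y.1)) (Ctx.mem y.1 0))
          (deg0 (mat (Ctx.mem y.1)) (Ctx.mem y.1 0)) y.2 (i y) := by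
      intro i hi hiB
      refine comp_walk ?_ (comp_deg0 ?_) Comp.snd hi ?_
      all_goals
        intro x B h
        have h0 := hD _ _ h.1
        have h2 := hWW _ _ h.1
        have h3 := h.2
        have h6 := h0.d_le
        first
        | exact h0
        | exact h.1
        | exact ⟨h0.d_pos, by omega, by omega, hiB _ _ h.1⟩
    refine Comp.ite (CompP.eq (hwk _ (hlg.fst fun x B h => h.1) fun y B h => hQ _ _ h)
      (hwk _ (Comp.lit 0) fun _ _ _ => Nat.zero_le _)) (comp_md (comp_walkCode ?_ Comp.snd
      (hq.fst ?_) (ht.fst ?_) ?_) ?_) (Comp.lit 0)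
    all_goals
      intro y B h
      have h0 := hD _ _ h.1
      have h1 := hWW _ _ h.1
      have h2 := h.2
      have h3 := h0.le
      first
      | exact h0
      | exact h.1
      | exact ⟨by omega, hB _ _ h.1⟩
      | exact (Nat.add_le_add_right (Nat.mod_lt _ (by norm_num : 0 < 3)).le 3).trans (by omega)
  · intro x B h
    refine le_trans ((Finset.sum_le_sum (g := fun _ => 2) fun c _ => ?_).trans ?_) (hWW x B h)
    · split_ifs
      · exact md_le _
      · exact Nat.zero_le _
    · simp [mul_comm]

theorem comp_newEntry {q : α → ℕ} (hq : Comp D q) (hB : ∀ x B, D x B → q x ≤ B) :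
    Comp D fun x => newEntry (Ctx.mem x) (q x) := by
  have hn : ∀ x B, D x B → 0 < Ctx.mem x 0 := fun x B h => (hD x B h).n_pos
  have h1 := hq.div comp_mem0 hB hn
  have h2 := hq.mod comp_mem0 hB hn
  exact Comp.ite (CompP.lt h1 h2) (Comp.ite (CompP.eq (Comp.cell ((Comp.lit 1).add hq)) (Comp.lit 0))
    (Comp.lit 0) (Comp.ite (CompP.le (comp_potAt hD hq (Comp.lit 1) fun _ _ _ => by norm_num)
      (comp_potAt hD hq (Comp.lit 2) fun _ _ _ => by norm_num)) (Comp.lit 1) (Comp.lit 2)))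
    (comp_mat h2 h1 fun x B h => (hD x B h).n_le')

end Computability
end TwoLift

namespace TwoLift

/-! ### The greedy choice of the signs -/

/-- The number of nonzero entries before `y` increases strictly along the neighbors of `x`, so at
most one neighbor has rank `j` and the defining sum has a single nonzero summand at most. -/
theorem nbr_eq {a : ℕ → ℕ → ℕ} {n x j y : ℕ} (hy : y < n) (ha : a x y ≠ 0)
    (hj : (∑ z ∈ Finset.range y, if a x z ≠ 0 then 1 else 0) = j) : nbr a n x j = y := by
  have hmono : ∀ y y' : ℕ, y < y' → a x y ≠ 0 →
      (∑ z ∈ Finset.range y, if a x z ≠ 0 then 1 else 0) <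
        ∑ z ∈ Finset.range y', if a x z ≠ 0 then 1 else 0 := by
    intro y y' h h'
    refine Nat.lt_of_succ_le ?_
    calc _ = ∑ z ∈ Finset.range (y + 1), if a x z ≠ 0 then 1 else 0 := by
          rw [Finset.sum_range_succ, if_pos h']
      _ ≤ _ := Finset.sum_le_sum_of_subset (Finset.range_subset_range.mpr h)
  unfold nbr
  rw [Finset.sum_eq_single y, if_pos ⟨ha, hj⟩]
  · intro y' _ hne
    refine if_neg fun h => ?_
    rcases lt_or_gt_of_ne hne with hlt | hlt
    · have := hmono _ _ hlt h.1; omega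
    · have := hmono _ _ hlt ha; omega
  · intro h; exact absurd (Finset.mem_range.mpr hy) h

theorem nbr_lt {a : ℕ → ℕ → ℕ} {n x j : ℕ} (hn : 0 < n) : nbr a n x j < n := by
  by_cases h : ∃ y < n, a x y ≠ 0 ∧ (∑ z ∈ Finset.range y, if a x z ≠ 0 then 1 else 0) = j
  · obtain ⟨y, hy, h1, h2⟩ := h
    rwa [nbr_eq hy h1 h2]
  · push Not at h
    unfold nbr
    rwa [Finset.sum_eq_zero]
    intro y hy
    exact if_neg fun h' => h y (Finset.mem_range.mp hy) h'.1 h'.2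

theorem walk_lt {a : ℕ → ℕ → ℕ} {n d b c i : ℕ} (hn : 0 < n) : walk a n d b c i < n := by
  cases i with
  | zero => exact Nat.mod_lt _ hn
  | succ i => exact nbr_lt hn

theorem walk_succ (a : ℕ → ℕ → ℕ) (n d b c i : ℕ) :
    walk a n d b c (i + 1) = nbr a n (walk a n d b c i) (dig b (c / n) i % d) := rfl

theorem lab_succ (a : ℕ → ℕ → ℕ) (n d b c Q x : ℕ) :
    lab a n d b c (Q + 1) x =
      if walk a n d b c Q = x then dig b (c / n) Q / d else lab a n d b c Q x := rfl

/-- The matrices `a` and `a'` have the same support. -/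
def SameSupp (n : ℕ) (a a' : ℕ → ℕ → ℕ) : Prop := ∀ x < n, ∀ y < n, (a x y = 0 ↔ a' x y = 0)

section Congr

variable {a a' : ℕ → ℕ → ℕ} {n : ℕ} (h : SameSupp n a a')
include h

theorem SameSupp.deg0_eq : deg0 a n = deg0 a' n :=
  Finset.sum_congr rfl fun y hy => by
    have hy := Finset.mem_range.mp hy
    simp only [ne_eq, h 0 (by omega) y hy]

theorem SameSupp.nbr_eq {x j : ℕ} (hx : x < n) : nbr a n x j = nbr a' n x j := by
  refine Finset.sum_congr rfl fun y hy => ?_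
  have hy := Finset.mem_range.mp hy
  have h1 : (∑ z ∈ Finset.range y, if a x z ≠ 0 then 1 else 0) =
      ∑ z ∈ Finset.range y, if a' x z ≠ 0 then 1 else 0 :=
    Finset.sum_congr rfl fun z hz => by
      have hz := Finset.mem_range.mp hz
      simp only [ne_eq, h x hx z (by omega)]
  rw [h1]
  simp only [ne_eq, h x hx y hy]

theorem SameSupp.walk_eq (hn : 0 < n) (d b c i : ℕ) : walk a n d b c i = walk a' n d b c i := by
  induction i with
  | zero => rfl
  | succ i ih => rw [walk_succ, walk_succ, h.nbr_eq (walk_lt hn), ih]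

theorem SameSupp.lab_eq (hn : 0 < n) (d b c Q x : ℕ) : lab a n d b c Q x = lab a' n d b c Q x := by
  induction Q with
  | zero => rfl
  | succ i ih => rw [lab_succ, lab_succ, h.walk_eq hn, ih]

theorem SameSupp.visits_eq (hn : 0 < n) (d Q c x y : ℕ) :
    visits a n d Q c x y = visits a' n d Q c x y := by
  simp only [visits, h.walk_eq hn]

/-- Walks and labels only ask which entries of the matrix vanish. Writing signs 1 and 2 over the
entries 1 therefore leaves the potential unchanged, and the algorithm can work in place. -/
theorem SameSupp.pot_eq {s s' : ℕ → ℕ → ℕ} (hs : ∀ x < n, ∀ y < n, s x y = s' x y) (d Q : ℕ) :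
    pot a s n d Q = pot a' s' n d Q := by
  rcases Nat.eq_zero_or_pos n with rfl | hn
  · simp [pot]
  unfold pot
  congr 1
  · refine Finset.sum_congr rfl fun c _ => Finset.prod_congr rfl fun x hx =>
      Finset.prod_congr rfl fun y hy => ?_
    rw [hs x (Finset.mem_range.mp hx) y (Finset.mem_range.mp hy)]
    simp only [h.lab_eq hn]
  · congr 2
    refine Finset.sum_congr rfl fun c _ => ?_
    have : walkCode a s n d Q c = walkCode a' s' n d Q c := by
      unfold walkCode
      congr 1
      refine Finset.prod_congr rfl fun x hx => ?_
      congr 1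
      refine Finset.prod_congr rfl fun y hy => ?_
      rw [hs x (Finset.mem_range.mp hx) y (Finset.mem_range.mp hy)]
      rw [h.visits_eq hn]
    rw [this]
    simp only [h.walk_eq hn]

end Congr

/-- Products that differ in one factor. -/
theorem prod_add_prod_eq {ι : Type*} [DecidableEq ι] {S : Finset ι} {f g e : ι → ℕ} {i : ι}
    (hi : i ∈ S) (hf : ∀ j ∈ S, j ≠ i → f j = e j) (hg : ∀ j ∈ S, j ≠ i → g j = e j)
    (h : f i + g i = 2 * e i) : ∏ j ∈ S, f j + ∏ j ∈ S, g j = 2 * ∏ j ∈ S, e j := by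
  rw [← Finset.mul_prod_erase S f hi, ← Finset.mul_prod_erase S g hi,
    ← Finset.mul_prod_erase S e hi,
    Finset.prod_congr rfl fun j hj => hf j (Finset.mem_of_mem_erase hj) (Finset.ne_of_mem_erase hj),
    Finset.prod_congr rfl fun j hj => hg j (Finset.mem_of_mem_erase hj) (Finset.ne_of_mem_erase hj),
    ← add_mul, h, mul_assoc]

theorem walkCode_eq (a s : ℕ → ℕ → ℕ) (n d Q c : ℕ) :
    walkCode a s n d Q c = (∏ p ∈ Finset.range n ×ˢ Finset.range n,
      if visits a n d Q c p.1 p.2 % 2 = 1 ∧ p.1 < p.2 then s p.1 p.2 else 1) % 3 := by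
  unfold walkCode
  rw [← Finset.prod_nat_mod, Finset.prod_product]

theorem labWeight_eq (a s : ℕ → ℕ → ℕ) (n d Q c : ℕ) :
    labWeight a s n d Q c = ∏ p ∈ Finset.range n ×ˢ Finset.range n,
    (2 + md (lab a n d (9 * d) c Q p.1 % 3 * (lab a n d (9 * d) c Q p.2 / 3) * s p.1 p.2) +
      md (lab a n d (9 * d) c Q p.2 % 3 * (lab a n d (9 * d) c Q p.1 / 3) * s p.1 p.2)) := by
  unfold labWeight
  rw [Finset.prod_product]

/-- The potential is a martingale under the choice of one sign. -/
theorem pot_add_pot {a s₁ s₂ s₀ : ℕ → ℕ → ℕ} {n u v : ℕ} (hu : u < n) (hv : v < n)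
    (h₁ : ∀ x < n, ∀ y < n, (x, y) ≠ (u, v) → s₁ x y = s₀ x y)
    (h₂ : ∀ x < n, ∀ y < n, (x, y) ≠ (u, v) → s₂ x y = s₀ x y)
    (e₁ : s₁ u v = 1) (e₂ : s₂ u v = 2) (e₀ : s₀ u v = 0) (d Q : ℕ) :
    pot a s₁ n d Q + pot a s₂ n d Q = 2 * pot a s₀ n d Q := by
  have hmem : (u, v) ∈ Finset.range n ×ˢ Finset.range n := by simp [hu, hv]
  -- Modulo 3 the numbers `z` and `2 * z` code opposite signs, so their average is the code of an
  -- undecided sign.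
  have hm : ∀ z, md (z * 1) + md (z * 2) = 2 * md (z * 0) := fun z => by unfold md; omega
  -- The sign at `(u, v)` occurs in one factor of the product only, so the product is affine in it.
  have hlab : ∀ c, labWeight a s₁ n d Q c + labWeight a s₂ n d Q c = 2 * labWeight a s₀ n d Q c := by
    intro c
    simp only [labWeight_eq]
    refine prod_add_prod_eq hmem ?_ ?_ ?_
    · rintro ⟨x, y⟩ hxy hne
      simp only [Finset.mem_product, Finset.mem_range] at hxy
      simp only [h₁ x hxy.1 y hxy.2 hne]
    · rintro ⟨x, y⟩ hxy hne
      simp only [Finset.mem_product, Finset.mem_range] at hxy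
      simp only [h₂ x hxy.1 y hxy.2 hne]
    · simp only [e₁, e₂, e₀]
      have h1 := hm (lab a n d (9 * d) c Q u % 3 * (lab a n d (9 * d) c Q v / 3))
      have h2 := hm (lab a n d (9 * d) c Q v % 3 * (lab a n d (9 * d) c Q u / 3))
      omega
  -- The parity in `walkCode` admits each sign to at most the first power. The factor at `(u, v)` is
  -- split off; if it does not depend on the sign, all three values agree.
  have hwalk : ∀ c, md (walkCode a s₁ n d Q c) + md (walkCode a s₂ n d Q c) =
      2 * md (walkCode a s₀ n d Q c) := by
    intro c
    have hmod : ∀ z, md (z % 3) = md z := fun z => by unfold md; omega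
    have key : ∀ s : ℕ → ℕ → ℕ, (∀ x < n, ∀ y < n, (x, y) ≠ (u, v) → s x y = s₀ x y) →
        md (walkCode a s n d Q c) = md ((∏ p ∈ (Finset.range n ×ˢ Finset.range n).erase (u, v),
          if visits a n d Q c p.1 p.2 % 2 = 1 ∧ p.1 < p.2 then s₀ p.1 p.2 else 1) *
          if visits a n d Q c u v % 2 = 1 ∧ u < v then s u v else 1) := by
      intro s hs
      rw [walkCode_eq, hmod, ← Finset.mul_prod_erase _ _ hmem, mul_comm]
      congr 2
      refine Finset.prod_congr rfl fun p hp => ?_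
      have h1 := Finset.mem_of_mem_erase hp
      simp only [Finset.mem_product, Finset.mem_range] at h1
      rw [hs p.1 h1.1 p.2 h1.2 (Finset.ne_of_mem_erase hp)]
    rw [key s₁ h₁, key s₂ h₂, key s₀ fun _ _ _ _ _ => rfl, e₁, e₂, e₀]
    split_ifs
    · exact hm _
    · ring
  have hsum : ∀ (S : Finset ℕ) (f g e : ℕ → ℕ), (∀ c, f c + g c = 2 * e c) →
      ∑ c ∈ S, f c + ∑ c ∈ S, g c = 2 * ∑ c ∈ S, e c := by
    intro S f g e h
    rw [← Finset.sum_add_distrib, Finset.mul_sum]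
    exact Finset.sum_congr rfl fun c _ => h c
  unfold pot
  have H1 := hsum (Finset.range (n * (9 * d) ^ Q)) _ _ _ hlab
  have H2 := hsum (Finset.range (n * d ^ Q))
    (fun c => if walk a n d d c Q = walk a n d d c 0 then md (walkCode a s₁ n d Q c) else 0)
    (fun c => if walk a n d d c Q = walk a n d d c 0 then md (walkCode a s₂ n d Q c) else 0)
    (fun c => if walk a n d d c Q = walk a n d d c 0 then md (walkCode a s₀ n d Q c) else 0)
    fun c => by split_ifs; exacts [hwalk c, rfl]
  beta_reduce at H2
  linear_combination H1 + n * (9 * d) ^ Q * 4 ^ (n * n) * H2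

/-- The memory after the first `q` entries have been rewritten. -/
def signIter (M : ℕ → ℕ) (q : ℕ) : ℕ → ℕ :=
  Nat.rec M (fun q M => Function.update M (1 + q) (newEntry M q)) q

theorem signIter_succ (M : ℕ → ℕ) (q : ℕ) : signIter M (q + 1) =
    Function.update (signIter M q) (1 + q) (newEntry (signIter M q) q) := rfl

theorem signIter_of_lt (M : ℕ → ℕ) {q i : ℕ} (h : q < i) : signIter M q i = M i := by
  induction q with
  | zero => rfl
  | succ q ih => rw [signIter_succ, Function.update_of_ne (by omega), ih (by omega)]

theorem signIter_zero (M : ℕ → ℕ) (q : ℕ) : signIter M q 0 = M 0 := by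
  induction q with
  | zero => rfl
  | succ q ih => rw [signIter_succ, Function.update_of_ne (by omega), ih]

theorem signIter_of_le (M : ℕ → ℕ) {p q : ℕ} (h : p < q) :
    signIter M q (1 + p) = newEntry (signIter M p) p := by
  induction q with
  | zero => omega
  | succ q ih =>
    rw [signIter_succ]
    by_cases hp : p = q
    · rw [hp, Function.update_self]
    · rw [Function.update_of_ne (by omega), ih (by omega)]

/-- The memory holds the adjacency matrix of a graph. -/
structure HoldsAdj (M : ℕ → ℕ) : Prop where
  le_one : ∀ x < M 0, ∀ y < M 0, mat M x y ≤ 1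
  symm : ∀ x < M 0, ∀ y < M 0, mat M x y = mat M y x

theorem pos_lt {n x y : ℕ} (hx : x < n) (hy : y < n) : n * x + y < n * n := by nlinarith

theorem pos_div {n x y : ℕ} (hy : y < n) : (n * x + y) / n = x := by
  rw [Nat.mul_add_div (by omega), Nat.div_eq_of_lt hy, add_zero]

theorem pos_mod {n x y : ℕ} (hy : y < n) : (n * x + y) % n = y := by
  rw [Nat.mul_add_mod, Nat.mod_eq_of_lt hy]

theorem pos_div_lt {n q : ℕ} (hq : q < n * n) : q / n < n := Nat.div_lt_of_lt_mul hq

/-- The matrix after all entries have been rewritten. -/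
theorem mat_signIter {M : ℕ → ℕ} (q x y : ℕ) :
    mat (signIter M q) x y = if M 0 * x + y < q then
      newEntry (signIter M (M 0 * x + y)) (M 0 * x + y) else mat M x y := by
  unfold mat
  rw [signIter_zero]
  split_ifs with h
  · exact signIter_of_le M h
  · exact signIter_of_lt M (by omega)

section Greedy

variable {M : ℕ → ℕ} (hM : HoldsAdj M)
include hM

/-- An entry above the diagonal receives a sign exactly when it was nonzero. Any other entry copies
its mirror image, whose support is the right one because the adjacency matrix is symmetric. -/
theorem signIter_spec (q : ℕ) :
    ∀ x < M 0, ∀ y < M 0, mat (signIter M q) x y ≤ 2 ∧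
      (mat (signIter M q) x y = 0 ↔ mat M x y = 0) := by
  induction q with
  | zero => exact fun x hx y hy => ⟨(hM.le_one x hx y hy).trans one_le_two, Iff.rfl⟩
  | succ q ih =>
    intro x hx y hy
    by_cases hq : M 0 * x + y = q
    · have h1 := ih x hx y hy
      have h2 := ih y hy x hx
      have e : mat (signIter M (q + 1)) x y = newEntry (signIter M q) q := by
        rw [mat_signIter, if_pos (by omega), hq]
      rw [e]
      unfold newEntry
      have e' : signIter M q (1 + q) = mat (signIter M q) x y := by
        unfold mat; rw [signIter_zero, hq]
      rw [signIter_zero, e', ← hq, pos_div hy, pos_mod hy, hq]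
      split_ifs with h3 h4 h5
      · exact ⟨by norm_num, by simp [← h1.2, h4]⟩
      · exact ⟨by norm_num, by simp [← h1.2, h4]⟩
      · exact ⟨by norm_num, by simp [← h1.2, h4]⟩
      · exact ⟨h2.1, by rw [h2.2, hM.symm x hx y hy]⟩
    · have e : mat (signIter M (q + 1)) x y = mat (signIter M q) x y := by
        rw [mat_signIter, mat_signIter]
        congr 1
        exact propext ⟨by omega, by omega⟩
      rw [e]
      exact ih x hx y hy

theorem signIter_sameSupp (q : ℕ) : SameSupp (M 0) (mat (signIter M q)) (mat M) :=
  fun x hx y hy => (signIter_spec hM q x hx y hy).2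

end Greedy

end TwoLift

/-! ### Monotonicity of the potential along the greedy choice -/

namespace TwoLift

/-- The matrix of signs found by the greedy algorithm. -/
def signMat (M : ℕ → ℕ) : ℕ → ℕ → ℕ := mat (signIter M (M 0 * M 0))

/-- The part of a matrix above the diagonal. -/
def upper (a : ℕ → ℕ → ℕ) (x y : ℕ) : ℕ := if x < y then a x y else 0

theorem signMat_eq {M : ℕ → ℕ} {x y : ℕ} (hx : x < M 0) (hy : y < M 0) :
    signMat M x y = newEntry (signIter M (M 0 * x + y)) (M 0 * x + y) := by
  rw [signMat, mat_signIter, if_pos (pos_lt hx hy)]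

theorem potAt_congr {M M' : ℕ → ℕ} (h0 : M' 0 = M 0)
    (h : ∀ x < M 0, ∀ y < M 0, mat M' x y = mat M x y) (q t : ℕ) : potAt M' q t = potAt M q t := by
  have hs : SameSupp (M 0) (mat M') (mat M) := fun x hx y hy => by rw [h x hx y hy]
  unfold potAt
  rw [h0, hs.deg0_eq]
  refine hs.pot_eq (fun x hx y hy => ?_) _ _
  unfold partialSign
  rw [h x hx y hy]

theorem newEntry_congr {M M' : ℕ → ℕ} (h0 : M' 0 = M 0)
    (h : ∀ x < M 0, ∀ y < M 0, mat M' x y = mat M x y) {q : ℕ} (hq : q < M 0 * M 0) :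
    newEntry M' q = newEntry M q := by
  have hn : 0 < M 0 := Nat.pos_of_ne_zero fun h => by simp [h] at hq
  have hq' : q / M 0 < M 0 := pos_div_lt hq
  have hr : q % M 0 < M 0 := Nat.mod_lt _ hn
  have e : M' (1 + q) = M (1 + q) := by
    have := h _ hq' _ hr
    unfold mat at this
    rwa [h0, Nat.div_add_mod] at this
  unfold newEntry
  rw [h0, potAt_congr h0 h, potAt_congr h0 h, e, h _ hr _ hq']

/-- The signs depend only on the graph, not on the rest of the memory. -/
theorem signIter_congr {M M' : ℕ → ℕ} (h0 : M' 0 = M 0)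
    (h : ∀ x < M 0, ∀ y < M 0, mat M' x y = mat M x y) {q : ℕ} (hq : q ≤ M 0 * M 0) :
    ∀ x < M 0, ∀ y < M 0, mat (signIter M' q) x y = mat (signIter M q) x y := by
  induction q with
  | zero => exact h
  | succ q ih =>
    intro x hx y hy
    have h1 := ih (by omega)
    rw [mat_signIter, mat_signIter, h0]
    have h2 := h1 x hx y hy
    rw [mat_signIter, mat_signIter, h0] at h2
    by_cases hxy : M 0 * x + y = q
    · rw [if_pos (by omega), if_pos (by omega), hxy]
      have h3 := newEntry_congr (M := signIter M q) (M' := signIter M' q)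
        (by rw [signIter_zero, signIter_zero, h0]) (by rwa [signIter_zero]) (q := q)
        (by rw [signIter_zero]; omega)
      exact h3
    · by_cases hlt : M 0 * x + y < q
      · rw [if_pos (by omega), if_pos (by omega)]
        rwa [if_pos hlt, if_pos hlt] at h2
      · rw [if_neg (by omega), if_neg (by omega)]
        exact h x hx y hy

/-- In row-major order the position above the diagonal precedes its mirror image, so the value
copied below the diagonal is already final. -/
theorem signMat_symm {M : ℕ → ℕ} {x y : ℕ} (hx : x < M 0) (hy : y < M 0) : signMat M x y = signMat M y x := by
  wlog hxy : y < x generalizing x y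
  · rcases lt_or_eq_of_le (not_lt.mp hxy) with h | h
    · exact (this hy hx h).symm
    · rw [h]
  have hlt : M 0 * y + x < M 0 * x + y := by nlinarith
  rw [signMat_eq hx hy]
  unfold newEntry
  rw [signIter_zero, pos_div hy, pos_mod hy, if_neg (by omega), mat_signIter, if_pos hlt,
    ← signMat_eq hy hx]

section Greedy

variable {M : ℕ → ℕ} (hM : HoldsAdj M)
include hM

theorem signMat_spec {x y : ℕ} (hx : x < M 0) (hy : y < M 0) :
    signMat M x y ≤ 2 ∧ (signMat M x y = 0 ↔ mat M x y = 0) :=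
  signIter_spec hM _ x hx y hy

/-- The potential of the partial signing before the step `q`, with sign `t` at `q`. -/
theorem potAt_signIter (q t : ℕ) : potAt (signIter M q) q t =
    pot (mat M) (partialSign (signMat M) (M 0) q t) (M 0) (deg0 (mat M) (M 0)) (2 * lg (M 0)) := by
  unfold potAt
  rw [signIter_zero, (signIter_sameSupp hM q).deg0_eq]
  refine (signIter_sameSupp hM q).pot_eq (fun x hx y hy => ?_) _ _
  unfold partialSign
  split_ifs with h1 h2
  · rw [signMat_eq hx hy, mat_signIter, if_pos h2]
  · rfl
  · rfl
  · rfl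

/-- The potentials for the two signs at `q` average to the potential with `q` undecided, and the
algorithm takes the smaller one. At a non-edge, or on or below the diagonal, nothing is decided and
the potential stays the same. -/
theorem pot_step {q : ℕ} (hq : q < M 0 * M 0) :
    pot (mat M) (partialSign (signMat M) (M 0) (q + 1) 0) (M 0) (deg0 (mat M) (M 0)) (2 * lg (M 0)) ≤
      pot (mat M) (partialSign (signMat M) (M 0) q 0) (M 0) (deg0 (mat M) (M 0)) (2 * lg (M 0)) := by
  have hn : 0 < M 0 := Nat.pos_of_ne_zero fun h => by simp [h] at hq
  have hu : q / M 0 < M 0 := pos_div_lt hq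
  have hv : q % M 0 < M 0 := Nat.mod_lt _ hn
  have huv : M 0 * (q / M 0) + q % M 0 = q := Nat.div_add_mod _ _
  have hpos : ∀ x < M 0, ∀ y < M 0, (x, y) ≠ (q / M 0, q % M 0) → M 0 * x + y ≠ q := by
    rintro x hx y hy hne rfl
    rw [pos_div hy, pos_mod hy] at hne
    exact hne rfl
  have hss : SameSupp (M 0) (mat M) (mat M) := fun _ _ _ _ => Iff.rfl
  have hsucc : pot (mat M) (partialSign (signMat M) (M 0) (q + 1) 0) (M 0)
      (deg0 (mat M) (M 0)) (2 * lg (M 0)) =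
      pot (mat M) (partialSign (signMat M) (M 0) q (signMat M (q / M 0) (q % M 0))) (M 0)
        (deg0 (mat M) (M 0)) (2 * lg (M 0)) := by
    refine hss.pot_eq (fun x hx y hy => ?_) _ _
    unfold partialSign
    by_cases hxy : M 0 * x + y = q
    · simp only [hxy, lt_irrefl, if_true, if_false, Nat.lt_succ_self]
      rw [← hxy, pos_div hy, pos_mod hy]
    · have : M 0 * x + y < q + 1 ↔ M 0 * x + y < q := by omega
      simp only [hxy, if_false, this]
      split_ifs <;> rfl
  have hsame : signMat M (q / M 0) (q % M 0) = 0 ∨ ¬ q / M 0 < q % M 0 →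
      pot (mat M) (partialSign (signMat M) (M 0) q (signMat M (q / M 0) (q % M 0))) (M 0)
        (deg0 (mat M) (M 0)) (2 * lg (M 0)) =
      pot (mat M) (partialSign (signMat M) (M 0) q 0) (M 0) (deg0 (mat M) (M 0)) (2 * lg (M 0)) := by
    intro h
    refine hss.pot_eq (fun x hx y hy => ?_) _ _
    unfold partialSign
    by_cases hxy : M 0 * x + y = q
    · have e1 : q / M 0 = x := by rw [← hxy, pos_div hy]
      have e2 : q % M 0 = y := by rw [← hxy, pos_mod hy]
      rw [e1, e2] at h ⊢
      rcases h with h | h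
      · rw [h]
      · rw [if_neg h, if_neg h]
    · rw [if_neg hxy, if_neg hxy]
  rw [hsucc]
  by_cases hlt : q / M 0 < q % M 0
  swap
  · exact (hsame (Or.inr hlt)).le
  by_cases h0 : signMat M (q / M 0) (q % M 0) = 0
  · exact (hsame (Or.inl h0)).le
  have hadd := pot_add_pot (a := mat M) (s₁ := partialSign (signMat M) (M 0) q 1)
    (s₂ := partialSign (signMat M) (M 0) q 2) (s₀ := partialSign (signMat M) (M 0) q 0) hu hv
    (fun x hx y hy hne => by
      have := hpos x hx y hy hne
      simp only [partialSign, this, if_false])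
    (fun x hx y hy hne => by
      have := hpos x hx y hy hne
      simp only [partialSign, this, if_false])
    (by simp [partialSign, hlt, huv]) (by simp [partialSign, hlt, huv])
    (by simp [partialSign, huv]) (deg0 (mat M) (M 0)) (2 * lg (M 0))
  have hcell : signIter M q (1 + q) ≠ 0 := by
    intro h
    refine h0 ((signMat_spec hM hu hv).2.mpr ((signIter_spec hM q _ hu _ hv).2.mp ?_))
    unfold mat
    rwa [signIter_zero, huv]
  have hval : signMat M (q / M 0) (q % M 0) =
      if potAt (signIter M q) q 1 ≤ potAt (signIter M q) q 2 then 1 else 2 := by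
    rw [signMat_eq hu hv, huv]
    unfold newEntry
    rw [signIter_zero, if_pos hlt, if_neg hcell]
  rw [potAt_signIter hM, potAt_signIter hM] at hval
  rw [hval]
  split_ifs with h <;> omega

/-- The greedy algorithm does not increase the potential. -/
theorem pot_signMat_le :
    pot (mat M) (upper (signMat M)) (M 0) (deg0 (mat M) (M 0)) (2 * lg (M 0)) ≤
      pot (mat M) (fun _ _ => 0) (M 0) (deg0 (mat M) (M 0)) (2 * lg (M 0)) := by
  have hss : SameSupp (M 0) (mat M) (mat M) := fun _ _ _ _ => Iff.rfl
  have h : ∀ q ≤ M 0 * M 0,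
      pot (mat M) (partialSign (signMat M) (M 0) q 0) (M 0) (deg0 (mat M) (M 0)) (2 * lg (M 0)) ≤
      pot (mat M) (partialSign (signMat M) (M 0) 0 0) (M 0) (deg0 (mat M) (M 0)) (2 * lg (M 0)) := by
    intro q hq
    induction q with
    | zero => rfl
    | succ q ih => exact (pot_step hM (by omega)).trans (ih (by omega))
  refine le_trans (le_of_eq ?_) ((h _ le_rfl).trans (le_of_eq ?_))
  · refine hss.pot_eq (fun x hx y hy => ?_) _ _
    simp only [upper, partialSign, pos_lt hx hy, if_true]
  · refine hss.pot_eq (fun x hx y hy => ?_) _ _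
    simp [partialSign]

end Greedy

theorem Small.signIter {M : ℕ → ℕ} {B : ℕ} (h : Small M B) (hM : HoldsAdj M) (q : ℕ) :
    Small (signIter M q) B := by
  have e := (signIter_sameSupp hM q).deg0_eq
  have e0 := signIter_zero M q
  exact ⟨by rw [e0]; exact h.n_pos, by rw [e0, e]; exact h.d_pos, by rw [e0]; exact h.n_le,
    by rw [e0, e]; exact h.d_le, by rw [e0, e]; exact h.walks_le,
    by rw [e0]; exact fun x hx y hy => (signIter_spec hM q x hx y hy).1, h.le⟩

theorem trans_sign {α : Type} [Ctx α] {D : α → ℕ → Prop}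
    (hD : ∀ x B, D x B → HoldsAdj (Ctx.mem x) ∧ Ctx.mem x 0 * Ctx.mem x 0 ≤ B ∧
      (0 < Ctx.mem x 0 → Small (Ctx.mem x) B)) :
    Trans D fun x => signIter (Ctx.mem x) (Ctx.mem x 0 * Ctx.mem x 0) := by
  have hi : ∀ (x : α) (q : ℕ), (Nat.rec (Ctx.mem x) (fun q M => Function.update
      (Ctx.mem ((Ctx.upd x M, q) : α × ℕ)) (1 + q)
      (newEntry (Ctx.mem ((Ctx.upd x M, q) : α × ℕ)) q)) q : ℕ → ℕ) = signIter (Ctx.mem x) q := by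
    intro x q
    induction q with
    | zero => rfl
    | succ q ih =>
      rw [signIter_succ, ← ih]
      change Function.update (Ctx.mem (Ctx.upd x _)) _ (newEntry (Ctx.mem (Ctx.upd x _)) _) = _
      rw [Ctx.mem_upd]
  refine (Trans.iter (b := fun x => Ctx.mem x 0 * Ctx.mem x 0)
    (g := fun y => Function.update (Ctx.mem y) (1 + y.2) (newEntry (Ctx.mem y) y.2))
    (Comp.mul comp_mem0 comp_mem0 fun x B h => ?_) (fun x B h => (hD x B h).2.1) ?_).congr
    fun x B h => (hi x _).symm
  · exact (Nat.le_mul_self _).trans (hD x B h).2.1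
  · refine Trans.store ((Comp.lit 1).add Comp.snd) (comp_newEntry ?_ Comp.snd ?_)
    · rintro ⟨y, q⟩ B ⟨x, h, hq, hy⟩
      have h1 := hD x B h
      have hn : 0 < Ctx.mem x 0 := Nat.pos_of_ne_zero fun h => by simp [h] at hq
      simp only at hy
      rw [hi] at hy
      change Small (Ctx.mem y) B
      rw [hy, Ctx.mem_upd]
      exact (h1.2.2 hn).signIter h1.1 q
    · rintro ⟨y, q⟩ B ⟨x, h, hq, hy⟩
      exact hq.le.trans (hD x B h).2.1

end TwoLift

namespace TwoLift

/-! ### The 2-lift in memory, and the complete programs -/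

/-- The memory `M`, with `F 0, …, F (N - 1)` written into the cells from `b` on. -/
def fill (M : ℕ → ℕ) (b N : ℕ) (F : ℕ → ℕ) (i : ℕ) : ℕ :=
  if b ≤ i ∧ i < b + N then F (i - b) else M i

theorem fill_succ (M : ℕ → ℕ) (b N : ℕ) (F : ℕ → ℕ) :
    fill M b (N + 1) F = Function.update (fill M b N F) (b + N) (F N) := by
  funext i
  unfold fill
  by_cases h : i = b + N
  · subst h; simp
  · rw [Function.update_of_ne h]
    congr 1
    exact propext ⟨fun h' => ⟨h'.1, by omega⟩, fun h' => ⟨h'.1, by omega⟩⟩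

theorem fill_zero (M : ℕ → ℕ) (b : ℕ) (F : ℕ → ℕ) : fill M b 0 F = M := by
  funext i
  unfold fill
  exact if_neg (by omega)

/-- The values are recomputed from the memory as it stands in the middle of the loop. The hypotheses
`hbs` and `hFs` say that the cells filled so far do not affect the start address or the next value.
-/
theorem Trans.fill {α : Type} [Ctx α] {D : α → ℕ → Prop} {b N : α → ℕ} {F : α × ℕ → ℕ}
    (hN : Comp D N) (hNB : ∀ x B, D x B → N x ≤ B)
    (hb : Comp (fun (y : α × ℕ) B => ∃ x, D x B ∧ y.2 < N x ∧
      y.1 = Ctx.upd x (fill (Ctx.mem x) (b x) y.2 fun p => F (x, p))) fun y => b y.1)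
    (hF : Comp (fun (y : α × ℕ) B => ∃ x, D x B ∧ y.2 < N x ∧
      y.1 = Ctx.upd x (fill (Ctx.mem x) (b x) y.2 fun p => F (x, p))) F)
    (hbs : ∀ x B q, D x B → q < N x →
      b (Ctx.upd x (TwoLift.fill (Ctx.mem x) (b x) q fun p => F (x, p))) = b x)
    (hFs : ∀ x B q, D x B → q < N x →
      F (Ctx.upd x (TwoLift.fill (Ctx.mem x) (b x) q fun p => F (x, p)), q) = F (x, q)) :
    Trans D fun x => TwoLift.fill (Ctx.mem x) (b x) (N x) fun p => F (x, p) := by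
  have hi : ∀ (x : α) (B q : ℕ), D x B → q ≤ N x → (Nat.rec (Ctx.mem x) (fun q M => Function.update
      (Ctx.mem ((Ctx.upd x M, q) : α × ℕ)) (b (Ctx.upd x M) + q)
      (F (Ctx.upd x M, q))) q : ℕ → ℕ) =
      TwoLift.fill (Ctx.mem x) (b x) q fun p => F (x, p) := by
    intro x B q hD hq
    induction q with
    | zero => rw [fill_zero]; rfl
    | succ q ih =>
      rw [fill_succ]
      change Function.update (Ctx.mem (Ctx.upd x _)) (b (Ctx.upd x _) + q) (F (Ctx.upd x _, q)) = _
      rw [Ctx.mem_upd, ih (by omega), hbs x B q hD (by omega), hFs x B q hD (by omega)]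
  refine (Trans.iter (g := fun y => Function.update (Ctx.mem y) (b y.1 + y.2) (F y)) hN hNB
    ?_).congr fun x B h => (hi x B _ h le_rfl).symm
  refine Trans.store (Comp.add (Comp.mono hb ?_) Comp.snd) (Comp.mono hF ?_)
  all_goals
    rintro ⟨y, q⟩ B ⟨x, h, hq, hy⟩
    refine ⟨x, h, hq, ?_⟩
    rw [← hi x B q h (le_of_lt hq)]
    exact hy

/-- The entry at position `p` of the adjacency matrix of the 2-lift. -/
def liftEntry (a : ℕ → ℕ → ℕ) (n p : ℕ) : ℕ :=
  if (a (p / (2 * n) % n) (p % (2 * n) % n) = 1 ∧ p / (2 * n) / n = p % (2 * n) / n) ∨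
    (a (p / (2 * n) % n) (p % (2 * n) % n) = 2 ∧ p / (2 * n) / n ≠ p % (2 * n) / n) then 1 else 0

/-- The adjacency matrix of the 2-lift is written beyond the old matrix. -/
def expandFar (M : ℕ → ℕ) : ℕ → ℕ :=
  fill M (1 + M 0 * M 0) (2 * M 0 * (2 * M 0)) (liftEntry (mat M) (M 0))

/-- A matrix of twice the size is copied to its place. -/
def copyBack (M : ℕ → ℕ) : ℕ → ℕ :=
  fill M 1 (2 * M 0 * (2 * M 0)) fun p => M (1 + M 0 * M 0 + p)

/-- The matrix in memory is replaced by the adjacency matrix of its 2-lift. -/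
def expand (M : ℕ → ℕ) : ℕ → ℕ :=
  Function.update (copyBack (expandFar M)) 0 (2 * copyBack (expandFar M) 0)

/-- One round: the signs, and then the 2-lift. -/
def liftStep (M : ℕ → ℕ) : ℕ → ℕ := expand (signIter M (M 0 * M 0))

theorem mem_fst {α : Type} [Ctx α] (y : α × ℕ) : Ctx.mem y = Ctx.mem y.1 := rfl

section

variable {α : Type} [Ctx α] {D : α → ℕ → Prop}

theorem comp_liftEntry {p : α → ℕ} (hp : Comp D p)
    (hD : ∀ x B, D x B → 0 < Ctx.mem x 0 ∧ 2 * Ctx.mem x 0 * (2 * Ctx.mem x 0) ≤ B ∧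
      p x < 2 * Ctx.mem x 0 * (2 * Ctx.mem x 0)) :
    Comp D fun x => liftEntry (mat (Ctx.mem x)) (Ctx.mem x 0) (p x) := by
  have hB : ∀ x B, D x B → 0 < Ctx.mem x 0 ∧ 2 * Ctx.mem x 0 ≤ B ∧ 2 ≤ B := by
    intro x B h
    have h1 := hD x B h
    refine ⟨h1.1, (Nat.le_mul_self _).trans h1.2.1, ?_⟩
    nlinarith
  have hN : Comp D fun x => 2 * Ctx.mem x 0 :=
    (Comp.lit 2).mul comp_mem0 fun x B h => (hB x B h).2.2
  have hpB : ∀ x B, D x B → p x ≤ B := fun x B h => (hD x B h).2.2.le.trans (hD x B h).2.1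
  have hN0 : ∀ x B, D x B → 0 < 2 * Ctx.mem x 0 := fun x B h => by have := (hB x B h).1; omega
  have hn0 : ∀ x B, D x B → 0 < Ctx.mem x 0 := fun x B h => (hB x B h).1
  have h1 := hp.div hN hpB hN0
  have h2 := hp.mod hN hpB hN0
  have h1B : ∀ x B, D x B → p x / (2 * Ctx.mem x 0) ≤ B := fun x B h =>
    (Nat.div_le_self _ _).trans (hpB x B h)
  have h2B : ∀ x B, D x B → p x % (2 * Ctx.mem x 0) ≤ B := fun x B h =>
    (Nat.mod_le _ _).trans (hpB x B h)
  have ha := comp_mat (h1.mod comp_mem0 h1B hn0) (h2.mod comp_mem0 h2B hn0)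
    fun x B h => by have := (hB x B h).2.1; omega
  have hd1 := h1.div comp_mem0 h1B hn0
  have hd2 := h2.div comp_mem0 h2B hn0
  exact Comp.ite (CompP.or (CompP.and (CompP.eq ha (Comp.lit 1)) (CompP.eq hd1 hd2))
    (CompP.and (CompP.eq ha (Comp.lit 2)) (CompP.ne hd1 hd2))) (Comp.lit 1) (Comp.lit 0)

theorem pos_lt_of_liftEntry {n x y : ℕ} (hn : 0 < n) :
    1 + (n * (x % n) + y % n) < 1 + n * n := by
  have := pos_lt (Nat.mod_lt x hn) (Nat.mod_lt y hn)
  omega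

theorem fill_far_zero (M : ℕ → ℕ) (q : ℕ) (F : ℕ → ℕ) : fill M (1 + M 0 * M 0) q F 0 = M 0 :=
  if_neg (by omega)

theorem fill_one_zero (M : ℕ → ℕ) (q : ℕ) (F : ℕ → ℕ) : fill M 1 q F 0 = M 0 :=
  if_neg (by omega)

theorem comp_size (hD : ∀ x B, D x B → 2 * Ctx.mem x 0 * (2 * Ctx.mem x 0) ≤ B ∧ 2 ≤ B) :
    Comp D fun x => 2 * Ctx.mem x 0 * (2 * Ctx.mem x 0) :=
  have h : Comp D fun x => 2 * Ctx.mem x 0 :=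
    (Comp.lit 2).mul comp_mem0 fun x B h => (hD x B h).2
  h.mul h fun x B h => (Nat.le_mul_self _).trans (hD x B h).1

theorem comp_far (hD : ∀ x B, D x B → Ctx.mem x 0 ≤ B) :
    Comp D fun x => 1 + Ctx.mem x 0 * Ctx.mem x 0 :=
  (Comp.lit 1).add (comp_mem0.mul comp_mem0 hD)

theorem le_of_size_le {n B : ℕ} (h : 2 * n * (2 * n) ≤ B) : n ≤ B := by
  nlinarith [Nat.le_mul_self n]

/-- Written in place, the larger matrix would destroy entries still to be read. Beyond the first `1
+ n * n` cells it is out of reach of everything that `liftEntry` reads. -/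
theorem trans_expandFar (hD : ∀ x B, D x B → 2 * Ctx.mem x 0 * (2 * Ctx.mem x 0) ≤ B ∧ 2 ≤ B) :
    Trans D fun x => expandFar (Ctx.mem x) := by
  have hmat : ∀ (M : ℕ → ℕ) (q : ℕ) (F : ℕ → ℕ) (p : ℕ), 0 < M 0 →
      liftEntry (mat (fill M (1 + M 0 * M 0) q F)) (M 0) p = liftEntry (mat M) (M 0) p := by
    intro M q F p hn
    have : mat (fill M (1 + M 0 * M 0) q F) (p / (2 * M 0) % M 0) (p % (2 * M 0) % M 0) =
        mat M (p / (2 * M 0) % M 0) (p % (2 * M 0) % M 0) := by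
      unfold mat
      rw [fill_far_zero]
      exact if_neg fun h => absurd (pos_lt_of_liftEntry (x := p / (2 * M 0)) (y := p % (2 * M 0)) hn)
        (by omega)
    unfold liftEntry
    rw [this]
  have hpos : ∀ (x : α) (q : ℕ), q < 2 * Ctx.mem x 0 * (2 * Ctx.mem x 0) → 0 < Ctx.mem x 0 :=
    fun x q hq => Nat.pos_of_ne_zero fun h => by simp [h] at hq
  refine Trans.fill (b := fun x => 1 + Ctx.mem x 0 * Ctx.mem x 0)
    (N := fun x => 2 * Ctx.mem x 0 * (2 * Ctx.mem x 0))
    (F := fun y => liftEntry (mat (Ctx.mem y)) (Ctx.mem y 0) y.2)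
    (comp_size hD) (fun x B h => (hD x B h).1) ?_ ?_ ?_ ?_
  · refine Comp.fst (comp_far (D := fun x B => Ctx.mem x 0 ≤ B) fun _ _ h => h) ?_
    rintro ⟨y, q⟩ B ⟨x, h, hq, hy⟩
    simp only at hy
    rw [hy, Ctx.mem_upd, fill_far_zero]
    exact le_of_size_le (hD x B h).1
  · refine comp_liftEntry Comp.snd ?_
    rintro ⟨y, q⟩ B ⟨x, h, hq, hy⟩
    simp only [mem_fst] at hy hq ⊢
    rw [hy, Ctx.mem_upd, fill_far_zero]
    exact ⟨hpos x q hq, (hD x B h).1, hq⟩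
  · intro x B q h hq
    rw [Ctx.mem_upd, fill_far_zero]
  · intro x B q h hq
    simp only [mem_fst, Ctx.mem_upd, fill_far_zero]
    exact hmat _ _ _ _ (hpos x q hq)

/-- Every source cell lies above all target cells filled so far, so copying upwards is safe although
source and target may overlap. -/
theorem trans_copyBack (hD : ∀ x B, D x B → 2 * Ctx.mem x 0 * (2 * Ctx.mem x 0) ≤ B ∧ 2 ≤ B) :
    Trans D fun x => copyBack (Ctx.mem x) := by
  refine Trans.fill (b := fun _ => 1)
    (N := fun x => 2 * Ctx.mem x 0 * (2 * Ctx.mem x 0))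
    (F := fun y => Ctx.mem y (1 + Ctx.mem y 0 * Ctx.mem y 0 + y.2))
    (comp_size hD) (fun x B h => (hD x B h).1) (Comp.lit 1) ?_ ?_ ?_
  · refine Comp.cell ((comp_far ?_).add Comp.snd)
    rintro ⟨y, q⟩ B ⟨x, h, hq, hy⟩
    simp only [mem_fst] at hy hq ⊢
    rw [hy, Ctx.mem_upd, fill_one_zero]
    exact le_of_size_le (hD x B h).1
  · intro x B q h hq
    rfl
  · intro x B q h hq
    have : 0 < Ctx.mem x 0 := Nat.pos_of_ne_zero fun h => by simp [h] at hq
    simp only [mem_fst, Ctx.mem_upd, fill_one_zero]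
    exact if_neg fun h => by nlinarith

theorem expandFar_zero (M : ℕ → ℕ) : expandFar M 0 = M 0 := fill_far_zero _ _ _

theorem copyBack_zero (M : ℕ → ℕ) : copyBack M 0 = M 0 := fill_one_zero _ _ _

theorem trans_expand (hD : ∀ x B, D x B → 2 * Ctx.mem x 0 * (2 * Ctx.mem x 0) ≤ B ∧ 2 ≤ B) :
    Trans D fun x => expand (Ctx.mem x) := by
  set E : α → ℕ → Prop := fun x B => 2 * Ctx.mem x 0 * (2 * Ctx.mem x 0) ≤ B ∧ 2 ≤ B
  have t3 : Trans E fun x => Function.update (Ctx.mem x) 0 (2 * Ctx.mem x 0) :=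
    Trans.store (Comp.lit 0) ((Comp.lit 2).mul comp_mem0 fun x B h => h.2)
  have t2 : Trans E fun x => _ := Trans.seq (trans_copyBack fun _ _ h => h) t3 fun x B h => by
    change 2 * Ctx.mem (Ctx.upd x _) 0 * (2 * Ctx.mem (Ctx.upd x _) 0) ≤ B ∧ 2 ≤ B
    rwa [Ctx.mem_upd, copyBack_zero]
  refine (Trans.seq (trans_expandFar hD) t2 fun x B h => ?_).congr fun x B _ => ?_
  · change 2 * Ctx.mem (Ctx.upd x _) 0 * (2 * Ctx.mem (Ctx.upd x _) 0) ≤ B ∧ 2 ≤ B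
    rw [Ctx.mem_upd, expandFar_zero]
    exact hD x B h
  · simp only [Ctx.mem_upd, expand]

theorem trans_liftStep (hD : ∀ x B, D x B → HoldsAdj (Ctx.mem x) ∧
      2 * Ctx.mem x 0 * (2 * Ctx.mem x 0) ≤ B ∧ 2 ≤ B ∧ (0 < Ctx.mem x 0 → Small (Ctx.mem x) B)) :
    Trans D fun x => liftStep (Ctx.mem x) := by
  refine (Trans.seq (trans_sign fun x B h => ?_) (trans_expand (D := fun x B =>
    2 * Ctx.mem x 0 * (2 * Ctx.mem x 0) ≤ B ∧ 2 ≤ B) fun _ _ h => h) fun x B h => ?_).congr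
    fun x B _ => ?_
  · have h1 := hD x B h
    exact ⟨h1.1, by nlinarith, h1.2.2.2⟩
  · rw [Ctx.mem_upd, signIter_zero]
    exact ⟨(hD x B h).2.1, (hD x B h).2.2.1⟩
  · simp only [Ctx.mem_upd, liftStep]

end

theorem expand_zero (M : ℕ → ℕ) : expand M 0 = 2 * M 0 := by
  rw [expand, Function.update_self, copyBack_zero, expandFar_zero]

theorem mat_expand {M : ℕ → ℕ} {i j : ℕ} (hi : i < 2 * M 0) (hj : j < 2 * M 0) :
    mat (expand M) i j = if (mat M (i % M 0) (j % M 0) = 1 ∧ i / M 0 = j / M 0) ∨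
      (mat M (i % M 0) (j % M 0) = 2 ∧ i / M 0 ≠ j / M 0) then 1 else 0 := by
  have hlt := pos_lt hi hj
  have e : mat (expand M) i j = liftEntry (mat M) (M 0) (2 * M 0 * i + j) := by
    unfold mat
    rw [expand_zero, expand, Function.update_of_ne (by omega), copyBack, expandFar_zero, fill,
      if_pos (by omega), expandFar, fill, if_pos (by omega)]
    congr 1
    omega
  rw [e]
  unfold liftEntry
  rw [pos_div hj, pos_mod hj]

end TwoLift

/-! ### Programs on encoded inputs -/

namespace TwoLift

/-- The output convention also wants the length of the list in register 0. Cell 0 holds the size of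
the matrix, so a second program computes the length from it. -/
theorem Trans.exists_prog {D : (ℕ → ℕ) → ℕ → Prop} {F : (ℕ → ℕ) → ℕ → ℕ} (hF : Trans D F) :
    ∃ (p : Prog) (c h : ℕ), ∀ (input output : List ℕ) (B : ℕ), D (initState input).mem B →
      F (initState input).mem 0 ≤ B →
      output.length = F (initState input).mem 0 * F (initState input).mem 0 + 1 →
      (∀ i (hi : i < output.length), F (initState input).mem i = output[i]) →
      p.OutputsWithin input output (c * (B + 1) ^ h) := by
  obtain ⟨c, e, H⟩ := hF
  have hlen : Comp (fun (M : ℕ → ℕ) B => M 0 ≤ B) fun M => M 0 * M 0 + 1 :=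
    ((comp_mem0 (α := ℕ → ℕ)).mul comp_mem0 fun x B h => h).add (Comp.lit 1)
  obtain ⟨c', e', H'⟩ := hlen
  obtain ⟨p, hp⟩ := H () 0 trivial
  obtain ⟨q, hq⟩ := H' () 0 trivial
  refine ⟨.seq p q, c + c' + 0, e + e', fun input output B hD hB hl ho => ?_⟩
  refine (Runs.seq (hp (initState input) B hD) fun σ' hσ' => (hq σ' B (by
    change σ'.mem 0 ≤ B; rw [hσ'.1]; exact hB)).mono le_rfl
    (Q' := fun τ => τ.Holds output) fun τ hτ => ?_).mono (poly_add_le c c' e e' 0 B) fun _ h => h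
  refine ⟨?_, fun i hi => ?_⟩
  · rw [hτ.2, hl]
    change σ'.mem 0 * σ'.mem 0 + 1 = _
    rw [hσ'.1]
    rfl
  · rw [hτ.1.1, hσ'.1]
    exact ho i hi

section

variable {α : Type} [Ctx α] {D : α → ℕ → Prop}

/-- The conditions under which `k` rounds take polynomial time. -/
def IterOK (M : ℕ → ℕ) (k B : ℕ) : Prop :=
  0 < M 0 → k ≤ B ∧ ∀ i < k, HoldsAdj (liftStep^[i] M) ∧
    2 * (liftStep^[i] M) 0 * (2 * (liftStep^[i] M) 0) ≤ B ∧ Small (liftStep^[i] M) B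

/-- `k` rounds, but none on the empty graph. -/
def iterLift (M : ℕ → ℕ) (k : ℕ) : ℕ → ℕ := liftStep^[if M 0 = 0 then 0 else k] M

/-- For the empty graph the final size is 0 whatever `k` is, so the time allowed does not grow with
`k` and even `k` idle rounds would be too many. On a nonempty graph `k` is smaller than the final
size. -/
theorem trans_iterLift {k : α → ℕ} (hk : Comp D k) (hD : ∀ x B, D x B → IterOK (Ctx.mem x) (k x) B) :
    Trans D fun x => iterLift (Ctx.mem x) (k x) := by
  have hi : ∀ (x : α) (q : ℕ), (Nat.rec (Ctx.mem x) (fun q M => liftStep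
      (Ctx.mem ((Ctx.upd x M, q) : α × ℕ))) q : ℕ → ℕ) = liftStep^[q] (Ctx.mem x) := by
    intro x q
    induction q with
    | zero => rfl
    | succ q ih =>
      rw [Function.iterate_succ_apply', ← ih]
      change liftStep (Ctx.mem (Ctx.upd x _)) = _
      rw [Ctx.mem_upd]
  refine (Trans.iter (b := fun x => if Ctx.mem x 0 = 0 then 0 else k x)
    (g := fun y => liftStep (Ctx.mem y)) (Comp.ite (CompP.eq comp_mem0 (Comp.lit 0)) (Comp.lit 0) hk)
    ?_ ?_).congr fun x B _ => (hi x _).symm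
  · intro x B h
    split_ifs with h0
    · exact Nat.zero_le _
    · exact (hD x B h (Nat.pos_of_ne_zero h0)).1
  · refine trans_liftStep ?_
    rintro ⟨y, q⟩ B ⟨x, h, hq, hy⟩
    have h0 : Ctx.mem x 0 ≠ 0 := fun h0 => by simp [h0] at hq
    rw [if_neg h0] at hq
    have h1 := (hD x B h (Nat.pos_of_ne_zero h0)).2 q hq
    simp only at hy
    rw [hi] at hy
    rw [mem_fst, hy, Ctx.mem_upd]
    exact ⟨h1.1, h1.2.1, by have := h1.2.2.le; omega, fun _ => h1.2.2⟩

end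

/-- The encoded graph is moved to the beginning of the memory. -/
def shiftMem (M : ℕ → ℕ) : ℕ → ℕ := fill M 0 (1 + M 1 * M 1) fun p => M (p + 1)

/-- Moving the graph to the front overwrites the cell holding the number of rounds, which is
therefore saved in a register beforehand by `Trans.bind`. The next construction treats its second
input in the same way. -/
theorem trans_shift_iterLift :
    Trans (fun (M : ℕ → ℕ) B => 1 + M 1 * M 1 ≤ B ∧ IterOK (shiftMem M) (M 0) B)
      fun M => iterLift (shiftMem M) (M 0) := by
  have t1 : Trans (fun (x : (ℕ → ℕ) × ℕ) B => 1 + x.1 1 * x.1 1 ≤ B)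
      fun x => shiftMem x.1 := by
    have hsq : Comp (fun (x : (ℕ → ℕ) × ℕ) B => 1 + x.1 1 * x.1 1 ≤ B)
        fun x => 1 + x.1 1 * x.1 1 :=
      (Comp.lit 1).add ((Comp.cell (α := (ℕ → ℕ) × ℕ) (Comp.lit 1)).mul
        (Comp.cell (α := (ℕ → ℕ) × ℕ) (Comp.lit 1)) fun x B h => by
          change x.1 1 ≤ B
          have := Nat.le_mul_self (x.1 1); omega)
    refine Trans.fill (α := (ℕ → ℕ) × ℕ) (b := fun _ => 0) (N := fun x => 1 + x.1 1 * x.1 1)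
      (F := fun y => y.1.1 (y.2 + 1)) hsq (fun x B h => h) (Comp.lit 0)
      (Comp.cell (α := ((ℕ → ℕ) × ℕ) × ℕ) (Comp.snd.add (Comp.lit 1))) (fun _ _ _ _ _ => rfl) ?_
    intro x B q h hq
    exact if_neg (by omega)
  have t2 : Trans (fun (x : (ℕ → ℕ) × ℕ) B => IterOK x.1 x.2 B) fun x => iterLift x.1 x.2 :=
    trans_iterLift (α := (ℕ → ℕ) × ℕ) Comp.snd fun x B h => h
  have t3 : Trans (fun (x : (ℕ → ℕ) × ℕ) B => 1 + x.1 1 * x.1 1 ≤ B ∧ IterOK (shiftMem x.1) x.2 B)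
      fun x => iterLift (shiftMem x.1) x.2 :=
    Trans.seq (α := (ℕ → ℕ) × ℕ) (t1.mono fun x B h => h.1) t2 fun x B h => h.2
  exact Trans.bind (comp_mem0 (α := ℕ → ℕ)) t3 fun x B h => h

/-- The complete graph with `M 0 + 1` vertices. -/
def startMem (M : ℕ → ℕ) : ℕ → ℕ :=
  fill (Function.update M 0 (M 0 + 1)) 1 ((M 0 + 1) * (M 0 + 1)) fun p =>
    if p / (M 0 + 1) = p % (M 0 + 1) then 0 else 1

theorem trans_start_iterLift :
    Trans (fun (M : ℕ → ℕ) B => (M 0 + 1) * (M 0 + 1) ≤ B ∧ IterOK (startMem M) (M 1) B)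
      fun M => iterLift (startMem M) (M 1) := by
  have t0 : Trans (fun (_ : (ℕ → ℕ) × ℕ) (_ : ℕ) => True)
      fun x => Function.update x.1 0 (x.1 0 + 1) :=
    Trans.store (α := (ℕ → ℕ) × ℕ) (Comp.lit 0) (comp_mem0.add (Comp.lit 1))
  have t1 : Trans (fun (x : (ℕ → ℕ) × ℕ) B => 0 < x.1 0 ∧ x.1 0 * x.1 0 ≤ B)
      fun x => fill x.1 1 (x.1 0 * x.1 0) fun p => if p / x.1 0 = p % x.1 0 then 0 else 1 := by
    have hsq : Comp (fun (x : (ℕ → ℕ) × ℕ) B => 0 < x.1 0 ∧ x.1 0 * x.1 0 ≤ B)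
        fun x => x.1 0 * x.1 0 :=
      (comp_mem0 (α := (ℕ → ℕ) × ℕ)).mul (comp_mem0 (α := (ℕ → ℕ) × ℕ)) fun x B h =>
        (Nat.le_mul_self _).trans h.2
    refine Trans.fill (α := (ℕ → ℕ) × ℕ) (b := fun _ => 1) (N := fun x => x.1 0 * x.1 0)
      (F := fun y => if y.2 / y.1.1 0 = y.2 % y.1.1 0 then 0 else 1) hsq (fun x B h => h.2)
      (Comp.lit 1) ?_ (fun _ _ _ _ _ => rfl) ?_
    · refine Comp.ite (CompP.eq (Comp.div Comp.snd (comp_mem0 (α := ((ℕ → ℕ) × ℕ) × ℕ)) ?_ ?_)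
        (Comp.mod Comp.snd (comp_mem0 (α := ((ℕ → ℕ) × ℕ) × ℕ)) ?_ ?_)) (Comp.lit 0) (Comp.lit 1)
      all_goals
        rintro ⟨y, q⟩ B ⟨x, h, hq, hy⟩
        first
        | exact hq.le.trans h.2
        | change 0 < y.1 0
          rw [show y = _ from hy]
          exact h.1
    · intro x B q h hq
      have : (Ctx.upd x (fill (Ctx.mem x) 1 q fun p =>
        if p / x.1 0 = p % x.1 0 then 0 else 1)).1 0 = x.1 0 :=
        fill_one_zero x.1 q fun p => if p / x.1 0 = p % x.1 0 then 0 else 1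
      simp only [this]
  have t2 : Trans (fun (x : (ℕ → ℕ) × ℕ) B => IterOK x.1 x.2 B) fun x => iterLift x.1 x.2 :=
    trans_iterLift (α := (ℕ → ℕ) × ℕ) Comp.snd fun x B h => h
  have e : ∀ M : ℕ → ℕ, startMem M = fill (Function.update M 0 (M 0 + 1)) 1
      (Function.update M 0 (M 0 + 1) 0 * Function.update M 0 (M 0 + 1) 0) fun p =>
        if p / Function.update M 0 (M 0 + 1) 0 = p % Function.update M 0 (M 0 + 1) 0 then 0 else 1 := by
    intro M
    simp [startMem]
  have t3 : Trans (fun (x : (ℕ → ℕ) × ℕ) B => (x.1 0 + 1) * (x.1 0 + 1) ≤ B ∧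
      IterOK (startMem x.1) x.2 B) fun x => startMem x.1 := by
    refine (Trans.seq (α := (ℕ → ℕ) × ℕ) (t0.mono fun x B h => trivial) t1 fun x B h => ?_).congr
      fun x B _ => e x.1
    change 0 < Function.update x.1 0 (x.1 0 + 1) 0 ∧
      Function.update x.1 0 (x.1 0 + 1) 0 * Function.update x.1 0 (x.1 0 + 1) 0 ≤ B
    simpa using h.1
  have t4 : Trans (fun (x : (ℕ → ℕ) × ℕ) B => (x.1 0 + 1) * (x.1 0 + 1) ≤ B ∧
      IterOK (startMem x.1) x.2 B) fun x => iterLift (startMem x.1) x.2 :=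
    Trans.seq (α := (ℕ → ℕ) × ℕ) t3 t2 fun x B h => h.2
  exact Trans.bind (Comp.cell (α := ℕ → ℕ) (Comp.lit 1)) t4 fun x B h => h

end TwoLift

namespace TwoLift

/-! ### Graphs in memory -/

open Classical in
/-- The memory holds the graph `G`. -/
structure Encodes {n : ℕ} (M : ℕ → ℕ) (G : SimpleGraph (Fin n)) : Prop where
  size : M 0 = n
  adj : ∀ x y : Fin n, mat M x y = if G.Adj x y then 1 else 0

theorem encodeMatrix_length {n : ℕ} (f : Fin n → Fin n → ℕ) :
    (encodeMatrix f).length = n * n + 1 := by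
  simp [encodeMatrix]

theorem encodeMatrix_getD {n : ℕ} (f : Fin n → Fin n → ℕ) (x y : Fin n) :
    (encodeMatrix f).getD (1 + (n * x + y)) 0 = f x y := by
  have hlt := pos_lt x.2 y.2
  rw [add_comm 1, encodeMatrix, List.getD_cons_succ, List.getD_eq_getElem _ _ (by simpa using hlt),
    List.getElem_ofFn]
  congr 1
  · exact Fin.ext (pos_div y.2)
  · exact Fin.ext (pos_mod y.2)

/-- The memory on input `G`. -/
noncomputable def graphMem {n : ℕ} (G : SimpleGraph (Fin n)) : ℕ → ℕ :=
  (initState (encodeGraph G)).mem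

theorem graphMem_zero {n : ℕ} (G : SimpleGraph (Fin n)) : graphMem G 0 = n := rfl

theorem encodes_graphMem {n : ℕ} (G : SimpleGraph (Fin n)) : Encodes (graphMem G) G := by
  refine ⟨rfl, fun x y => ?_⟩
  unfold mat
  rw [graphMem_zero]
  exact encodeMatrix_getD _ x y

section

variable {n : ℕ} {G : SimpleGraph (Fin n)} {M : ℕ → ℕ}

theorem Encodes.holdsAdj (h : Encodes M G) : HoldsAdj M := by
  have key : ∀ x < M 0, ∀ y < M 0, ∃ x' y' : Fin n, x = x' ∧ y = y' := by
    intro x hx y hy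
    rw [h.size] at hx hy
    exact ⟨⟨x, hx⟩, ⟨y, hy⟩, rfl, rfl⟩
  constructor
  · intro x hx y hy
    obtain ⟨x, y, rfl, rfl⟩ := key x hx y hy
    rw [h.adj]
    split_ifs <;> simp
  · intro x hx y hy
    obtain ⟨x, y, rfl, rfl⟩ := key x hx y hy
    rw [h.adj, h.adj]
    classical exact if_congr (G.adj_comm _ _) rfl rfl

/-- After earlier rounds the cells behind the matrix contain debris, while `greedySigning` refers to
a clean input. The signs found are the same. -/
theorem Encodes.signMat_eq (h : Encodes M G) (x y : Fin n) :
    signMat M x y = signMat (graphMem G) x y := by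
  have h' := encodes_graphMem G
  have := signIter_congr (M := graphMem G) (M' := M) (by rw [h.size, h'.size]) (fun x hx y hy => ?_)
    le_rfl x (by rw [h'.size]; exact x.2) y (by rw [h'.size]; exact y.2)
  · unfold signMat
    rw [h.size]
    rwa [h'.size] at this
  · rw [h'.size] at hx hy
    exact (h.adj ⟨x, hx⟩ ⟨y, hy⟩).trans (h'.adj ⟨x, hx⟩ ⟨y, hy⟩).symm

/-- The signing that the greedy algorithm finds. -/
noncomputable def greedySigning {n : ℕ} (G : SimpleGraph (Fin n)) : Signing G := fun e =>
  if signMat (graphMem G) e.1.out.1 e.1.out.2 = 1 then 1 else -1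

/-- The signing reads the matrix at some representative of the unordered pair; by symmetry of the
sign matrix the choice does not matter. -/
theorem greedySigning_sign {x y : Fin n} (h : G.Adj x y) :
    (greedySigning G).sign h = if signMat (graphMem G) x y = 1 then 1 else -1 := by
  unfold Signing.sign greedySigning
  have h0 : s((s(x, y) : Sym2 (Fin n)).out.1, (s(x, y) : Sym2 (Fin n)).out.2) = s(x, y) :=
    Quot.out_eq _
  rcases Sym2.eq_iff.mp h0 with ⟨e1, e2⟩ | ⟨e1, e2⟩
  · simp only [e1, e2]
  · simp only [e1, e2]
    rw [signMat_symm]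
    exacts [y.2, x.2]

theorem signMat_eq_zero_iff {x y : Fin n} : signMat (graphMem G) x y = 0 ↔ ¬ G.Adj x y := by
  have h := encodes_graphMem G
  rw [(signMat_spec h.holdsAdj (by rw [h.size]; exact x.2) (by rw [h.size]; exact y.2)).2, h.adj]
  by_cases hxy : G.Adj x y <;> simp [hxy]

theorem signMat_le_two {x y : Fin n} : signMat (graphMem G) x y ≤ 2 := by
  have h := encodes_graphMem G
  exact (signMat_spec h.holdsAdj (by rw [h.size]; exact x.2) (by rw [h.size]; exact y.2)).1

open Classical in
theorem signMat_eq_code {x y : Fin n} : signMat (graphMem G) x y =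
    if h : G.Adj x y then (if (greedySigning G).sign h = 1 then 1 else 2) else 0 := by
  have h2 := signMat_le_two (G := G) (x := x) (y := y)
  have h0 := signMat_eq_zero_iff (G := G) (x := x) (y := y)
  by_cases h : G.Adj x y
  · rw [dif_pos h, greedySigning_sign h]
    have : signMat (graphMem G) x y ≠ 0 := fun h' => h0.mp h' h
    by_cases h1 : signMat (graphMem G) x y = 1
    · simp [h1]
    · rw [if_neg h1, if_neg (by decide)]
      omega
  · rw [dif_neg h]
    exact h0.mpr h

/-- The vertices of the 2-lift, numbered. -/
def liftEquiv (n : ℕ) : Fin (2 * n) ≃ Fin n × Bool :=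
  finProdFinEquiv.symm.trans ((Equiv.prodComm _ _).trans ((Equiv.refl _).prodCongr finTwoEquiv))

/-- The 2-lift on numbered vertices. -/
def liftGraph (s : Signing G) : SimpleGraph (Fin (2 * n)) := (lift s).comap (liftEquiv n)

theorem liftGraph_iso (s : Signing G) : Nonempty (liftGraph s ≃g lift s) :=
  ⟨SimpleGraph.Iso.comap (liftEquiv n) (lift s)⟩

/-- In the numbering by `liftEquiv`, the remainder of `i` modulo `n` is the base vertex and the
quotient is the layer, as in the matrix produced by `expand`. -/
theorem Encodes.liftStep (h : Encodes M G) :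
    Encodes (TwoLift.liftStep M) (liftGraph (greedySigning G)) := by
  have h1 : signIter M (M 0 * M 0) 0 = n := by rw [signIter_zero, h.size]
  refine ⟨by rw [TwoLift.liftStep, expand_zero, h1], fun i j => ?_⟩
  have hi := i.2
  have hj := j.2
  have hn : 0 < n := by omega
  have e1 := h.signMat_eq ⟨i % n, Nat.mod_lt _ hn⟩ ⟨j % n, Nat.mod_lt _ hn⟩
  simp only at e1
  have hp : ∀ i : Fin (2 * n), ((liftEquiv n) i).1 = ⟨i % n, Nat.mod_lt _ hn⟩ := fun i => rfl
  have hb : ∀ i j : Fin (2 * n), ((liftEquiv n) i).2 = ((liftEquiv n) j).2 ↔ (i : ℕ) / n = j / n := by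
    intro i j
    simp only [liftEquiv, Equiv.trans_apply]
    change finTwoEquiv _ = finTwoEquiv _ ↔ _
    rw [finTwoEquiv.apply_eq_iff_eq, Fin.ext_iff]
    rfl
  rw [TwoLift.liftStep, mat_expand (by rw [h1]; exact hi) (by rw [h1]; exact hj), h1]
  classical refine if_congr ?_ rfl rfl
  change (signMat M _ _ = 1 ∧ _) ∨ (signMat M _ _ = 2 ∧ _) ↔ _
  have e2 := signMat_eq_code (G := G) (x := ⟨i % n, Nat.mod_lt _ hn⟩) (y := ⟨j % n, Nat.mod_lt _ hn⟩)
  simp only [liftGraph, SimpleGraph.comap_adj, TwoLift.lift, hb, ne_eq, hp, e1]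
  simp only at e2
  rw [e2]
  by_cases hadj : G.Adj ⟨i % n, Nat.mod_lt _ hn⟩ ⟨j % n, Nat.mod_lt _ hn⟩
  · rw [dif_pos hadj]
    rcases Int.units_eq_one_or ((greedySigning G).sign hadj) with hs | hs <;>
      simp [hs, hadj]
  · simp [hadj]

/-- A bound for all loops of the algorithm. -/
def loopBound (n d : ℕ) : ℕ := 4 * n ^ 2 + 9 * d + 2 * (n * (9 * d) ^ (2 * lg n)) + 100

theorem deg0_eq {d : ℕ} (h : Encodes M G) (hG : IsRegular G d) (hn : 0 < n) :
    deg0 (mat M) (M 0) = d := by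
  rw [h.size, deg0, Finset.sum_range]
  rw [← hG ⟨0, hn⟩, ← SimpleGraph.card_neighborFinset_eq_degree, SimpleGraph.neighborFinset_eq_filter, Finset.card_filter]
  refine Finset.sum_congr rfl fun y _ => ?_
  have e := h.adj ⟨0, hn⟩ y
  simp only at e
  rw [e]
  split_ifs <;> simp_all

theorem Encodes.small {d B : ℕ} (h : Encodes M G) (hG : IsRegular G d) (hd : 0 < d) (hn : 0 < n)
    (hB : loopBound n d ≤ B) : Small M B := by
  have e := deg0_eq h hG hn
  unfold loopBound at hB
  refine ⟨by rwa [h.size], by rwa [e], ?_, by rw [e]; omega, ?_, ?_, by omega⟩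
  · rw [h.size, ← pow_two]; omega
  · rw [e, h.size]; omega
  · exact fun x hx y hy => (h.holdsAdj.le_one x hx y hy).trans one_le_two

theorem lg_eq {n : ℕ} (hn : 0 < n) : lg n = Nat.log 2 n + 1 := by
  unfold lg
  rw [← Finset.sum_filter, Finset.sum_const, smul_eq_mul, mul_one]
  have : (Finset.range n).filter (fun i => 2 ^ i ≤ n) = Finset.range (Nat.log 2 n + 1) := by
    ext i
    simp only [Finset.mem_filter, Finset.mem_range, Nat.lt_succ_iff,
      Nat.le_log_iff_pow_le one_lt_two hn.ne']
    exact ⟨fun h => h.2, fun h => ⟨i.lt_two_pow_self.trans_le h, h⟩⟩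
  rw [this, Finset.card_range]

theorem lg_mono {n n' : ℕ} (h : n ≤ n') : lg n ≤ lg n' := by
  rcases Nat.eq_zero_or_pos n with rfl | hn
  · simp [lg]
  · rw [lg_eq hn, lg_eq (hn.trans_le h)]
    exact Nat.succ_le_succ (Nat.log_mono_right h)

theorem loopBound_mono {n n' d : ℕ} (h : n ≤ n') (hd : 0 < d) : loopBound n d ≤ loopBound n' d := by
  have := lg_mono h
  unfold loopBound
  gcongr
  omega

/-- The number of labelled walks is polynomial in `n` for fixed `d`: `9 * d` is at most `2 ^ (9 *
d)`, and `2 ^ lg n` is at most `2 * n`, so the degree moves into the exponent of a power of `2 * n`.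
-/
theorem loopBound_le (n d : ℕ) : loopBound n d ≤
    4 * n ^ 2 + 9 * d + 2 * (n * (2 * n) ^ (18 * d)) + 100 := by
  rcases Nat.eq_zero_or_pos n with rfl | hn
  · simp [loopBound]
  have : (9 * d) ^ (2 * lg n) ≤ (2 * n) ^ (18 * d) := calc
    (9 * d) ^ (2 * lg n) ≤ (2 ^ (9 * d)) ^ (2 * lg n) :=
        Nat.pow_le_pow_left Nat.lt_two_pow_self.le _
    _ = (2 ^ lg n) ^ (18 * d) := by rw [← pow_mul, ← pow_mul]; congr 1; ring
    _ ≤ (2 * n) ^ (18 * d) := by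
      refine Nat.pow_le_pow_left ?_ _
      rw [lg_eq hn, pow_succ, mul_comm]
      exact Nat.mul_le_mul_left 2 (Nat.pow_log_le_self 2 hn.ne')
  unfold loopBound
  exact Nat.add_le_add_right (Nat.add_le_add_left (Nat.mul_le_mul_left 2
    (Nat.mul_le_mul_left n this)) _) _

theorem exists_poly (c h d : ℕ) : ∃ p : Polynomial ℕ, ∀ n, c * (loopBound n d + 1) ^ h ≤ p.eval n := by
  refine ⟨.C c * (4 * .X ^ 2 + 9 * .C d + 2 * (.X * (2 * .X) ^ (18 * d)) + 100 + 1) ^ h, fun n => ?_⟩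
  have := loopBound_le n d
  simp only [Polynomial.eval_mul, Polynomial.eval_C, Polynomial.eval_pow, Polynomial.eval_add,
    Polynomial.eval_X, Polynomial.eval_ofNat, Polynomial.eval_one]
  gcongr

end

end TwoLift

namespace TwoLift

section

variable {n : ℕ} {G : SimpleGraph (Fin n)}

/-! ### Regularity -/

/-- Projection is a bijection from the neighbors of a lifted vertex to the neighbors of its base
vertex, since the sign of an edge determines the layer of the other end. -/
theorem isRegular_lift {V : Type*} [Fintype V] {G : SimpleGraph V} {d : ℕ} (hG : IsRegular G d)
    (s : Signing G) : IsRegular (lift s) d := by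
  classical
  intro p
  rw [← hG p.1, ← SimpleGraph.card_neighborSet_eq_degree, ← SimpleGraph.card_neighborSet_eq_degree]
  refine Fintype.card_congr (Equiv.ofBijective (fun q => ⟨q.1.1, q.2.1⟩) ⟨?_, ?_⟩)
  · rintro ⟨⟨y, b⟩, h, hb⟩ ⟨⟨y', b'⟩, h', hb'⟩ he
    obtain rfl : y = y' := congrArg Subtype.val he
    have : ¬ (1 : ℤˣ) = -1 := by decide
    simp only at hb hb'
    have : b = b' := by
      rcases hb with ⟨h1, h2⟩ | ⟨h1, h2⟩ <;> rcases hb' with ⟨h3, h4⟩ | ⟨h3, h4⟩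
      · rw [← h2, h4]
      · exact absurd (h1.symm.trans h3) this
      · exact absurd (h3.symm.trans h1) this
      · clear he
        revert h2 h4
        cases p.2 <;> cases b <;> cases b' <;> simp
    subst this
    rfl
  · rintro ⟨y, h⟩
    change G.Adj p.1 y at h
    rcases Int.units_eq_one_or (s.sign h) with hs | hs
    · exact ⟨⟨(y, p.2), h, Or.inl ⟨hs, rfl⟩⟩, rfl⟩
    · exact ⟨⟨(y, !p.2), h, Or.inr ⟨hs, by simp⟩⟩, rfl⟩

theorem IsRegular.of_iso {V W : Type*} [Fintype V] [Fintype W] {G : SimpleGraph V}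
    {H : SimpleGraph W} {d : ℕ} (hG : IsRegular G d) (e : H ≃g G) : IsRegular H d := by
  classical
  intro x
  rw [← hG (e x)]
  exact (e.degree_eq x).symm

theorem isRegular_liftGraph {d : ℕ} (hG : IsRegular G d) (s : Signing G) :
    IsRegular (liftGraph s) d := by
  obtain ⟨e⟩ := liftGraph_iso s
  exact (isRegular_lift hG s).of_iso e

theorem isRegular_top (d : ℕ) : IsRegular (⊤ : SimpleGraph (Fin (d + 1))) d := by
  classical
  intro x
  convert SimpleGraph.complete_graph_degree x
  simp

/-! ### The programs -/

theorem getElem_encodeMatrix {M : ℕ → ℕ} {f : Fin n → Fin n → ℕ} (h0 : M 0 = n)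
    (h : ∀ x y : Fin n, mat M x y = f x y) (i : ℕ) (hi : i < (encodeMatrix f).length) :
    M i = (encodeMatrix f)[i] := by
  rw [encodeMatrix_length] at hi
  rcases i with _ | i
  · exact h0
  have hi' : i < n * n := by omega
  have hn : 0 < n := Nat.pos_of_ne_zero fun h => by simp [h] at hi'
  have := h ⟨i / n, pos_div_lt hi'⟩ ⟨i % n, Nat.mod_lt _ hn⟩
  rw [← encodeMatrix_getD f] at this
  simp only [mat, h0, Nat.div_add_mod] at this
  rw [add_comm 1] at this
  rw [this, List.getD_eq_getElem]

theorem exists_signing_prog : ∃ (p : Prog) (c h : ℕ), ∀ {n d B : ℕ} (G : SimpleGraph (Fin n)),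
    IsRegular G d → 0 < d → loopBound n d ≤ B →
    p.OutputsWithin (encodeGraph G) (encodeSigning (greedySigning G)) (c * (B + 1) ^ h) := by
  obtain ⟨p, c, h, H⟩ := (trans_sign (α := ℕ → ℕ) (D := fun M B => HoldsAdj M ∧ M 0 * M 0 ≤ B ∧
    (0 < M 0 → Small M B)) fun _ _ h => h).exists_prog
  refine ⟨p, c, h, fun {n d B} G hG hd hB => ?_⟩
  have hE := encodes_graphMem G
  have h0 : signIter (graphMem G) (graphMem G 0 * graphMem G 0) 0 = n := by
    rw [signIter_zero, hE.size]
  have hnB : n * n ≤ B := by unfold loopBound at hB; rw [← pow_two]; omega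
  refine H _ _ B ⟨hE.holdsAdj, ?_, fun hn => hE.small hG hd ?_ hB⟩ ?_ ?_ ?_
  · exact hnB
  · exact hn
  · exact h0.le.trans ((Nat.le_mul_self n).trans hnB)
  · rw [encodeSigning, encodeMatrix_length]
    exact congrArg (fun t => t * t + 1) h0.symm
  · exact getElem_encodeMatrix h0 fun x y => signMat_eq_code

/-- The property `P` will be sparsity together with the eigenvalue bound. The memory is followed
along with the graph, so that the matrix computed by the iterating program is that of the iterated
lift. -/
theorem exists_iteratedLift {M : Prog} {d n₀ : ℕ} {G₀ : SimpleGraph (Fin n₀)}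
    (hG₀ : IsRegular G₀ d)
    (hM : ∀ (n : ℕ) (G : SimpleGraph (Fin n)), IsRegular G d →
      M.Outputs (encodeGraph G) (encodeSigning (greedySigning G)))
    {P : ∀ n : ℕ, SimpleGraph (Fin n) → Prop} (hP₀ : P n₀ G₀)
    (hP : ∀ (n : ℕ) (G : SimpleGraph (Fin n)), IsRegular G d → P n G →
      P (2 * n) (liftGraph (greedySigning G))) {M₀ : ℕ → ℕ} (hM₀ : Encodes M₀ G₀) (k : ℕ) :
    ∀ N, N = 2 ^ k * n₀ → ∃ G : SimpleGraph (Fin N),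
      IteratedLift M G₀ k G ∧ IsRegular G d ∧ P N G ∧ Encodes (liftStep^[k] M₀) G := by
  induction k with
  | zero =>
    intro N hN
    obtain rfl : N = n₀ := by simpa using hN
    exact ⟨G₀, .base, hG₀, hP₀, hM₀⟩
  | succ k ih =>
    intro N hN
    obtain ⟨G, h1, h2, h3, h4⟩ := ih _ rfl
    obtain rfl : N = 2 * (2 ^ k * n₀) := by rw [hN, pow_succ]; ring
    refine ⟨liftGraph (greedySigning G), .step _ h1 (hM _ _ h2) (liftGraph_iso _),
      isRegular_liftGraph h2 _, hP _ _ h2 h3, ?_⟩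
    rw [Function.iterate_succ_apply']
    exact h4.liftStep

theorem Encodes.of_size_zero {M : ℕ → ℕ} (hn : n = 0) (h : M 0 = 0) : Encodes M G :=
  ⟨h.trans hn.symm, fun x => by have := x.2; omega⟩

/-- Each round starts from a graph of at most half the final size, so the loop bound for the final
size covers all rounds, including the doubling at the end of each. -/
theorem Encodes.iterOK {M₀ : ℕ → ℕ} {d n₀ k B : ℕ} {G₀ : SimpleGraph (Fin n₀)}
    (h : Encodes M₀ G₀) (hG₀ : IsRegular G₀ d) (hd : 0 < d)
    (hB : loopBound (2 ^ k * n₀) d ≤ B) : IterOK M₀ k B := by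
  intro hn
  rw [h.size] at hn
  have hk : k ≤ 2 ^ k * n₀ := k.lt_two_pow_self.le.trans (Nat.le_mul_of_pos_right _ hn)
  have hB' := hB
  unfold loopBound at hB'
  refine ⟨?_, fun i hi => ?_⟩
  · have : 2 ^ k * n₀ ≤ (2 ^ k * n₀) ^ 2 := Nat.le_self_pow two_ne_zero _
    omega
  have key : ∀ i, ∃ G : SimpleGraph (Fin (2 ^ i * n₀)), IsRegular G d ∧ Encodes (TwoLift.liftStep^[i] M₀) G := by
    intro i
    induction i with
    | zero =>
      have e : n₀ = 2 ^ 0 * n₀ := by simp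
      generalize hm : 2 ^ 0 * n₀ = m at e
      subst e
      exact ⟨G₀, hG₀, h⟩
    | succ i ih =>
      obtain ⟨G, h1, h2⟩ := ih
      have e : 2 * (2 ^ i * n₀) = 2 ^ (i + 1) * n₀ := by ring
      generalize 2 ^ (i + 1) * n₀ = m at e
      subst e
      exact ⟨_, isRegular_liftGraph h1 _, by rw [Function.iterate_succ_apply']; exact h2.liftStep⟩
  obtain ⟨G, h1, h2⟩ := key i
  have hle : 2 * (2 ^ i * n₀) ≤ 2 ^ k * n₀ := by
    rw [← mul_assoc, ← pow_succ']
    exact Nat.mul_le_mul_right _ (Nat.pow_le_pow_right two_pos hi)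
  refine ⟨h2.holdsAdj, ?_, h2.small h1 hd (by positivity) ((loopBound_mono (by omega) hd).trans hB)⟩
  rw [h2.size]
  have := Nat.mul_le_mul hle hle
  rw [← pow_two (2 ^ k * n₀)] at this
  omega

theorem Encodes.iterLift {M₀ : ℕ → ℕ} {n₀ N k : ℕ} {G₀ : SimpleGraph (Fin n₀)}
    {G : SimpleGraph (Fin N)} (h : Encodes M₀ G₀) (hN : N = 2 ^ k * n₀)
    (hG : Encodes (TwoLift.liftStep^[k] M₀) G) : Encodes (TwoLift.iterLift M₀ k) G := by
  unfold TwoLift.iterLift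
  by_cases h0 : M₀ 0 = 0
  · rw [if_pos h0]
    exact .of_size_zero (by rw [hN, ← h.size, h0, mul_zero]) h0
  · rwa [if_neg h0]

theorem encodes_shiftMem {n₀ k : ℕ} (G₀ : SimpleGraph (Fin n₀)) :
    Encodes (shiftMem (initState (k :: encodeGraph G₀)).mem) G₀ := by
  have e : ∀ i, (initState (k :: encodeGraph G₀)).mem (i + 1) = graphMem G₀ i := fun i => by
    simp [graphMem, initState]
  have e1 : (initState (k :: encodeGraph G₀)).mem 1 = n₀ := (e 0).trans (graphMem_zero G₀)
  have e2 : ∀ i < 1 + n₀ * n₀, shiftMem (initState (k :: encodeGraph G₀)).mem i = graphMem G₀ i := by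
    intro i hi
    rw [shiftMem, fill, if_pos (by rw [e1]; omega), Nat.sub_zero, e]
  have h := encodes_graphMem G₀
  have h0 : shiftMem (initState (k :: encodeGraph G₀)).mem 0 = n₀ := e2 0 (by omega)
  refine ⟨h0, fun x y => ?_⟩
  rw [← h.adj, mat, mat, h.size, h0, e2]
  have := pos_lt x.2 y.2
  omega

theorem encodes_startMem {d k : ℕ} :
    Encodes (startMem (initState [d, k]).mem) (⊤ : SimpleGraph (Fin (d + 1))) := by
  have h0 : startMem (initState [d, k]).mem 0 = d + 1 := by
    rw [startMem, fill, if_neg (by omega), Function.update_self]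
    rfl
  have h1 : (initState [d, k]).mem 0 = d := rfl
  refine ⟨h0, fun x y => ?_⟩
  have := pos_lt x.2 y.2
  rw [mat, h0, startMem, fill, h1, if_pos (by omega), Nat.add_sub_cancel_left, pos_div y.2,
    pos_mod y.2]
  by_cases hxy : x = y
  · simp [hxy]
  · rw [if_neg (fun h => hxy (Fin.ext h))]
    simp [hxy]

theorem exists_iterate_prog : ∃ (p : Prog) (c h : ℕ), ∀ {n₀ d k B N : ℕ}
    {G₀ : SimpleGraph (Fin n₀)} {G : SimpleGraph (Fin N)}, IsRegular G₀ d → 0 < d → N = 2 ^ k * n₀ →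
    Encodes (liftStep^[k] (shiftMem (initState (k :: encodeGraph G₀)).mem)) G →
    loopBound N d ≤ B →
    p.OutputsWithin (k :: encodeGraph G₀) (encodeGraph G) (c * (B + 1) ^ h) := by
  obtain ⟨p, c, h, H⟩ := trans_shift_iterLift.exists_prog
  refine ⟨p, c, h, fun {n₀ d k B N G₀ G} hG₀ hd hN hG hB => ?_⟩
  have hE := encodes_shiftMem (k := k) G₀
  have hF := hE.iterLift hN hG
  have hn : n₀ ≤ N := hN ▸ Nat.le_mul_of_pos_left _ (by positivity)
  have hB' := hB
  unfold loopBound at hB'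
  have hnn := Nat.mul_le_mul hn hn
  rw [← pow_two N] at hnn
  have hNN : N ≤ N ^ 2 := Nat.le_self_pow two_ne_zero _
  have e1 : (initState (k :: encodeGraph G₀)).mem 1 = n₀ := rfl
  refine H _ _ B ⟨by rw [e1]; omega, hE.iterOK hG₀ hd (hN ▸ hB)⟩ ?_ ?_ ?_
  · exact hF.size.le.trans (by omega)
  · rw [encodeGraph, encodeMatrix_length]
    exact congrArg (fun t => t * t + 1) hF.size.symm
  · exact getElem_encodeMatrix hF.size hF.adj

theorem exists_start_prog : ∃ (p : Prog) (c h : ℕ), ∀ {d k B N : ℕ}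
    {G : SimpleGraph (Fin N)}, 0 < d → N = 2 ^ k * (d + 1) →
    Encodes (liftStep^[k] (startMem (initState [d, k]).mem)) G →
    loopBound N d ≤ B →
    p.OutputsWithin [d, k] (encodeGraph G) (c * (B + 1) ^ h) := by
  obtain ⟨p, c, h, H⟩ := trans_start_iterLift.exists_prog
  refine ⟨p, c, h, fun {d k B N G} hd hN hG hB => ?_⟩
  have hE := encodes_startMem (d := d) (k := k)
  have hF := hE.iterLift hN hG
  have hn : d + 1 ≤ N := hN ▸ Nat.le_mul_of_pos_left _ (by positivity)
  have hB' := hB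
  unfold loopBound at hB'
  have hnn := Nat.mul_le_mul hn hn
  rw [← pow_two N] at hnn
  have hNN : N ≤ N ^ 2 := Nat.le_self_pow two_ne_zero _
  have e1 : (initState [d, k]).mem 0 = d := rfl
  refine H _ _ B ⟨by rw [e1]; omega, hE.iterOK (isRegular_top d) hd (hN ▸ hB)⟩ ?_ ?_ ?_
  · exact hF.size.le.trans (by omega)
  · rw [encodeGraph, encodeMatrix_length]
    exact congrArg (fun t => t * t + 1) hF.size.symm
  · exact getElem_encodeMatrix hF.size hF.adj

end

end TwoLift

namespace TwoLift

/-! ### Quadratic forms and eigenvalues -/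

open Matrix

theorem dotProduct_self_eq_norm_sq {V : Type*} [Fintype V] (x : V → ℝ) :
    x ⬝ᵥ x = ‖WithLp.toLp 2 x‖ ^ 2 := by
  rw [EuclideanSpace.norm_sq_eq, dotProduct]
  exact Finset.sum_congr rfl fun i _ => by simp [pow_two]

theorem dotProduct_mulVec_eq_sum {V : Type*} [Fintype V] (A : Matrix V V ℝ) (x y : V → ℝ) :
    x ⬝ᵥ A *ᵥ y = ∑ u, ∑ v, A u v * (x u * y v) := by
  simp only [dotProduct, mulVec, Finset.mul_sum]
  exact Finset.sum_congr rfl fun _ _ => Finset.sum_congr rfl fun _ _ => by ring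

section

variable {V : Type*} [Fintype V] [DecidableEq V] {A : Matrix V V ℝ}

theorem exists_spectral (hA : A.IsHermitian) : ∃ v : V → V → ℝ,
    (∀ i, A *ᵥ v i = hA.eigenvalues i • v i) ∧ (∀ i, v i ⬝ᵥ v i = 1) ∧
    (∀ i j, i ≠ j → v i ⬝ᵥ v j = 0) ∧ (∀ x y, x ⬝ᵥ y = ∑ i, (v i ⬝ᵥ x) * (v i ⬝ᵥ y)) ∧
    ∀ x, x ⬝ᵥ A *ᵥ x = ∑ i, hA.eigenvalues i * (v i ⬝ᵥ x) ^ 2 := by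
  set b := hA.eigenvectorBasis
  have hin : ∀ x y : EuclideanSpace ℝ V, inner ℝ x y = x.ofLp ⬝ᵥ y.ofLp := fun x y => by
    rw [EuclideanSpace.inner_eq_star_dotProduct, dotProduct_comm]
    simp
  have h1 : ∀ i, A *ᵥ (b i).ofLp = hA.eigenvalues i • (b i).ofLp := hA.mulVec_eigenvectorBasis
  have h4 : ∀ x y : V → ℝ, x ⬝ᵥ y = ∑ i, ((b i).ofLp ⬝ᵥ x) * ((b i).ofLp ⬝ᵥ y) := fun x y => by
    have := b.sum_inner_mul_inner (WithLp.toLp 2 x) (WithLp.toLp 2 y)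
    simp only [hin] at this
    rw [← this]
    exact Finset.sum_congr rfl fun i _ => by rw [dotProduct_comm x]
  refine ⟨fun i => (b i).ofLp, h1, fun i => ?_, fun i j hij => ?_, h4, fun x => ?_⟩
  · rw [← hin, real_inner_self_eq_norm_sq, b.norm_eq_one, one_pow]
  · rw [← hin]
    exact b.orthonormal.2 hij
  · rw [h4]
    refine Finset.sum_congr rfl fun i _ => ?_
    have ht : Aᵀ = A := by rw [← conjTranspose_eq_transpose_of_trivial]; exact hA
    have : (b i).ofLp ⬝ᵥ A *ᵥ x = hA.eigenvalues i * ((b i).ofLp ⬝ᵥ x) := by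
      rw [dotProduct_mulVec, ← mulVec_transpose, ht, h1, smul_dotProduct, smul_eq_mul]
    rw [this]
    ring

theorem abs_quadratic_le_of_eigenvalues (hA : A.IsHermitian) {c : ℝ}
    (h : ∀ i, |hA.eigenvalues i| ≤ c) (x : V → ℝ) : |x ⬝ᵥ A *ᵥ x| ≤ c * (x ⬝ᵥ x) := by
  obtain ⟨v, _, _, _, h4, h5⟩ := exists_spectral hA
  rw [h5, h4, Finset.mul_sum]
  refine (Finset.abs_sum_le_sum_abs _ _).trans (Finset.sum_le_sum fun i _ => ?_)
  rw [abs_mul, abs_pow, sq_abs, pow_two]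
  exact mul_le_mul_of_nonneg_right (h i) (mul_self_nonneg _)

theorem spectralRadius_le_of_quadratic {c : ℝ}
    (h : ∀ x : V → ℝ, |x ⬝ᵥ A *ᵥ x| ≤ c * (x ⬝ᵥ x)) : spectralRadius ℝ A ≤ ENNReal.ofReal c := by
  refine iSup₂_le fun k hk => ?_
  rw [← Matrix.spectrum_toLin', ← Module.End.hasEigenvalue_iff_mem_spectrum] at hk
  obtain ⟨x, hx⟩ := hk.exists_hasEigenvector
  have e : A *ᵥ x = k • x := by simpa using hx.apply_eq_smul
  have h1 := h x
  rw [e, dotProduct_smul, smul_eq_mul, abs_mul] at h1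
  have hpos : 0 < x ⬝ᵥ x := by
    have : (0 : ℝ) ≤ x ⬝ᵥ x := Finset.sum_nonneg fun i _ => mul_self_nonneg _
    exact lt_of_le_of_ne this fun h0 => hx.2 (dotProduct_self_eq_zero.mp h0.symm)
  rw [abs_of_pos hpos] at h1
  have h2 : |k| ≤ c := le_of_mul_le_mul_right h1 hpos
  change ‖k‖ₑ ≤ _
  rw [← ofReal_norm, Real.norm_eq_abs]
  exact ENNReal.ofReal_le_ofReal h2

end

section

variable {V : Type*} {G : SimpleGraph V}

theorem adj_apply [DecidableRel G.Adj] (x y : V) : adj G x y = if G.Adj x y then 1 else 0 := by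
  rw [adj, SimpleGraph.adjMatrix_apply]
  congr

theorem adj_nonneg (x y : V) : 0 ≤ adj G x y := by
  classical
  rw [adj_apply]
  split_ifs <;> simp

theorem adj_symm (x y : V) : adj G x y = adj G y x := by
  classical
  rw [adj_apply, adj_apply]
  exact if_congr (G.adj_comm x y) rfl rfl

theorem signedAdj_apply (s : Signing G) {x y : V} (h : G.Adj x y) :
    signedAdj s x y = (((s.sign h : ℤˣ) : ℤ) : ℝ) := by
  classical
  simp [signedAdj, h]

theorem signedAdj_apply_of_not_adj (s : Signing G) {x y : V} (h : ¬ G.Adj x y) :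
    signedAdj s x y = 0 := by
  classical
  simp [signedAdj, h]

theorem signedAdj_symm (s : Signing G) (x y : V) : signedAdj s x y = signedAdj s y x := by
  by_cases h : G.Adj x y
  · rw [signedAdj_apply s h, signedAdj_apply s h.symm]
    have e : s.sign h.symm = s.sign h := congrArg s (Subtype.ext Sym2.eq_swap)
    rw [e]
  · rw [signedAdj_apply_of_not_adj s h, signedAdj_apply_of_not_adj s fun h' => h h'.symm]

theorem signedAdj_isHermitian (s : Signing G) : (signedAdj s).IsHermitian := by
  ext x y
  simp [signedAdj_symm s x y]

theorem abs_signedAdj (s : Signing G) (x y : V) : |signedAdj s x y| = adj G x y := by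
  classical
  rw [adj_apply]
  by_cases h : G.Adj x y
  · rw [signedAdj_apply s h, if_pos h]
    rcases Int.units_eq_one_or (s.sign h) with h | h <;> simp [h]
  · rw [signedAdj_apply_of_not_adj s h, if_neg h, abs_zero]

/-- The edges of sign 1 have adjacency matrix (A + A_s)/2, those of sign -1 have (A - A_s)/2; they
fill the diagonal and the off-diagonal blocks of the lift. -/
theorem adj_lift_apply (s : Signing G) (x y : V) (i j : Bool) : adj (lift s) (x, i) (y, j) =
    if i = j then (adj G x y + signedAdj s x y) / 2 else (adj G x y - signedAdj s x y) / 2 := by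
  classical
  rw [adj_apply, adj_apply]
  by_cases h : G.Adj x y
  · rw [signedAdj_apply s h, if_pos h]
    rcases Int.units_eq_one_or (s.sign h) with hs | hs <;> by_cases hij : i = j <;>
      simp [lift, hs, h, hij]
  · rw [signedAdj_apply_of_not_adj s h, if_neg h]
    simp [lift, h]

end

section

variable {V : Type*} [Fintype V] {G : SimpleGraph V} {d : ℕ}

theorem sum_adj (hG : IsRegular G d) (x : V) : ∑ y, adj G x y = d := by
  classical
  simp only [adj_apply]
  rw [← hG x, ← SimpleGraph.card_neighborFinset_eq_degree, Finset.sum_boole]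
  congr 2
  ext y
  simp

theorem adj_mulVec_one (hG : IsRegular G d) : adj G *ᵥ (fun _ => 1) = (d : ℝ) • fun _ => 1 := by
  ext x
  simp [mulVec, dotProduct, sum_adj hG]

/-- On each edge |ab| ≤ (a² + b²)/2, and each vertex is counted `d` times. The form with a sum of
squares, instead of a product of norms, is the one passed on to the trace bounds. -/
theorem abs_bilinear_le_of_abs_le_adj (hG : IsRegular G d) {B : Matrix V V ℝ}
    (hB : ∀ x y, |B x y| ≤ adj G x y) (x y : V → ℝ) :
    |x ⬝ᵥ B *ᵥ y| ≤ d / 2 * (x ⬝ᵥ x + y ⬝ᵥ y) := by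
  rw [dotProduct_mulVec_eq_sum]
  have h1 : |∑ u, ∑ v, B u v * (x u * y v)| ≤
      ∑ u, ∑ v, (adj G u v * (x u * x u) / 2 + adj G u v * (y v * y v) / 2) := by
    refine (Finset.abs_sum_le_sum_abs _ _).trans (Finset.sum_le_sum fun u _ =>
      (Finset.abs_sum_le_sum_abs _ _).trans (Finset.sum_le_sum fun v _ => ?_))
    have h2 : |x u * y v| ≤ (x u * x u + y v * y v) / 2 := by
      rw [abs_le]
      constructor <;> nlinarith [sq_nonneg (x u + y v), sq_nonneg (x u - y v)]
    rw [abs_mul]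
    calc |B u v| * |x u * y v| ≤ adj G u v * ((x u * x u + y v * y v) / 2) :=
          mul_le_mul (hB u v) h2 (abs_nonneg _) (adj_nonneg u v)
      _ = _ := by ring
  refine h1.trans_eq ?_
  simp only [Finset.sum_add_distrib]
  have e1 : ∑ u, ∑ v, adj G u v * (x u * x u) / 2 = d / 2 * (x ⬝ᵥ x) := by
    rw [dotProduct, Finset.mul_sum]
    refine Finset.sum_congr rfl fun u _ => ?_
    rw [← Finset.sum_div, ← Finset.sum_mul, sum_adj hG]
    ring
  have e2 : ∑ u, ∑ v, adj G u v * (y v * y v) / 2 = d / 2 * (y ⬝ᵥ y) := by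
    rw [Finset.sum_comm, dotProduct, Finset.mul_sum]
    refine Finset.sum_congr rfl fun u _ => ?_
    rw [← Finset.sum_div, ← Finset.sum_mul]
    simp only [fun v => adj_symm (G := G) v u]
    rw [sum_adj hG]
    ring
  rw [e1, e2]
  ring

theorem abs_quadratic_adj_le (hG : IsRegular G d) (x : V → ℝ) :
    |x ⬝ᵥ adj G *ᵥ x| ≤ d * (x ⬝ᵥ x) := by
  have := abs_bilinear_le_of_abs_le_adj hG
    (fun u v => (abs_of_nonneg (adj_nonneg (G := G) u v)).le) x x
  linarith

theorem secondEigenvalue_nonneg : 0 ≤ secondEigenvalue G := Real.iSup_nonneg fun _ => abs_nonneg _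

/-- An eigenvector with negative eigenvalue is orthogonal to the constants, whose eigenvalue is `d`.
For a nonnegative eigenvalue of positive index, some nonzero combination of its eigenvector with the
one of index 0 is orthogonal to the constants, and the form there is at least that eigenvalue times
the squared norm. Connectedness is not needed. -/
theorem secondEigenvalue_le (hG : IsRegular G d) {c : ℝ} (hc : 0 ≤ c)
    (h : ∀ x : V → ℝ, x ⬝ᵥ (fun _ => 1) = 0 → |x ⬝ᵥ adj G *ᵥ x| ≤ c * (x ⬝ᵥ x)) :
    secondEigenvalue G ≤ c := by
  classical
  refine Real.iSup_le (fun i => ?_) hc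
  obtain ⟨v, h1, h2, h3, -, -⟩ := exists_spectral (adj_isHermitian G)
  have hcard : 0 < Fintype.card V := i.1.pos
  set e : Fin (Fintype.card V) ≃ V := Fintype.equivOfCardEq (Fintype.card_fin _) with he
  set ev := (adj_isHermitian G).eigenvalues₀ with hev
  have hv : ∀ j, adj G *ᵥ v (e j) = ev j • v (e j) := fun j => by
    have hj := h1 (e j)
    rw [Matrix.IsHermitian.eigenvalues, Equiv.symm_apply_apply] at hj
    exact hj
  have ht : (adj G)ᵀ = adj G := Matrix.ext fun x y => adj_symm y x
  rcases lt_or_ge (ev i) 0 with hneg | hpos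
  · have h0 : v (e i) ⬝ᵥ (fun _ => 1) = 0 := by
      have : v (e i) ⬝ᵥ (adj G *ᵥ fun _ => 1) = ev i * (v (e i) ⬝ᵥ fun _ => 1) := by
        rw [dotProduct_mulVec, ← mulVec_transpose, ht, hv, smul_dotProduct, smul_eq_mul]
      rw [adj_mulVec_one hG, dotProduct_smul, smul_eq_mul] at this
      have hd : (0 : ℝ) ≤ d := d.cast_nonneg
      have : (d - ev i) * (v (e i) ⬝ᵥ fun _ => 1) = 0 := by linarith
      rcases mul_eq_zero.mp this with h | h
      · linarith
      · exact h
    have := h _ h0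
    rwa [hv, dotProduct_smul, h2, smul_eq_mul, mul_one, mul_one] at this
  · set o : Fin (Fintype.card V) := ⟨0, hcard⟩
    have hoi : o ≠ i := fun h => by
      have := i.2
      rw [← h] at this
      exact lt_irrefl _ this
    have hle : ev i ≤ ev o := (adj_isHermitian G).eigenvalues₀_antitone (Fin.mk_le_mk.mpr (Nat.zero_le _))
    have hne : e o ≠ e i := fun h => hoi (e.injective h)
    set p := v (e o) ⬝ᵥ (fun _ => (1 : ℝ))
    set q := v (e i) ⬝ᵥ (fun _ => (1 : ℝ))
    rw [abs_of_nonneg hpos]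
    have key : ∀ a b : ℝ, a * p + b * q = 0 → 0 < a ^ 2 + b ^ 2 → ev i ≤ c := by
      intro a b hab hpos'
      have := h (a • v (e o) + b • v (e i)) (by
        simpa [add_dotProduct, smul_dotProduct] using hab)
      have e1 : (a • v (e o) + b • v (e i)) ⬝ᵥ (a • v (e o) + b • v (e i)) = a ^ 2 + b ^ 2 := by
        simp only [add_dotProduct, dotProduct_add, smul_dotProduct, dotProduct_smul, h2,
          h3 _ _ hne, h3 _ _ hne.symm, smul_eq_mul]
        ring
      have e2 : (a • v (e o) + b • v (e i)) ⬝ᵥ adj G *ᵥ (a • v (e o) + b • v (e i)) =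
          a ^ 2 * ev o + b ^ 2 * ev i := by
        simp only [mulVec_add, mulVec_smul, hv, add_dotProduct, dotProduct_add, smul_dotProduct,
          dotProduct_smul, h2, h3 _ _ hne, h3 _ _ hne.symm, smul_eq_mul]
        ring
      rw [e1, e2] at this
      have h5 := (le_abs_self _).trans this
      have h6 : a ^ 2 * ev i ≤ a ^ 2 * ev o := mul_le_mul_of_nonneg_left hle (sq_nonneg a)
      nlinarith
    -- The combination with coefficients `-q` and `p` is orthogonal to the constants and nonzero if
    -- `p` is. If `p = 0`, the eigenvector of index 0 is itself orthogonal.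
    by_cases hp : p = 0
    · exact key 1 0 (by rw [hp]; ring) (by norm_num)
    · exact key (-q) p (by ring) (by positivity)

/-- Only the eigenvalue of index 0 is missing from the supremum, and its eigenvector need not be
constant. If another eigenvector is not orthogonal to the constants, its eigenvalue is `d`, which
dominates all. Otherwise the constants are spanned by the eigenvector of index 0, to which `x` is
then orthogonal. -/
theorem abs_quadratic_le_secondEigenvalue (hG : IsRegular G d) (x : V → ℝ)
    (hx : x ⬝ᵥ (fun _ => 1) = 0) : |x ⬝ᵥ adj G *ᵥ x| ≤ secondEigenvalue G * (x ⬝ᵥ x) := by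
  classical
  obtain ⟨v, h1, h2, h3, h4, h5⟩ := exists_spectral (adj_isHermitian G)
  set e : Fin (Fintype.card V) ≃ V := Fintype.equivOfCardEq (Fintype.card_fin _) with he
  have hle : ∀ i : V, 0 < (e.symm i).val → |(adj_isHermitian G).eigenvalues i| ≤ secondEigenvalue G :=
    fun i hi => le_ciSup (f := fun i : {i : Fin (Fintype.card V) // 0 < i.val} =>
      |(adj_isHermitian G).eigenvalues₀ i|) (Set.finite_range _).bddAbove ⟨e.symm i, hi⟩
  have ht : (adj G)ᵀ = adj G := Matrix.ext fun x y => adj_symm y x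
  have h0 : ∀ i, v i ⬝ᵥ (fun _ => 1) ≠ 0 → (adj_isHermitian G).eigenvalues i = d := by
    intro i hi
    have : v i ⬝ᵥ (adj G *ᵥ fun _ => 1) =
        (adj_isHermitian G).eigenvalues i * (v i ⬝ᵥ fun _ => 1) := by
      rw [dotProduct_mulVec, ← mulVec_transpose, ht, h1, smul_dotProduct, smul_eq_mul]
    rw [adj_mulVec_one hG, dotProduct_smul, smul_eq_mul] at this
    exact (mul_right_cancel₀ hi this).symm
  have key : ∀ i, |(adj_isHermitian G).eigenvalues i| * (v i ⬝ᵥ x) ^ 2 ≤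
      secondEigenvalue G * (v i ⬝ᵥ x) ^ 2 := by
    intro i
    by_cases hi : 0 < (e.symm i).val
    · exact mul_le_mul_of_nonneg_right (hle i hi) (sq_nonneg _)
    by_cases hj : ∃ j, j ≠ i ∧ v j ⬝ᵥ (fun _ => 1) ≠ 0
    · obtain ⟨j, hji, hj⟩ := hj
      refine mul_le_mul_of_nonneg_right ?_ (sq_nonneg _)
      have hj' : 0 < (e.symm j).val := by
        refine Nat.pos_of_ne_zero fun h => hji (e.symm.injective (Fin.ext ?_))
        omega
      have h6 := hle j hj'
      rw [h0 j hj, Nat.abs_cast] at h6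
      have h7 := abs_quadratic_adj_le hG (v i)
      rw [h1, dotProduct_smul, h2, smul_eq_mul, mul_one, mul_one] at h7
      exact h7.trans h6
    · push Not at hj
      have h6 := h4 x (fun _ => 1)
      rw [hx, Finset.sum_eq_single i (fun j _ hji => by rw [hj j hji, mul_zero]) (by simp)] at h6
      have h7 : v i ⬝ᵥ (fun _ => (1 : ℝ)) ≠ 0 := by
        intro h
        have h8 := h4 (fun _ => 1) (fun _ => 1)
        rw [Finset.sum_eq_zero fun j _ => ?_] at h8
        · have h9 := dotProduct_self_eq_zero.mp h8
          exact one_ne_zero (congrFun h9 i)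
        · by_cases hji : j = i
          · rw [hji, h, mul_zero]
          · rw [hj j hji, mul_zero]
      have : v i ⬝ᵥ x = 0 := (mul_eq_zero.mp h6.symm).resolve_right h7
      simp [this]
  rw [h5, h4, Finset.mul_sum]
  refine (Finset.abs_sum_le_sum_abs _ _).trans (Finset.sum_le_sum fun i _ => ?_)
  rw [abs_mul, abs_pow, sq_abs, ← pow_two]
  exact key i

theorem quadratic_lift (s : Signing G) (z : V × Bool → ℝ) : z ⬝ᵥ adj (lift s) *ᵥ z =
    ((fun x => z (x, false) + z (x, true)) ⬝ᵥ adj G *ᵥ (fun x => z (x, false) + z (x, true)) +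
      (fun x => z (x, false) - z (x, true)) ⬝ᵥ
        signedAdj s *ᵥ (fun x => z (x, false) - z (x, true))) / 2 := by
  simp only [dotProduct_mulVec_eq_sum, ← Finset.sum_add_distrib, Finset.sum_div]
  rw [Fintype.sum_prod_type]
  refine Finset.sum_congr rfl fun x _ => ?_
  simp only [Fintype.sum_bool, Fintype.sum_prod_type, adj_lift_apply, ← Finset.sum_add_distrib]
  refine Finset.sum_congr rfl fun y _ => ?_
  simp only [if_true, reduceCtorEq, if_false]
  ring

/-- The fiber sums of a vector orthogonal to the constants are again orthogonal to the constants, so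
the first part of the form only sees λ(G), while the differences only see A_s. -/
theorem secondEigenvalue_lift_le (hG : IsRegular G d) (s : Signing G) {c : ℝ}
    (hs : ∀ x : V → ℝ, |x ⬝ᵥ signedAdj s *ᵥ x| ≤ c * (x ⬝ᵥ x)) (z : V × Bool → ℝ)
    (hz : z ⬝ᵥ (fun _ => 1) = 0) :
    |z ⬝ᵥ adj (lift s) *ᵥ z| ≤ max (secondEigenvalue G) c * (z ⬝ᵥ z) := by
  set a := fun x => z (x, false) + z (x, true) with ha
  set b := fun x => z (x, false) - z (x, true) with hb
  have ha0 : a ⬝ᵥ (fun _ => 1) = 0 := by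
    rw [← hz]
    simp only [dotProduct, Fintype.sum_prod_type, Fintype.sum_bool, ha]
    exact Finset.sum_congr rfl fun _ _ => by ring
  have hzz : z ⬝ᵥ z = (a ⬝ᵥ a + b ⬝ᵥ b) / 2 := by
    simp only [dotProduct, Fintype.sum_prod_type, Fintype.sum_bool, ha, hb,
      ← Finset.sum_add_distrib, Finset.sum_div]
    exact Finset.sum_congr rfl fun _ _ => by ring
  have hnn : ∀ x : V → ℝ, 0 ≤ x ⬝ᵥ x := fun x => Finset.sum_nonneg fun i _ => mul_self_nonneg _
  have h1 := (abs_quadratic_le_secondEigenvalue hG a ha0).trans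
    (mul_le_mul_of_nonneg_right (le_max_left _ c) (hnn a))
  have h2 := (hs b).trans (mul_le_mul_of_nonneg_right (le_max_right (secondEigenvalue G) c) (hnn b))
  rw [quadratic_lift, hzz, abs_div, abs_two, mul_div_assoc', mul_add]
  gcongr
  exact (abs_add_le _ _).trans (add_le_add h1 h2)

end

theorem secondEigenvalue_liftGraph_le {n d : ℕ} {G : SimpleGraph (Fin n)} (hG : IsRegular G d)
    (s : Signing G) {c : ℝ} (hs : ∀ x : Fin n → ℝ, |x ⬝ᵥ signedAdj s *ᵥ x| ≤ c * (x ⬝ᵥ x)) :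
    secondEigenvalue (liftGraph s) ≤ max (secondEigenvalue G) c := by
  classical
  refine secondEigenvalue_le (isRegular_liftGraph hG s)
    (secondEigenvalue_nonneg.trans (le_max_left _ _)) fun x hx => ?_
  set e := liftEquiv n
  have hsum : ∀ f g : Fin (2 * n) → ℝ, f ⬝ᵥ g = (f ∘ e.symm) ⬝ᵥ (g ∘ e.symm) := fun f g =>
    (e.symm.sum_comp fun i => f i * g i).symm
  have hA : x ⬝ᵥ adj (liftGraph s) *ᵥ x = (x ∘ e.symm) ⬝ᵥ adj (lift s) *ᵥ (x ∘ e.symm) := by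
    rw [dotProduct_mulVec_eq_sum, dotProduct_mulVec_eq_sum, ← e.symm.sum_comp]
    refine Finset.sum_congr rfl fun u _ => ?_
    rw [← e.symm.sum_comp]
    refine Finset.sum_congr rfl fun v _ => ?_
    congr 1
    rw [adj_apply, adj_apply]
    refine if_congr ?_ rfl rfl
    simp [liftGraph, e]
  rw [hA, hsum x x]
  refine secondEigenvalue_lift_le hG s hs _ ?_
  rw [hsum] at hx
  exact hx

theorem secondEigenvalue_top_le (d : ℕ) :
    secondEigenvalue (⊤ : SimpleGraph (Fin (d + 1))) ≤ 1 := by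
  classical
  refine secondEigenvalue_le (isRegular_top d) zero_le_one fun x hx => ?_
  have h : x ⬝ᵥ adj (⊤ : SimpleGraph (Fin (d + 1))) *ᵥ x =
      (x ⬝ᵥ fun _ => 1) * (x ⬝ᵥ fun _ => 1) - x ⬝ᵥ x := by
    have e : ∀ u v, adj (⊤ : SimpleGraph (Fin (d + 1))) u v * (x u * x v) =
        x u * x v - if u = v then x u * x u else 0 := fun u v => by
      rw [adj_apply]
      by_cases huv : u = v <;> simp [huv]
    rw [dotProduct_mulVec_eq_sum]
    simp only [e, Finset.sum_sub_distrib, Finset.sum_ite_eq, Finset.mem_univ, if_true, dotProduct,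
      mul_one, Finset.sum_mul_sum]
  rw [h, hx, zero_mul, zero_sub, abs_neg, one_mul]
  exact (abs_of_nonneg (Finset.sum_nonneg fun i _ => mul_self_nonneg _)).le

end TwoLift

namespace TwoLift

/-! ### Sparsity -/

open Matrix

theorem IsSparse.of_iso {V W : Type*} [Fintype V] [Fintype W] {G : SimpleGraph V}
    {H : SimpleGraph W} {β t : ℝ} (hG : IsSparse G β t) (e : H ≃g G) : IsSparse H β t := by
  classical
  intro u v hu hv huv
  have hd : ∀ f g : W → ℝ, f ⬝ᵥ g = (f ∘ e.symm) ⬝ᵥ (g ∘ e.symm) := fun f g =>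
    (e.symm.toEquiv.sum_comp fun i => f i * g i).symm
  have hn : ∀ f : W → ℝ, ‖WithLp.toLp 2 f‖ = ‖WithLp.toLp 2 (f ∘ e.symm)‖ := fun f => by
    rw [← abs_norm, ← abs_norm (WithLp.toLp 2 (f ∘ e.symm)), ← sq_eq_sq_iff_abs_eq_abs,
      ← dotProduct_self_eq_norm_sq, ← dotProduct_self_eq_norm_sq, hd]
  have hA : u ⬝ᵥ adj H *ᵥ v = (u ∘ e.symm) ⬝ᵥ adj G *ᵥ (v ∘ e.symm) := by
    rw [dotProduct_mulVec_eq_sum, dotProduct_mulVec_eq_sum, ← e.symm.toEquiv.sum_comp]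
    refine Finset.sum_congr rfl fun x _ => ?_
    rw [← e.symm.toEquiv.sum_comp]
    refine Finset.sum_congr rfl fun y _ => ?_
    congr 1
    rw [adj_apply, adj_apply]
    exact if_congr e.symm.map_adj_iff rfl rfl
  rw [hA, hn u, hn v]
  refine hG _ _ (fun x => hu _) (fun x => hv _) ?_
  have hs : Function.support (u ∘ e.symm) ∪ Function.support (v ∘ e.symm) =
      e.symm ⁻¹' (Function.support u ∪ Function.support v) := rfl
  rw [hs, Set.ncard_preimage_of_injective_subset_range e.symm.injective
    (fun x _ => e.symm.surjective x)]
  exact huv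

theorem isSparse_of_isEmpty {V : Type*} [Fintype V] [IsEmpty V] (G : SimpleGraph V) (β t : ℝ) :
    IsSparse G β t := by
  intro u v _ _ _
  simp [EuclideanSpace.norm_eq]

theorem sum_eq_norm_sq {V : Type*} [Fintype V] {u : V → ℝ} (hu : ∀ x, u x = 0 ∨ u x = 1) :
    ∑ x, u x = ‖WithLp.toLp 2 u‖ ^ 2 := by
  rw [← dotProduct_self_eq_norm_sq, dotProduct]
  exact Finset.sum_congr rfl fun x _ => by rcases hu x with h | h <;> simp [h]

theorem norm_sq_eq_ncard {V : Type*} [Fintype V] {u : V → ℝ} (hu : ∀ x, u x = 0 ∨ u x = 1) :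
    ‖WithLp.toLp 2 u‖ ^ 2 = (Function.support u).ncard := by
  classical
  rw [← sum_eq_norm_sq hu, Set.ncard_eq_toFinset_card', ← nsmul_one, ← Finset.sum_const]
  symm
  refine Finset.sum_subset_zero_on_sdiff (Finset.subset_univ _) (fun x hx => ?_) fun x hx => ?_
  · simpa using hx
  · exact ((hu x).resolve_left (by simpa using hx)).symm

theorem logb_nonneg {d : ℕ} (hd : 2 ≤ d) : 1 ≤ Real.logb 2 d := by
  rw [Real.le_logb_iff_rpow_le one_lt_two (by positivity), Real.rpow_one]
  exact_mod_cast hd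

theorem logb_le_self {d : ℕ} : Real.logb 2 d ≤ d := by
  rcases Nat.eq_zero_or_pos d with rfl | hd
  · simp
  rw [Real.logb_le_iff_le_rpow one_lt_two (by positivity), Real.rpow_natCast]
  exact_mod_cast Nat.lt_two_pow_self.le

theorem one_le_quasiBound {d : ℕ} (hd : 2 ≤ d) : 1 ≤ quasiBound d := by
  rw [quasiBound, Real.one_le_sqrt]
  have h1 := logb_nonneg hd
  have h2 : (2 : ℝ) ≤ d := by exact_mod_cast hd
  nlinarith [one_le_pow₀ h1 (n := 3)]

end TwoLift

namespace TwoLift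

open Matrix

/-! ### Codes of walks -/

theorem sum_range_mul {β : Type*} [AddCommMonoid β] (n N : ℕ) (f : ℕ → β) :
    ∑ c ∈ Finset.range (n * N), f c =
      ∑ t ∈ Finset.range N, ∑ x ∈ Finset.range n, f (n * t + x) := by
  induction N with
  | zero => simp
  | succ N ih => rw [Nat.mul_succ, Finset.sum_range_add, ih, Finset.sum_range_succ]

theorem dig_add_of_lt {b e t i k : ℕ} (hi : i < k) :
    dig b (b ^ k * t + e) i = dig b e i := by
  obtain ⟨j, rfl⟩ := Nat.exists_eq_add_of_lt hi
  rcases Nat.eq_zero_or_pos b with rfl | hb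
  · simp [dig]
  unfold dig
  have : b ^ (i + j + 1) * t + e = b ^ i * (b * (b ^ j * t)) + e := by ring
  rw [this, Nat.mul_add_div (by positivity), Nat.mul_add_mod]

theorem dig_add_self {b e t k : ℕ} (he : e < b ^ k) (ht : t < b) :
    dig b (b ^ k * t + e) k = t := by
  unfold dig
  rw [Nat.mul_add_div (by omega), Nat.div_eq_of_lt he, add_zero, Nat.mod_eq_of_lt ht]

theorem exists_digits {b : ℕ} {f : ℕ → ℕ} {k : ℕ} (hf : ∀ i < k, f i < b) :
    ∃ e < b ^ k, ∀ i < k, dig b e i = f i := by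
  induction k with
  | zero => exact ⟨0, by simp, by simp⟩
  | succ k ih =>
    obtain ⟨e, he, h⟩ := ih fun i hi => hf i (by omega)
    have hk := hf k (by omega)
    refine ⟨b ^ k * f k + e, ?_, fun i hi => ?_⟩
    · calc b ^ k * f k + e < b ^ k * (f k + 1) := by rw [Nat.mul_succ]; omega
        _ ≤ b ^ (k + 1) := Nat.mul_le_mul_left _ hk
    · rcases Nat.lt_succ_iff_lt_or_eq.mp hi with hi | rfl
      · rw [dig_add_of_lt hi, h i hi]
      · exact dig_add_self he hk

theorem walk_congr {a : ℕ → ℕ → ℕ} {n d b x e e' i : ℕ} (hx : x < n)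
    (h : ∀ j < i, dig b e j = dig b e' j) :
    walk a n d b (n * e + x) i = walk a n d b (n * e' + x) i := by
  have hdiv : ∀ e, (n * e + x) / n = e := fun e => pos_div hx
  induction i with
  | zero =>
    change (n * e + x) % n = (n * e' + x) % n
    rw [pos_mod hx, pos_mod hx]
  | succ i ih =>
    rw [walk_succ, walk_succ, ih fun j hj => h j (by omega), hdiv, hdiv, h i (by omega)]

section

variable {n d : ℕ} {G : SimpleGraph (Fin n)} {a : ℕ → ℕ → ℕ}

/-- The number of earlier neighbors ranks the neighbors of `x`. The rank is injective with values
below `d`, and there are `d` neighbors, so every rank occurs. -/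
theorem exists_nbr_eq (ha : ∀ x y : Fin n, a x y ≠ 0 ↔ G.Adj x y) (hG : IsRegular G d)
    (x : Fin n) : ∃ r : Fin n → ℕ, (∀ y, G.Adj x y → r y < d ∧ nbr a n x (r y) = y) ∧
      ∀ j < d, ∃ y, G.Adj x y ∧ r y = j := by
  classical
  set r : Fin n → ℕ := fun y => ∑ z ∈ Finset.range y, if a x z ≠ 0 then 1 else 0 with hr
  have h1 : ∀ y, G.Adj x y → nbr a n x (r y) = y := fun y hy => nbr_eq y.2 ((ha x y).mpr hy) rfl
  have hcard : ∑ z ∈ Finset.range n, (if a x z ≠ 0 then 1 else 0) = d := by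
    rw [← hG x, ← SimpleGraph.card_neighborFinset_eq_degree,
      SimpleGraph.neighborFinset_eq_filter, Finset.card_filter, Finset.sum_range]
    exact Finset.sum_congr rfl fun y _ => by simp only [ha]
  have h2 : ∀ y, G.Adj x y → r y < d := by
    intro y hy
    rw [← hcard]
    refine (Nat.lt_succ_self _).trans_le ?_
    calc r y + 1 = ∑ z ∈ Finset.range (y + 1), if a x z ≠ 0 then 1 else 0 := by
          rw [Finset.sum_range_succ, if_pos ((ha x y).mpr hy)]
      _ ≤ _ := Finset.sum_le_sum_of_subset (Finset.range_mono y.2)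
  refine ⟨r, fun y hy => ⟨h2 y hy, h1 y hy⟩, fun j hj => ?_⟩
  have := Finset.surjOn_of_injOn_of_card_le r (s := G.neighborFinset x) (t := Finset.range d)
    (fun y hy => by simpa using h2 y (by simpa using hy))
    (fun y hy y' hy' he => by
      have e1 := h1 y (by simpa using hy)
      have e2 := h1 y' (by simpa using hy')
      exact Fin.ext (e1.symm.trans (he ▸ e2)))
    (by rw [Finset.card_range, SimpleGraph.card_neighborFinset_eq_degree, ← hG x])
  obtain ⟨y, hy, hyj⟩ := this (Finset.mem_coe.mpr (Finset.mem_range.mpr hj))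
  exact ⟨y, by simpa using hy, hyj⟩

theorem adj_nbr (ha : ∀ x y : Fin n, a x y ≠ 0 ↔ G.Adj x y) (hG : IsRegular G d)
    (x : Fin n) {j : ℕ} (hj : j < d) : G.Adj x ⟨nbr a n x j, nbr_lt x.pos⟩ := by
  obtain ⟨r, h1, h2⟩ := exists_nbr_eq ha hG x
  obtain ⟨y, hy, rfl⟩ := h2 j hj
  convert hy using 1
  exact Fin.ext (h1 y hy).2

theorem sum_nbr (ha : ∀ x y : Fin n, a x y ≠ 0 ↔ G.Adj x y) (hG : IsRegular G d)
    (x : Fin n) (F : Fin n → ℝ) :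
    ∑ j ∈ Finset.range d, F ⟨nbr a n x j, nbr_lt x.pos⟩ = ∑ y, adj G x y * F y := by
  classical
  obtain ⟨r, h1, h2⟩ := exists_nbr_eq ha hG x
  simp only [adj_apply, ite_mul, one_mul, zero_mul]
  rw [← Finset.sum_filter]
  symm
  refine Finset.sum_bij (fun y _ => r y) (fun y hy => ?_) (fun y hy y' hy' he => ?_)
    (fun j hj => ?_) (fun y hy => ?_)
  · exact Finset.mem_range.mpr (h1 y (by simpa using hy)).1
  · exact Fin.ext ((h1 y (by simpa using hy)).2.symm.trans
      (he ▸ (h1 y' (by simpa using hy')).2))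
  · obtain ⟨y, hy, e⟩ := h2 j (Finset.mem_range.mp hj)
    exact ⟨y, by simpa using hy, e⟩
  · congr 1
    exact Fin.ext (h1 y (by simpa using hy)).2.symm

/-- The `i`-th vertex of a walk, as a vertex of the graph. -/
def walkVertex (a : ℕ → ℕ → ℕ) {n : ℕ} (hn : 0 < n) (d b c i : ℕ) : Fin n :=
  ⟨walk a n d b c i, walk_lt hn⟩

theorem walkVertex_zero (hn : 0 < n) {b : ℕ} (e : ℕ) (x : Fin n) :
    walkVertex a hn d b (n * e + x) 0 = x := Fin.ext (pos_mod x.2)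

theorem adj_walkVertex (ha : ∀ x y : Fin n, a x y ≠ 0 ↔ G.Adj x y) (hG : IsRegular G d)
    (hn : 0 < n) (hd : 0 < d) (b c i : ℕ) :
    G.Adj (walkVertex a hn d b c i) (walkVertex a hn d b c (i + 1)) :=
  adj_nbr ha hG (walkVertex a hn d b c i) (Nat.mod_lt _ hd)

/-- The last step of a walk is the leading digit of its code. Splitting off that digit removes the
step, and summing over it is one multiplication by `B`, which is supported on edges, so that the `d`
neighbors account for a whole row. -/
theorem sum_walks (ha : ∀ x y : Fin n, a x y ≠ 0 ↔ G.Adj x y) (hG : IsRegular G d) (hn : 0 < n)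
    {B : Matrix (Fin n) (Fin n) ℝ} (hB : ∀ x y, adj G x y * B x y = B x y)
    (x : Fin n) (Q : ℕ) (F : Fin n → ℝ) :
    ∑ e ∈ Finset.range (d ^ Q), (∏ i ∈ Finset.range Q, B (walkVertex a hn d d (n * e + x) i)
      (walkVertex a hn d d (n * e + x) (i + 1))) * F (walkVertex a hn d d (n * e + x) Q) =
    ∑ y, (B ^ Q) x y * F y := by
  induction Q generalizing F with
  | zero => simp [walkVertex_zero, Matrix.one_apply]
  | succ Q ih =>
    have key : ∀ t < d, ∀ e < d ^ Q,
        (∏ i ∈ Finset.range (Q + 1), B (walkVertex a hn d d (n * (d ^ Q * t + e) + x) i)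
          (walkVertex a hn d d (n * (d ^ Q * t + e) + x) (i + 1))) *
            F (walkVertex a hn d d (n * (d ^ Q * t + e) + x) (Q + 1)) =
        (∏ i ∈ Finset.range Q, B (walkVertex a hn d d (n * e + x) i)
          (walkVertex a hn d d (n * e + x) (i + 1))) *
          (B (walkVertex a hn d d (n * e + x) Q)
            ⟨nbr a n (walkVertex a hn d d (n * e + x) Q) t, nbr_lt hn⟩ *
          F ⟨nbr a n (walkVertex a hn d d (n * e + x) Q) t, nbr_lt hn⟩) := by
      intro t ht e he
      have h1 : ∀ i ≤ Q, walkVertex a hn d d (n * (d ^ Q * t + e) + x) i =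
          walkVertex a hn d d (n * e + x) i := fun i hi =>
        Fin.ext (walk_congr x.2 fun j hj => dig_add_of_lt (by omega))
      have h2 : walkVertex a hn d d (n * (d ^ Q * t + e) + x) (Q + 1) =
          ⟨nbr a n (walkVertex a hn d d (n * e + x) Q) t, nbr_lt hn⟩ := by
        refine Fin.ext ?_
        change nbr a n (walkVertex a hn d d (n * (d ^ Q * t + e) + x) Q)
          (dig d ((n * (d ^ Q * t + e) + x) / n) Q % d) = _
        rw [h1 Q le_rfl, pos_div x.2, dig_add_self he ht, Nat.mod_eq_of_lt ht]
      rw [Finset.prod_range_succ, h2, h1 Q le_rfl, mul_assoc]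
      congr 1
      refine Finset.prod_congr rfl fun i hi => ?_
      have hi := Finset.mem_range.mp hi
      rw [h1 i (by omega), h1 (i + 1) (by omega)]
    rw [pow_succ, sum_range_mul]
    rw [Finset.sum_congr rfl fun t ht => Finset.sum_congr rfl fun e he =>
      key t (Finset.mem_range.mp ht) e (Finset.mem_range.mp he), Finset.sum_comm]
    simp only [← Finset.mul_sum]
    have h3 : ∀ z : Fin n, ∑ t ∈ Finset.range d, B z ⟨nbr a n z t, nbr_lt hn⟩ *
        F ⟨nbr a n z t, nbr_lt hn⟩ = ∑ y, B z y * F y := fun z => by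
      rw [sum_nbr ha hG z fun y => B z y * F y]
      exact Finset.sum_congr rfl fun y _ => by rw [← mul_assoc, hB]
    simp only [h3]
    rw [ih fun z => ∑ y, B z y * F y]
    simp only [pow_succ, Matrix.mul_apply, Finset.mul_sum, Finset.sum_mul]
    rw [Finset.sum_comm]
    exact Finset.sum_congr rfl fun _ _ => Finset.sum_congr rfl fun _ _ => by ring

theorem sum_closed_walks (ha : ∀ x y : Fin n, a x y ≠ 0 ↔ G.Adj x y) (hG : IsRegular G d)
    (hn : 0 < n) {B : Matrix (Fin n) (Fin n) ℝ}
    (hB : ∀ x y, adj G x y * B x y = B x y) (Q : ℕ) :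
    (∑ c ∈ Finset.range (n * d ^ Q), if walk a n d d c Q = walk a n d d c 0 then
      ∏ i ∈ Finset.range Q, B (walkVertex a hn d d c i) (walkVertex a hn d d c (i + 1)) else 0) =
    (B ^ Q).trace := by
  rw [sum_range_mul, Finset.sum_comm, Finset.sum_range, Matrix.trace]
  refine Finset.sum_congr rfl fun x _ => ?_
  have := sum_walks ha hG hn hB x Q fun y => if y = x then 1 else 0
  simp only [mul_ite, mul_one, mul_zero, Finset.sum_ite_eq', Finset.mem_univ, if_true] at this
  rw [Matrix.diag_apply, ← this]
  refine Finset.sum_congr rfl fun e _ => ?_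
  refine if_congr ?_ rfl rfl
  rw [Fin.ext_iff]
  change _ = (n * e + x) % n ↔ walk a n d d (n * e + x) Q = _
  rw [pos_mod x.2]

/-! ### The random signed matrix -/

/-- The symmetric matrix supported on the edges with the entries of `p` above the diagonal. -/
noncomputable def edgeMatrix (G : SimpleGraph (Fin n)) (p : Fin n → Fin n → ℝ) :
    Matrix (Fin n) (Fin n) ℝ :=
  Matrix.of fun x y => adj G x y * if x < y then p x y else p y x

theorem edgeMatrix_symm (p : Fin n → Fin n → ℝ) (x y : Fin n) :
    edgeMatrix G p x y = edgeMatrix G p y x := by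
  simp only [edgeMatrix, Matrix.of_apply]
  rcases lt_trichotomy x y with h | rfl | h
  · rw [if_pos h, if_neg h.not_gt, adj_symm]
  · rfl
  · rw [if_pos h, if_neg h.not_gt, adj_symm]

theorem adj_mul_edgeMatrix (p : Fin n → Fin n → ℝ) (x y : Fin n) :
    adj G x y * edgeMatrix G p x y = edgeMatrix G p x y := by
  classical
  simp only [edgeMatrix, Matrix.of_apply, adj_apply]
  split_ifs <;> simp

/-- Each step contributes the entry of its edge at the ordered pair with the smaller vertex first;
exchanging the products over steps and over pairs collects these entries as powers. -/
theorem prod_walk_edgeMatrix (ha : ∀ x y : Fin n, a x y ≠ 0 ↔ G.Adj x y) (hG : IsRegular G d)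
    (hn : 0 < n) (hd : 0 < d) (p : Fin n → Fin n → ℝ) (c Q : ℕ) :
    ∏ i ∈ Finset.range Q, edgeMatrix G p (walkVertex a hn d d c i) (walkVertex a hn d d c (i + 1)) =
      ∏ e : Fin n × Fin n, if e.1 < e.2 then p e.1 e.2 ^ visits a n d Q c e.1 e.2 else 1 := by
  classical
  have h1 : ∀ e : Fin n × Fin n,
      (if e.1 < e.2 then p e.1 e.2 ^ visits a n d Q c e.1 e.2 else 1) =
      ∏ i ∈ Finset.range Q, if e.1 < e.2 ∧
        ((walkVertex a hn d d c i = e.1 ∧ walkVertex a hn d d c (i + 1) = e.2) ∨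
          (walkVertex a hn d d c i = e.2 ∧ walkVertex a hn d d c (i + 1) = e.1))
        then p e.1 e.2 else 1 := by
    intro e
    by_cases he : e.1 < e.2
    · rw [if_pos he, visits, ← Finset.prod_pow_eq_pow_sum]
      refine Finset.prod_congr rfl fun i _ => ?_
      simp only [Fin.ext_iff, walkVertex]
      split_ifs <;> simp_all
    · simp [he]
  simp only [h1]
  rw [Finset.prod_comm]
  refine Finset.prod_congr rfl fun i _ => ?_
  have hadj := adj_walkVertex ha hG hn hd d c i
  simp only [edgeMatrix, Matrix.of_apply, adj_apply, if_pos hadj, one_mul]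
  generalize walkVertex a hn d d c i = w at *
  generalize walkVertex a hn d d c (i + 1) = w' at *
  rcases lt_or_gt_of_ne hadj.ne with h | h
  · rw [if_pos h, Finset.prod_eq_single (w, w')]
    · simp [h]
    · rintro ⟨x, y⟩ _ hxy
      rw [if_neg]
      rintro ⟨h2, ⟨rfl, rfl⟩ | ⟨rfl, rfl⟩⟩
      · exact hxy rfl
      · exact absurd h h2.not_gt
    · simp
  · rw [if_neg h.not_gt, Finset.prod_eq_single (w', w)]
    · simp [h]
    · rintro ⟨x, y⟩ _ hxy
      rw [if_neg]
      rintro ⟨h2, ⟨rfl, rfl⟩ | ⟨rfl, rfl⟩⟩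
      · exact absurd h h2.not_gt
      · exact hxy rfl
    · simp

theorem adj_of_visits_ne_zero (ha : ∀ x y : Fin n, a x y ≠ 0 ↔ G.Adj x y) (hG : IsRegular G d)
    (hn : 0 < n) (hd : 0 < d) {c Q : ℕ} {x y : Fin n} (h : visits a n d Q c x y ≠ 0) :
    G.Adj x y := by
  obtain ⟨i, _, hi⟩ := Finset.exists_ne_zero_of_sum_ne_zero h
  have hadj := adj_walkVertex ha hG hn hd d c i
  rcases of_not_not fun h => hi (if_neg h) with ⟨h1, h2⟩ | ⟨h1, h2⟩
  · rwa [show walkVertex a hn d d c i = x from Fin.ext h1,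
      show walkVertex a hn d d c (i + 1) = y from Fin.ext h2] at hadj
  · rw [show walkVertex a hn d d c i = y from Fin.ext h1,
      show walkVertex a hn d d c (i + 1) = x from Fin.ext h2] at hadj
    exact hadj.symm

end

end TwoLift

namespace TwoLift

open Matrix

/-! ### The potential as a real number -/

/-- The sign coded by a number modulo 3: `0`, `1`, `2` code `0`, `1`, `-1`. -/
noncomputable def sgn (z : ℕ) : ℝ := md z - 1

theorem md_eq_sgn (z : ℕ) : (md z : ℝ) = 1 + sgn z := by simp [sgn]

theorem sgn_mod (z : ℕ) : sgn (z % 3) = sgn z := by simp [sgn, md]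

theorem sgn_zero : sgn 0 = 0 := by simp [sgn, md]

theorem sgn_one : sgn 1 = 1 := by norm_num [sgn, md]

theorem sgn_two : sgn 2 = -1 := by norm_num [sgn, md]

/-- `sgn` is the quadratic character modulo 3. It lets the machine multiply signs as natural
numbers, with 0 standing for an undecided sign. -/
theorem sgn_mul (z w : ℕ) : sgn (z * w) = sgn z * sgn w := by
  rw [← sgn_mod (z * w), ← sgn_mod z, ← sgn_mod w, Nat.mul_mod]
  have h1 := Nat.mod_lt z three_pos
  have h2 := Nat.mod_lt w three_pos
  interval_cases z % 3 <;> interval_cases w % 3 <;> norm_num [sgn, md]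

theorem sgn_eq (z : ℕ) : sgn z = 0 ∨ sgn z = 1 ∨ sgn z = -1 := by
  rw [← sgn_mod z]
  have h1 := Nat.mod_lt z three_pos
  interval_cases z % 3 <;> simp [sgn_zero, sgn_one, sgn_two]

theorem sgn_prod {ι : Type*} (S : Finset ι) (f : ι → ℕ) :
    sgn (∏ i ∈ S, f i) = ∏ i ∈ S, sgn (f i) := by
  classical
  induction S using Finset.induction_on with
  | empty => simp [sgn_one]
  | insert i S hi ih => rw [Finset.prod_insert hi, Finset.prod_insert hi, sgn_mul, ih]

theorem prod_range_product {β : Type*} [CommMonoid β] (n : ℕ) (f : ℕ → ℕ → β) :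
    ∏ e ∈ Finset.range n ×ˢ Finset.range n, f e.1 e.2 = ∏ e : Fin n × Fin n, f e.1 e.2 := by
  rw [Finset.prod_product, Fintype.prod_prod_type, Finset.prod_range]
  exact Finset.prod_congr rfl fun x _ => Finset.prod_range _

/-- The first vector given by the labels of the walk `c`. -/
noncomputable def fstLab (a : ℕ → ℕ → ℕ) {n : ℕ} (d Q c : ℕ) (x : Fin n) : ℝ :=
  sgn (lab a n d (9 * d) c Q x)

/-- The second vector given by the labels of the walk `c`. -/
noncomputable def sndLab (a : ℕ → ℕ → ℕ) {n : ℕ} (d Q c : ℕ) (x : Fin n) : ℝ :=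
  sgn (lab a n d (9 * d) c Q x / 3)

/-- The normalized product for two vectors and a sign matrix. -/
noncomputable def pairWeight {n : ℕ} (u v : Fin n → ℝ) (p : Fin n → Fin n → ℝ) : ℝ :=
  ∏ e : Fin n × Fin n, (1 + (u e.1 * v e.2 + u e.2 * v e.1) * p e.1 e.2 / 4)

/-- A factor is 2 + (1 + p) + (1 + q) = 4 (1 + (p + q)/4) with signs p and q, which explains the
summand 2 and the normalization by 4. All factors are at least 2 as natural numbers. -/
theorem cast_labWeight (a s : ℕ → ℕ → ℕ) (n d Q c : ℕ) :
    (labWeight a s n d Q c : ℝ) = 4 ^ (n * n) *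
      pairWeight (fstLab a d Q c) (sndLab a d Q c) fun x y : Fin n => sgn (s x y) := by
  rw [labWeight_eq, prod_range_product n fun x y =>
    (2 + md (lab a n d (9 * d) c Q x % 3 * (lab a n d (9 * d) c Q y / 3) * s x y) +
      md (lab a n d (9 * d) c Q y % 3 * (lab a n d (9 * d) c Q x / 3) * s x y)), Nat.cast_prod]
  have : (4 : ℝ) ^ (n * n) = ∏ e : Fin n × Fin n, (4 : ℝ) := by simp
  rw [this, pairWeight, ← Finset.prod_mul_distrib]
  refine Finset.prod_congr rfl fun e _ => ?_
  push_cast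
  simp only [md_eq_sgn, sgn_mul, sgn_mod, fstLab, sndLab]
  ring

theorem sgn_walkCode (a s : ℕ → ℕ → ℕ) (n d Q c : ℕ) :
    sgn (walkCode a s n d Q c) = ∏ e : Fin n × Fin n,
      if visits a n d Q c e.1 e.2 % 2 = 1 ∧ e.1 < e.2 then sgn (s e.1 e.2) else 1 := by
  rw [walkCode_eq, sgn_mod, prod_range_product n fun x y =>
    if visits a n d Q c x y % 2 = 1 ∧ x < y then s x y else 1, sgn_prod]
  refine Finset.prod_congr rfl fun e _ => ?_
  simp only [Fin.lt_def]
  split_ifs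
  · rfl
  · exact sgn_one

/-- The number of closed walks. -/
noncomputable def closedCount (a : ℕ → ℕ → ℕ) (n d Q : ℕ) : ℝ :=
  ∑ c ∈ Finset.range (n * d ^ Q), if walk a n d d c Q = walk a n d d c 0 then 1 else 0

/-- The weights `4 ^ (n * n)` and `n * (9 * d) ^ Q` bring both parts to a common scale.
`closedCount` is only the offset that keeps the trace part nonnegative; it is the same for all
signings. -/
theorem cast_pot (a s : ℕ → ℕ → ℕ) (n d Q : ℕ) : (pot a s n d Q : ℝ) = 4 ^ (n * n) *
    ((∑ c ∈ Finset.range (n * (9 * d) ^ Q), pairWeight (fstLab a d Q c) (sndLab a d Q c)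
        fun x y : Fin n => sgn (s x y)) +
      n * (9 * d) ^ Q * (closedCount a n d Q + ∑ c ∈ Finset.range (n * d ^ Q),
        if walk a n d d c Q = walk a n d d c 0 then sgn (walkCode a s n d Q c) else 0)) := by
  unfold pot closedCount
  push_cast
  simp only [cast_labWeight, ← Finset.mul_sum, ← Finset.sum_add_distrib]
  have : ∀ c, (if walk a n d d c Q = walk a n d d c 0 then (md (walkCode a s n d Q c) : ℝ) else 0) =
      (if walk a n d d c Q = walk a n d d c 0 then 1 else 0) +
        if walk a n d d c Q = walk a n d d c 0 then sgn (walkCode a s n d Q c) else 0 := by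
    intro c
    split_ifs
    · exact md_eq_sgn _
    · simp
  simp only [this]
  ring

/-- The sign of a boolean. -/
noncomputable def bsgn (b : Bool) : ℝ := if b then 1 else -1

theorem sum_prod_bool {ι : Type*} [Fintype ι] [DecidableEq ι] (f : ι → Bool → ℝ) :
    ∑ ε : ι → Bool, ∏ i, f i (ε i) = ∏ i, (f i true + f i false) := by
  have := Finset.prod_univ_sum (fun _ : ι => (Finset.univ : Finset Bool)) f
  rw [Fintype.piFinset_univ] at this
  rw [← this]
  exact Finset.prod_congr rfl fun i _ => Fintype.sum_bool _

section

variable {n d : ℕ} {G : SimpleGraph (Fin n)}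

/-- The trace of the `Q`-th power of the randomly signed adjacency matrix, on average. -/
noncomputable def meanTrace (G : SimpleGraph (Fin n)) (Q : ℕ) : ℝ :=
  (∑ ε : Fin n × Fin n → Bool, (edgeMatrix G (fun x y => bsgn (ε (x, y))) ^ Q).trace) / 2 ^ (n * n)

/-- The average of a product of independent signs vanishes as soon as one edge is traversed an odd
number of times, and is 1 otherwise. The code of a walk with all signs undecided has exactly these
values. -/
theorem sum_walkCode_zero {a : ℕ → ℕ → ℕ} (ha : ∀ x y : Fin n, a x y ≠ 0 ↔ G.Adj x y)
    (hG : IsRegular G d) (hn : 0 < n) (hd : 0 < d) (Q : ℕ) :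
    (∑ c ∈ Finset.range (n * d ^ Q), if walk a n d d c Q = walk a n d d c 0 then
      sgn (walkCode a (fun _ _ => 0) n d Q c) else 0) = meanTrace G Q := by
  rw [meanTrace, eq_div_iff (by positivity)]
  simp only [← sum_closed_walks ha hG hn fun x y => adj_mul_edgeMatrix _ x y]
  rw [Finset.sum_comm, Finset.sum_mul]
  refine Finset.sum_congr rfl fun c _ => ?_
  split_ifs with hc
  · simp only [prod_walk_edgeMatrix ha hG hn hd]
    rw [sum_prod_bool fun (e : Fin n × Fin n) b => if e.1 < e.2 then bsgn b ^ visits a n d Q c e.1 e.2 else 1,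
      sgn_walkCode]
    have : (2 : ℝ) ^ (n * n) = ∏ e : Fin n × Fin n, (2 : ℝ) := by simp
    rw [this, ← Finset.prod_mul_distrib]
    refine Finset.prod_congr rfl fun e _ => ?_
    by_cases he : e.1 < e.2
    · simp only [he, and_true, bsgn, sgn_zero, one_pow, if_true, Bool.false_eq_true,
        if_false]
      rcases Nat.even_or_odd (visits a n d Q c e.1 e.2) with h | h
      · rw [h.neg_one_pow, if_neg (by rw [Nat.even_iff.mp h]; omega)]
        norm_num
      · rw [h.neg_one_pow, if_pos (Nat.odd_iff.mp h)]
        norm_num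
    · simp only [he, and_false, if_false]
      norm_num
  · simp

/-- The signs above the diagonal. -/
noncomputable def upperSign (s : Signing G) (x y : Fin n) : ℝ := if x < y then signedAdj s x y else 0

theorem sgn_signMat (x y : Fin n) :
    sgn (signMat (graphMem G) x y) = signedAdj (greedySigning G) x y := by
  classical
  rw [signMat_eq_code]
  by_cases h : G.Adj x y
  · rw [dif_pos h, signedAdj_apply _ h]
    rcases Int.units_eq_one_or ((greedySigning G).sign h) with hs | hs
    · rw [hs, if_pos rfl, sgn_one]; simp
    · rw [hs, if_neg (by decide), sgn_two]; simp
  · rw [dif_neg h, signedAdj_apply_of_not_adj _ h, sgn_zero]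

theorem edgeMatrix_signedAdj (s : Signing G) :
    edgeMatrix G (fun x y => signedAdj s x y) = signedAdj s := by
  classical
  ext x y
  simp only [edgeMatrix, Matrix.of_apply, signedAdj_symm s y x, ite_self, adj_apply]
  by_cases h : G.Adj x y
  · simp [h]
  · simp [h, signedAdj_apply_of_not_adj s h]

theorem signedAdj_sq (s : Signing G) {x y : Fin n} (h : G.Adj x y) : signedAdj s x y ^ 2 = 1 := by
  rw [signedAdj_apply s h]
  rcases Int.units_eq_one_or (s.sign h) with h | h <;> simp [h]

/-- Once the signs are decided, even powers of them are 1, so the parity in `walkCode` loses nothing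
and the sum is a true trace. -/
theorem sum_walkCode_signMat {a : ℕ → ℕ → ℕ} (ha : ∀ x y : Fin n, a x y ≠ 0 ↔ G.Adj x y)
    (hG : IsRegular G d) (hn : 0 < n) (hd : 0 < d) (Q : ℕ) :
    (∑ c ∈ Finset.range (n * d ^ Q), if walk a n d d c Q = walk a n d d c 0 then
      sgn (walkCode a (upper (signMat (graphMem G))) n d Q c) else 0) =
    (signedAdj (greedySigning G) ^ Q).trace := by
  rw [← edgeMatrix_signedAdj, ← sum_closed_walks ha hG hn fun x y => adj_mul_edgeMatrix _ x y]
  refine Finset.sum_congr rfl fun c _ => ?_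
  rw [prod_walk_edgeMatrix ha hG hn hd, sgn_walkCode]
  refine if_congr Iff.rfl (Finset.prod_congr rfl fun e _ => ?_) rfl
  by_cases he : e.1 < e.2
  · have he' : (e.1 : ℕ) < e.2 := he
    simp only [he, and_true, if_true, upper, if_pos he', sgn_signMat]
    by_cases hv : visits a n d Q c e.1 e.2 = 0
    · simp [hv]
    have h2 := signedAdj_sq (greedySigning G) (adj_of_visits_ne_zero ha hG hn hd hv)
    rcases Nat.even_or_odd (visits a n d Q c e.1 e.2) with h | h
    · rw [if_neg (by rw [Nat.even_iff.mp h]; omega)]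
      obtain ⟨k, hk⟩ := h
      rw [hk, ← two_mul, pow_mul, h2, one_pow]
    · rw [if_pos (Nat.odd_iff.mp h)]
      obtain ⟨k, hk⟩ := h
      rw [hk, pow_succ, pow_mul, h2, one_pow, one_mul]
  · simp only [he, and_false, if_false]

theorem pairWeight_zero (u v : Fin n → ℝ) : pairWeight u v (fun _ _ => 0) = 1 := by
  simp [pairWeight]

theorem graphMem_ne_zero (x y : Fin n) : mat (graphMem G) x y ≠ 0 ↔ G.Adj x y := by
  classical
  rw [(encodes_graphMem G).adj]
  split_ifs with h <;> simp [h]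

/-- Initially every product is 1 and the trace part is the mean trace. The common factor and the
offset cancel from the comparison of the initial and the final potential. -/
theorem greedySigning_inequality (hG : IsRegular G d) (hn : 0 < n) (hd : 0 < d) :
    (∑ c ∈ Finset.range (n * (9 * d) ^ (2 * lg n)),
      pairWeight (fstLab (mat (graphMem G)) d (2 * lg n) c)
        (sndLab (mat (graphMem G)) d (2 * lg n) c) (upperSign (greedySigning G))) +
      n * (9 * d) ^ (2 * lg n) * (signedAdj (greedySigning G) ^ (2 * lg n)).trace ≤
    n * (9 * d) ^ (2 * lg n) * (1 + meanTrace G (2 * lg n)) := by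
  have hE := encodes_graphMem G
  have h := pot_signMat_le hE.holdsAdj
  rw [deg0_eq hE hG hn, hE.size, ← Nat.cast_le (α := ℝ), cast_pot, cast_pot,
    sum_walkCode_signMat graphMem_ne_zero hG hn hd, sum_walkCode_zero graphMem_ne_zero hG hn hd] at h
  have h := le_of_mul_le_mul_left h (by positivity)
  have e : (fun x y : Fin n => sgn (upper (signMat (graphMem G)) x y)) =
      upperSign (greedySigning G) := by
    funext x y
    unfold upper upperSign
    by_cases hxy : x < y
    · rw [if_pos hxy, if_pos (Fin.lt_def.mp hxy), sgn_signMat]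
    · rw [if_neg hxy, if_neg (fun h => hxy (Fin.lt_def.mpr h)), sgn_zero]
  simp only [e, sgn_zero, pairWeight_zero, Finset.sum_const, Finset.card_range, nsmul_eq_mul,
    mul_one] at h
  push_cast at h
  linarith

end

end TwoLift

namespace TwoLift

/-! ### Labelled walks that cover a connected set -/

section

variable {V : Type*} [DecidableEq V] {G : SimpleGraph V}

/-- The set `S` spans a connected subgraph, or is empty. -/
def Linked (G : SimpleGraph V) (S : Finset V) : Prop :=
  ∀ T ⊆ S, T.Nonempty → T ≠ S → ∃ x ∈ T, ∃ y ∈ S \ T, G.Adj x y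

/-- The set is explored one vertex at a time: a new neighbor `y` of a visited `x` is reached by
inserting the detour `y, x` after an occurrence of `x`. Each new vertex lengthens the walk by two,
so k vertices need a walk with 2k - 1 entries. -/
theorem Linked.exists_list {S : Finset V} (hS : Linked G S) (hne : S.Nonempty) :
    ∃ l : List V, l.IsChain G.Adj ∧ l.length + 1 = 2 * S.card ∧ ∀ x ∈ S, x ∈ l := by
  have key : ∀ k < S.card, ∃ T ⊆ S, T.card = k + 1 ∧ ∃ l : List V, l.IsChain G.Adj ∧
      l.length + 1 = 2 * T.card ∧ ∀ x ∈ T, x ∈ l := by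
    intro k
    induction k with
    | zero =>
      intro _
      obtain ⟨x, hx⟩ := hne
      exact ⟨{x}, by simpa using hx, by simp, [x], by simp, by simp, by simp⟩
    | succ k ih =>
      intro hk
      obtain ⟨T, hT, hTk, l, h1, h2, h3⟩ := ih (by omega)
      obtain ⟨x, hx, y, hy, hxy⟩ := hS T hT (Finset.card_pos.mp (by omega))
        fun h => by rw [h] at hTk; omega
      rw [Finset.mem_sdiff] at hy
      obtain ⟨l₁, l₂, rfl⟩ := List.append_of_mem (h3 x hx)
      rw [List.isChain_split] at h1
      refine ⟨insert y T, Finset.insert_subset hy.1 hT, by rw [Finset.card_insert_of_notMem hy.2, hTk],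
        l₁ ++ x :: y :: x :: l₂, ?_, ?_, ?_⟩
      · rw [List.isChain_split]
        exact ⟨h1.1, by simp [hxy, hxy.symm, h1.2]⟩
      · rw [Finset.card_insert_of_notMem hy.2]
        simp only [List.length_append, List.length_cons] at h2 ⊢
        omega
      · intro z hz
        rcases Finset.mem_insert.mp hz with rfl | hz
        · simp
        · have := h3 z hz
          simp only [List.mem_append, List.mem_cons] at this ⊢
          tauto
  obtain ⟨T, hT, hTk, l, h⟩ := key (S.card - 1) (by have := hne.card_pos; omega)
  obtain rfl := Finset.eq_of_subset_of_card_le hT (by have := hne.card_pos; omega)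
  exact ⟨l, h⟩

omit [DecidableEq V] in
-- Codes have a fixed length, so a short walk is padded by extra steps at its beginning.
theorem exists_longer_list (hG : ∀ x, ∃ y, G.Adj x y) {l : List V} (hl : l.IsChain G.Adj)
    (hne : l ≠ []) {Q : ℕ} (hQ : l.length ≤ Q) :
    ∃ l' : List V, l'.IsChain G.Adj ∧ l'.length = Q ∧ ∀ x ∈ l, x ∈ l' := by
  induction Q, hQ using Nat.le_induction with
  | base => exact ⟨l, hl, rfl, fun _ h => h⟩
  | succ Q hQ ih =>
    obtain ⟨l', h1, h2, h3⟩ := ih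
    rcases l' with _ | ⟨x, l'⟩
    · obtain ⟨x, hx⟩ := List.exists_mem_of_ne_nil l hne
      exact absurd (h3 x hx) (by simp)
    · obtain ⟨y, hy⟩ := hG x
      exact ⟨y :: x :: l', by simp [hy.symm, h1], by simp [← h2],
        fun z hz => List.mem_cons_of_mem _ (h3 z hz)⟩

end

variable {n d : ℕ} {G : SimpleGraph (Fin n)} {a : ℕ → ℕ → ℕ}

/-- The digit at a vertex is `d` times its label plus the number of the next step. Repeated visits
carry the same label, so it does no harm that the last visit overrides the earlier ones; unvisited
vertices keep the default label 0. -/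
theorem exists_code_of_list (ha : ∀ x y : Fin n, a x y ≠ 0 ↔ G.Adj x y) (hG : IsRegular G d)
    (hd : 0 < d) {l : List (Fin n)} (hl : l.IsChain G.Adj) (hne : l ≠ [])
    {f : Fin n → ℕ} (hf : ∀ x, f x < 9) (hfl : ∀ x, x ∉ l → f x = 0) :
    ∃ c < n * (9 * d) ^ l.length, ∀ x : Fin n, lab a n d (9 * d) c l.length x = f x := by
  classical
  have hlen : 0 < l.length := List.length_pos_iff.mpr hne
  have hn : 0 < n := (l[0]).pos
  set w : ℕ → Fin n := fun i => l.getD i (l[0]) with hw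
  have hwi : ∀ i (h : i < l.length), w i = l[i] := fun i h => List.getD_eq_getElem _ _ h
  have hstep : ∀ i, ∃ j < d, i + 1 < l.length → nbr a n (w i) j = w (i + 1) := by
    intro i
    by_cases hi : i + 1 < l.length
    · obtain ⟨r, h1, -⟩ := exists_nbr_eq ha hG (w i)
      have hadj : G.Adj (w i) (w (i + 1)) := by
        rw [hwi i (by omega), hwi (i + 1) hi]
        exact List.isChain_iff_getElem.mp hl i hi
      exact ⟨_, (h1 _ hadj).1, fun _ => (h1 _ hadj).2⟩
    -- There is one digit per vertex but one step fewer; the step in the last digit is arbitrary.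
    · exact ⟨0, hd, fun h => absurd h hi⟩
  choose j hj hj' using hstep
  obtain ⟨e, he, hdig⟩ := exists_digits (b := 9 * d) (k := l.length)
    (f := fun i => d * f (w i) + j i) fun i _ => by
      have := hj i
      have := Nat.mul_le_mul_left d (Nat.le_of_lt_succ (hf (w i)))
      rw [show 9 * d = d * 8 + d by ring]
      omega
  have h0 : (n * e + w 0) / n = e := pos_div (w 0).2
  have hwalk : ∀ i < l.length, walk a n d (9 * d) (n * e + w 0) i = w i := by
    intro i
    induction i with
    | zero => exact fun _ => pos_mod (w 0).2
    | succ i ih =>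
      intro hi
      rw [walk_succ, ih (by omega), h0, hdig i (by omega), Nat.mul_add_mod,
        Nat.mod_eq_of_lt (hj i), hj' i hi]
  refine ⟨n * e + w 0, ?_, fun x => ?_⟩
  · calc n * e + w 0 < n * (e + 1) := by rw [Nat.mul_succ]; have := (w 0).2; omega
      _ ≤ _ := Nat.mul_le_mul_left _ he
  have hlab : ∀ q ≤ l.length, lab a n d (9 * d) (n * e + w 0) q x =
      if ∃ i < q, w i = x then f x else 0 := by
    intro q
    induction q with
    | zero => simp [lab]
    | succ q ih =>
      intro hq
      rw [lab_succ, ih (by omega), hwalk q (by omega), h0, hdig q (by omega)]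
      by_cases hx : w q = x
      · rw [if_pos (congrArg Fin.val hx), if_pos ⟨q, by omega, hx⟩, Nat.mul_add_div hd,
          Nat.div_eq_of_lt (hj q), hx, add_zero]
      · rw [if_neg fun h => hx (Fin.ext h)]
        refine if_congr ⟨?_, ?_⟩ rfl rfl
        · rintro ⟨i, hi, h⟩
          exact ⟨i, by omega, h⟩
        · rintro ⟨i, hi, h⟩
          refine ⟨i, lt_of_le_of_ne (by omega) ?_, h⟩
          rintro rfl
          exact hx h
  rw [hlab _ le_rfl]
  split_ifs with h
  · rfl
  · refine (hfl x fun hx => h ?_).symm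
    obtain ⟨i, hi, rfl⟩ := List.getElem_of_mem hx
    exact ⟨i, hi, hwi i hi⟩

/-- The entries are `0`, `1` or `-1`. -/
def IsTernary {V : Type*} (u : V → ℝ) : Prop := ∀ x, u x = 0 ∨ u x = 1 ∨ u x = -1

/-- This is the counting behind both union bounds: pairs of ternary vectors with connected joint
support of at most `m` vertices are among the pairs given by `n * (9 * d) ^ (2 * m)` codes. -/
theorem exists_code (ha : ∀ x y : Fin n, a x y ≠ 0 ↔ G.Adj x y) (hG : IsRegular G d)
    (hd : 0 < d) {u v : Fin n → ℝ} (hu : IsTernary u) (hv : IsTernary v) {S : Finset (Fin n)}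
    (hS : Linked G S) (hne : S.Nonempty) (hSu : ∀ x ∉ S, u x = 0 ∧ v x = 0) {m : ℕ}
    (hm : S.card ≤ m) :
    ∃ c < n * (9 * d) ^ (2 * m), fstLab a d (2 * m) c = u ∧ sndLab a d (2 * m) c = v := by
  have code : ∀ z : ℝ, z = 0 ∨ z = 1 ∨ z = -1 → ∃ k < 3, sgn k = z ∧ (z = 0 → k = 0) := by
    rintro z (rfl | rfl | rfl)
    · exact ⟨0, by norm_num, sgn_zero, fun _ => rfl⟩
    · exact ⟨1, by norm_num, sgn_one, by norm_num⟩
    · exact ⟨2, by norm_num, sgn_two, by norm_num⟩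
  choose k hk hku hk0 using fun x => code _ (hu x)
  choose k' hk' hkv hk0' using fun x => code _ (hv x)
  obtain ⟨l, h1, h2, h3⟩ := hS.exists_list hne
  have hdeg : ∀ x, ∃ y, G.Adj x y := fun x => ⟨_, adj_nbr ha hG x hd⟩
  have hlne : l ≠ [] := by
    rintro rfl
    simp only [List.length_nil] at h2
    omega
  obtain ⟨l', h1', h2', h3'⟩ := exists_longer_list hdeg h1 hlne (Q := 2 * m) (by omega)
  obtain ⟨c, hc, h⟩ := exists_code_of_list ha hG hd h1'
    (fun h => by obtain ⟨x, hx⟩ := List.exists_mem_of_ne_nil l hlne; simp [h] at h3'; exact h3' x hx)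
    -- The label has base 3 digits coding the entries of `u` and `v`. Outside the support both are
    -- 0, as the default label requires.
    (f := fun x => k x + 3 * k' x) (fun x => by have := hk x; have := hk' x; omega) fun x hx => by
      have hxS : x ∉ S := fun h => hx (h3' x (h3 x h))
      simp [hk0 x (hSu x hxS).1, hk0' x (hSu x hxS).2]
  rw [h2'] at hc h
  refine ⟨c, hc, funext fun x => ?_, funext fun x => ?_⟩
  · rw [fstLab, h, ← sgn_mod, Nat.add_mul_mod_self_left, sgn_mod, hku]
  · rw [sndLab, h, Nat.add_mul_div_left _ _ three_pos, Nat.div_eq_of_lt (hk x), zero_add, hkv]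

end TwoLift

namespace TwoLift

open Matrix

/-! ### Ternary vectors -/

theorem sqrt_mul_add_sqrt_mul_le {a₁ a₂ b₁ b₂ : ℝ} (ha₁ : 0 ≤ a₁) (ha₂ : 0 ≤ a₂) (hb₁ : 0 ≤ b₁)
    (hb₂ : 0 ≤ b₂) : √(a₁ * b₁) + √(a₂ * b₂) ≤ √((a₁ + a₂) * (b₁ + b₂)) := by
  refine Real.le_sqrt_of_sq_le ?_
  have h1 := Real.sq_sqrt (mul_nonneg ha₁ hb₁)
  have h2 := Real.sq_sqrt (mul_nonneg ha₂ hb₂)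
  have h3 : √(a₁ * b₁) * √(a₂ * b₂) ≤ (a₁ * b₂ + a₂ * b₁) / 2 := by
    rw [← Real.sqrt_mul (mul_nonneg ha₁ hb₁)]
    refine Real.sqrt_le_iff.mpr ⟨by positivity, ?_⟩
    nlinarith [sq_nonneg (a₁ * b₂ - a₂ * b₁)]
  nlinarith

section

variable {V : Type*} {u v : V → ℝ}

theorem IsTernary.abs_mul_abs (hu : IsTernary u) (x : V) : |u x| * |u x| = |u x| := by
  rcases hu x with h | h | h <;> simp [h]

theorem IsTernary.abs_le_one (hu : IsTernary u) (x : V) : |u x| ≤ 1 := by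
  rcases hu x with h | h | h <;> simp [h]

theorem IsTernary.indicator (hu : IsTernary u) (p : V → Prop) [DecidablePred p] :
    IsTernary fun x => if p x then u x else 0 := fun x => by
  by_cases hp : p x
  · simpa [hp] using hu x
  · simp [hp]

variable [Fintype V]

theorem dotProduct_self_nonneg' (u : V → ℝ) : 0 ≤ u ⬝ᵥ u :=
  Finset.sum_nonneg fun _ _ => mul_self_nonneg _

theorem IsTernary.dotProduct_self (hu : IsTernary u) : u ⬝ᵥ u = ∑ x, |u x| :=
  Finset.sum_congr rfl fun x _ => by rw [← abs_mul_abs_self, hu.abs_mul_abs]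

open Classical in
/-- The union of the supports of two vectors. -/
noncomputable def jointSupport (u v : V → ℝ) : Finset V := {x | u x ≠ 0 ∨ v x ≠ 0}

theorem mem_jointSupport {x : V} : x ∈ jointSupport u v ↔ u x ≠ 0 ∨ v x ≠ 0 := by
  simp [jointSupport]

theorem notMem_jointSupport {x : V} : x ∉ jointSupport u v ↔ u x = 0 ∧ v x = 0 := by
  rw [mem_jointSupport]
  tauto

theorem card_jointSupport_le (hu : IsTernary u) (hv : IsTernary v) :
    ((jointSupport u v).card : ℝ) ≤ u ⬝ᵥ u + v ⬝ᵥ v := by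
  classical
  rw [hu.dotProduct_self, hv.dotProduct_self, ← Finset.sum_add_distrib, ← nsmul_one,
    ← Finset.sum_const]
  refine (Finset.sum_le_sum fun x hx => ?_).trans (Finset.sum_le_sum_of_subset_of_nonneg
    (Finset.subset_univ _) fun x _ _ => add_nonneg (abs_nonneg _) (abs_nonneg _))
  have h1 := abs_nonneg (u x)
  have h2 := abs_nonneg (v x)
  rcases mem_jointSupport.mp hx with h | h
  · rcases hu x with h' | h' | h' <;> simp_all
  · rcases hv x with h' | h' | h' <;> simp_all

variable [DecidableEq V] {G : SimpleGraph V} {d : ℕ}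

/-- Induction on the size of the joint support. A disconnected support splits into two parts without
edges between them; the kernel sum and the squared norms add, and Cauchy–Schwarz in the form
`sqrt_mul_add_sqrt_mul_le` recombines the bounds. Hence only connected supports, of which there are
few, have to be examined. -/
theorem sum_kernel_le_of_linked {k : V → V → ℝ → ℝ → ℝ} (hk : ∀ x y a b, ¬ G.Adj x y → k x y a b = 0)
    (hkl : ∀ x y b, k x y 0 b = 0) (hkr : ∀ x y a, k x y a 0 = 0) {β : ℝ} (hβ : 0 ≤ β) {N : ℕ}
    (h : ∀ u v : V → ℝ, IsTernary u → IsTernary v → (jointSupport u v).card ≤ N →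
      Linked G (jointSupport u v) → (jointSupport u v).Nonempty →
      ∑ x, ∑ y, k x y (u x) (v y) ≤ β * √((u ⬝ᵥ u) * (v ⬝ᵥ v)))
    (u v : V → ℝ) (hu : IsTernary u) (hv : IsTernary v) (hN : (jointSupport u v).card ≤ N) :
    ∑ x, ∑ y, k x y (u x) (v y) ≤ β * √((u ⬝ᵥ u) * (v ⬝ᵥ v)) := by
  induction hs : (jointSupport u v).card using Nat.strong_induction_on generalizing u v with
  | _ s ih =>
  rcases (jointSupport u v).eq_empty_or_nonempty with he | hne
  · have hz : ∀ x, u x = 0 := fun x => (notMem_jointSupport.mp (he ▸ Finset.notMem_empty x)).1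
    simp only [hz, hkl, Finset.sum_const_zero]
    positivity
  by_cases hl : Linked G (jointSupport u v)
  · exact h u v hu hv hN hl hne
  unfold Linked at hl
  push Not at hl
  obtain ⟨T, hT, hTne, hTS, hadj⟩ := hl
  set u₁ : V → ℝ := fun x => if x ∈ T then u x else 0 with hu₁
  set v₁ : V → ℝ := fun x => if x ∈ T then v x else 0 with hv₁
  set u₂ : V → ℝ := fun x => if x ∉ T then u x else 0 with hu₂
  set v₂ : V → ℝ := fun x => if x ∉ T then v x else 0 with hv₂
  have hT1 : jointSupport u₁ v₁ ⊆ T := fun x hx => by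
    by_contra h
    simp [mem_jointSupport, hu₁, hv₁, h] at hx
  have hT2 : jointSupport u₂ v₂ ⊆ jointSupport u v \ T := fun x hx => by
    by_cases h : x ∈ T
    · simp [mem_jointSupport, hu₂, hv₂, h] at hx
    · simpa [mem_jointSupport, hu₂, hv₂, h] using hx
  have c1 := (Finset.card_le_card hT1).trans_lt
    (Finset.card_lt_card (lt_of_le_of_ne hT hTS))
  have c2 := (Finset.card_le_card hT2).trans_lt
    (Finset.card_lt_card (Finset.sdiff_ssubset hT hTne))
  have i1 := ih _ (hs ▸ c1) u₁ v₁ (hu.indicator _) (hv.indicator _) (c1.le.trans hN) rfl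
  have i2 := ih _ (hs ▸ c2) u₂ v₂ (hu.indicator _) (hv.indicator _) (c2.le.trans hN) rfl
  have e : ∀ x y, k x y (u x) (v y) = k x y (u₁ x) (v₁ y) + k x y (u₂ x) (v₂ y) := by
    intro x y
    by_cases hx : x ∈ T <;> by_cases hy : y ∈ T
    · simp [hu₁, hv₁, hu₂, hx, hy, hkl]
    · simp only [hv₁, hu₂, hx, hy, not_true_eq_false, if_false, hkl, hkr, add_zero]
      by_cases h0 : v y = 0
      · rw [h0, hkr]
      · exact hk _ _ _ _ (hadj x hx y (Finset.mem_sdiff.mpr ⟨mem_jointSupport.mpr (Or.inr h0), hy⟩))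
    · simp only [hu₁, hv₂, hx, hy, not_true_eq_false, if_false, hkl, hkr, add_zero]
      by_cases h0 : u x = 0
      · rw [h0, hkl]
      · exact hk _ _ _ _ fun h => hadj y hy x
          (Finset.mem_sdiff.mpr ⟨mem_jointSupport.mpr (Or.inl h0), hx⟩) h.symm
    · simp [hu₁, hv₂, hu₂, hx, hy, hkl]
  have ea : ∀ u : V → ℝ, u ⬝ᵥ u = (fun x => if x ∈ T then u x else 0) ⬝ᵥ
      (fun x => if x ∈ T then u x else 0) + (fun x => if x ∉ T then u x else 0) ⬝ᵥ
      (fun x => if x ∉ T then u x else 0) := fun u => by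
    simp only [dotProduct, ← Finset.sum_add_distrib]
    refine Finset.sum_congr rfl fun x _ => ?_
    by_cases hx : x ∈ T <;> simp [hx]
  simp only [e, Finset.sum_add_distrib]
  rw [ea u, ea v]
  refine (add_le_add i1 i2).trans ?_
  rw [← mul_add]
  exact mul_le_mul_of_nonneg_left (sqrt_mul_add_sqrt_mul_le (dotProduct_self_nonneg' _)
    (dotProduct_self_nonneg' _) (dotProduct_self_nonneg' _) (dotProduct_self_nonneg' _)) hβ

omit [DecidableEq V]

/-- The number of edges between the supports of two ternary vectors. -/
noncomputable def edgeCount (G : SimpleGraph V) (u v : V → ℝ) : ℝ :=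
  ∑ x, ∑ y, adj G x y * (|u x| * |v y|)

theorem edgeCount_le_left (hG : IsRegular G d) (hu : IsTernary u) (hv : IsTernary v) :
    edgeCount G u v ≤ d * (u ⬝ᵥ u) := by
  rw [hu.dotProduct_self, Finset.mul_sum]
  refine Finset.sum_le_sum fun x _ => ?_
  rw [← sum_adj hG x, Finset.sum_mul]
  refine Finset.sum_le_sum fun y _ => mul_le_mul_of_nonneg_left ?_ (adj_nonneg _ _)
  exact mul_le_of_le_one_right (abs_nonneg _) (hv.abs_le_one y)

theorem edgeCount_symm (u v : V → ℝ) : edgeCount G u v = edgeCount G v u := by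
  unfold edgeCount
  rw [Finset.sum_comm]
  exact Finset.sum_congr rfl fun x _ => Finset.sum_congr rfl fun y _ => by
    rw [adj_symm, mul_comm |u y|]

theorem edgeCount_le_right (hG : IsRegular G d) (hu : IsTernary u) (hv : IsTernary v) :
    edgeCount G u v ≤ d * (v ⬝ᵥ v) := edgeCount_symm u v ▸ edgeCount_le_left hG hv hu

theorem edgeCount_nonneg (u v : V → ℝ) : 0 ≤ edgeCount G u v :=
  Finset.sum_nonneg fun _ _ => Finset.sum_nonneg fun _ _ => mul_nonneg (adj_nonneg _ _)
    (mul_nonneg (abs_nonneg _) (abs_nonneg _))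

theorem edgeCount_le_sqrt (hG : IsRegular G d) (hu : IsTernary u) (hv : IsTernary v) :
    edgeCount G u v ≤ d * √((u ⬝ᵥ u) * (v ⬝ᵥ v)) := by
  have h1 := edgeCount_le_left hG hu hv
  have h2 := edgeCount_le_right hG hu hv
  have h0 := edgeCount_nonneg (G := G) u v
  have e : (d : ℝ) * √((u ⬝ᵥ u) * (v ⬝ᵥ v)) = √((d * (u ⬝ᵥ u)) * (d * (v ⬝ᵥ v))) := by
    rw [show (d * (u ⬝ᵥ u)) * (d * (v ⬝ᵥ v)) = (d : ℝ) ^ 2 * ((u ⬝ᵥ u) * (v ⬝ᵥ v)) by ring,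
      Real.sqrt_mul (sq_nonneg (d : ℝ)), Real.sqrt_sq d.cast_nonneg]
  rw [e]
  refine Real.le_sqrt_of_sq_le ?_
  rw [pow_two]
  exact mul_le_mul h1 h2 h0 (h0.trans h1)

theorem IsSparse.edgeCount_le {β t : ℝ} (h : IsSparse G β t) (hu : IsTernary u) (hv : IsTernary v)
    (ht : ((jointSupport u v).card : ℝ) ≤ t) :
    edgeCount G u v ≤ β * √((u ⬝ᵥ u) * (v ⬝ᵥ v)) := by
  have key : ∀ u : V → ℝ, IsTernary u → (∀ x, |u x| = 0 ∨ |u x| = 1) := fun u hu x => by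
    rcases hu x with h | h | h <;> simp [h]
  have hn : ∀ u : V → ℝ, ‖WithLp.toLp 2 (fun x => |u x|)‖ = √(u ⬝ᵥ u) := fun u => by
    rw [EuclideanSpace.norm_eq]
    congr 1
    exact Finset.sum_congr rfl fun x _ => by simp [pow_two]
  have := h (fun x => |u x|) (fun x => |v x|) (key u hu) (key v hv) ?_
  · rwa [dotProduct_mulVec_eq_sum, hn, hn, mul_assoc,
      ← Real.sqrt_mul (dotProduct_self_nonneg' _)] at this
  · refine le_trans (le_of_eq ?_) ht
    rw [← Set.ncard_coe_finset]
    congr 2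
    ext x
    simp [mem_jointSupport]

end

end TwoLift

namespace TwoLift

open Matrix

/-! ### From ternary vectors to integer vectors -/

/-- The binary digits of |x|, all with the sign of `x`. Equal signs make the cross terms of the
square nonnegative, whence the bound on the squares. -/
theorem exists_signed_digits (K : ℕ) (x : ℤ) (hx : |x| < 2 ^ K) : ∃ b : ℕ → ℤ,
    (∀ i, b i = 0 ∨ b i = 1 ∨ b i = -1) ∧ x = ∑ i ∈ Finset.range K, 2 ^ i * b i ∧
      ∑ i ∈ Finset.range K, 4 ^ i * b i ^ 2 ≤ x ^ 2 := by
  induction K generalizing x with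
  | zero =>
    have : x = 0 := by
      rw [pow_zero] at hx
      have := abs_nonneg x
      exact abs_eq_zero.mp (by omega)
    exact ⟨fun _ => 0, fun _ => Or.inl rfl, by simp [this], by simp [this]⟩
  | succ K ih =>
    -- Since `y` and the last digit `c` do not have opposite signs, 4y² + c² ≤ (2y + c)².
    obtain ⟨y, c, rfl, hc, hyc, hy⟩ : ∃ y c : ℤ, x = 2 * y + c ∧ (c = 0 ∨ c = 1 ∨ c = -1) ∧
        0 ≤ y * c ∧ |y| < 2 ^ K := by
      rw [pow_succ] at hx
      rcases le_total 0 x with h | h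
      · rw [abs_of_nonneg h] at hx
        refine ⟨x / 2, x % 2, by omega, by omega, mul_nonneg (by omega) (by omega), ?_⟩
        rw [abs_of_nonneg (by omega)]
        omega
      · rw [abs_of_nonpos h] at hx
        refine ⟨-(-x / 2), -(-x % 2), by omega, by omega, ?_, ?_⟩
        · rw [neg_mul_neg]
          exact mul_nonneg (by omega) (by omega)
        · rw [abs_neg, abs_of_nonneg (by omega)]
          omega
    obtain ⟨b, hb, h1, h2⟩ := ih y hy
    refine ⟨fun i => if i = 0 then c else b (i - 1), fun i => ?_, ?_, ?_⟩
    · dsimp only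
      split_ifs
      exacts [hc, hb _]
    · rw [Finset.sum_range_succ']
      simp only [Nat.add_eq_zero_iff, one_ne_zero, and_false, if_false, if_true,
        Nat.add_sub_cancel, pow_succ', mul_assoc, ← Finset.mul_sum, ← h1, pow_zero, one_mul]
    · rw [Finset.sum_range_succ']
      simp only [Nat.add_eq_zero_iff, one_ne_zero, and_false, if_false, if_true,
        Nat.add_sub_cancel, pow_succ' (4 : ℤ), mul_assoc, ← Finset.mul_sum, pow_zero, one_mul]
      nlinarith

theorem sum_half_pow_le (K r j : ℕ) :
    ∑ i ∈ Finset.range K, (if i + r ≤ j then (1 / 2 : ℝ) ^ (j - r - i) else 0) ≤ 2 := by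
  rcases lt_or_ge j r with h | h
  · rw [Finset.sum_eq_zero fun i _ => if_neg (by omega)]
    norm_num
  obtain ⟨t, rfl⟩ := Nat.exists_eq_add_of_le h
  have h1 : ∀ t : ℕ, ∑ i ∈ Finset.range (t + 1), (1 / 2 : ℝ) ^ (t - i) ≤ 2 := by
    intro t
    have := Finset.sum_range_reflect (fun i => (1 / 2 : ℝ) ^ i) (t + 1)
    simp only [Nat.add_sub_cancel] at this
    rw [this]
    have := geom_sum_eq (by norm_num : (1 / 2 : ℝ) ≠ 1) (t + 1)
    rw [this]
    have : (0 : ℝ) ≤ (1 / 2) ^ (t + 1) := by positivity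
    rw [div_le_iff_of_neg (by norm_num)]
    linarith
  refine le_trans ?_ (h1 t)
  rw [← Finset.sum_filter]
  simp only [Nat.add_sub_cancel_left]
  refine Finset.sum_le_sum_of_subset_of_nonneg (fun i hi => ?_) fun _ _ _ => by positivity
  simp only [Finset.mem_filter, Finset.mem_range] at hi ⊢
  omega

theorem sum_near_le (K r j : ℕ) :
    ∑ i ∈ Finset.range K, (if i < j + r ∧ j < i + r then (1 : ℝ) else 0) ≤ 2 * r := by
  rw [Finset.sum_boole]
  have : ((Finset.range K).filter fun i => i < j + r ∧ j < i + r).card ≤ 2 * r := by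
    refine (Finset.card_le_card (t := Finset.Ico (j + 1 - r) (j + r)) fun i hi => ?_).trans ?_
    · simp only [Finset.mem_filter, Finset.mem_Ico] at hi ⊢
      omega
    · rw [Nat.card_Ico]
      omega
  exact_mod_cast this

/-- Scales at distance less than `r` are fewer than `2 * r` for each index and cost `α / 2` each, in
total at most `α * r`. Scales at distance at least `r` decay geometrically with sum at most 2. -/
theorem sum_sum_le_of_digits {K r : ℕ} {α : ℝ} {f : ℕ → ℕ → ℝ} {X Y : ℕ → ℝ} (hα : 0 ≤ α)
    (hX : ∀ i, 0 ≤ X i) (hY : ∀ i, 0 ≤ Y i)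
    (hnear : ∀ i j, f i j ≤ α / 2 * (X i + Y j))
    (hright : ∀ i j, i + r ≤ j → f i j ≤ (1 / 2) ^ (j - r - i) * Y j)
    (hleft : ∀ i j, j + r ≤ i → f i j ≤ (1 / 2) ^ (i - r - j) * X i) :
    ∑ i ∈ Finset.range K, ∑ j ∈ Finset.range K, f i j ≤
      (α * r + 2) * (∑ i ∈ Finset.range K, X i + ∑ j ∈ Finset.range K, Y j) := by
  have hf : ∀ i j, f i j ≤
      ((if j < i + r ∧ i < j + r then 1 else 0) * (α / 2) +
        (if j + r ≤ i then (1 / 2 : ℝ) ^ (i - r - j) else 0)) * X i +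
      ((if i < j + r ∧ j < i + r then 1 else 0) * (α / 2) +
        (if i + r ≤ j then (1 / 2 : ℝ) ^ (j - r - i) else 0)) * Y j := by
    intro i j
    have h1 : (0 : ℝ) ≤ (1 / 2) ^ (i - r - j) * X i := mul_nonneg (by positivity) (hX i)
    have h2 : (0 : ℝ) ≤ (1 / 2) ^ (j - r - i) * Y j := mul_nonneg (by positivity) (hY j)
    have h3 : 0 ≤ α / 2 * X i := mul_nonneg (by positivity) (hX i)
    have h4 : 0 ≤ α / 2 * Y j := mul_nonneg (by positivity) (hY j)
    by_cases hij : i + r ≤ j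
    · have := hright i j hij
      rw [if_pos hij]
      split_ifs <;> linarith
    by_cases hji : j + r ≤ i
    · have := hleft i j hji
      rw [if_pos hji]
      split_ifs <;> linarith
    · have := hnear i j
      rw [if_pos (⟨by omega, by omega⟩ : j < i + r ∧ i < j + r),
        if_pos (⟨by omega, by omega⟩ : i < j + r ∧ j < i + r), if_neg hij, if_neg hji]
      linarith
  have key : ∀ Z : ℕ → ℝ, (∀ i, 0 ≤ Z i) → ∑ i ∈ Finset.range K, ∑ j ∈ Finset.range K,
      ((if j < i + r ∧ i < j + r then 1 else 0) * (α / 2) +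
        (if j + r ≤ i then (1 / 2 : ℝ) ^ (i - r - j) else 0)) * Z i ≤
      (α * r + 2) * ∑ i ∈ Finset.range K, Z i := by
    intro Z hZ
    rw [Finset.mul_sum]
    refine Finset.sum_le_sum fun i _ => ?_
    rw [← Finset.sum_mul, Finset.sum_add_distrib, ← Finset.sum_mul]
    refine mul_le_mul_of_nonneg_right ?_ (hZ i)
    have h1 := sum_near_le K r i
    have h2 := sum_half_pow_le K r i
    nlinarith
  calc _ ≤ ∑ i ∈ Finset.range K, ∑ j ∈ Finset.range K, _ :=
        Finset.sum_le_sum fun i _ => Finset.sum_le_sum fun j _ => hf i j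
    _ ≤ _ := by
      rw [Finset.sum_congr rfl fun i _ => Finset.sum_add_distrib, Finset.sum_add_distrib, mul_add]
      refine add_le_add (key X hX) ?_
      rw [Finset.sum_comm]
      exact key Y hY

section

variable {V : Type*} [Fintype V] {G : SimpleGraph V} {d : ℕ} {B : Matrix V V ℝ}

theorem abs_dotProduct_mulVec_le_edgeCount (hB : ∀ x y, |B x y| ≤ adj G x y) (u v : V → ℝ) :
    |u ⬝ᵥ B *ᵥ v| ≤ edgeCount G u v := by
  rw [dotProduct_mulVec_eq_sum]
  refine (Finset.abs_sum_le_sum_abs _ _).trans (Finset.sum_le_sum fun x _ =>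
    (Finset.abs_sum_le_sum_abs _ _).trans (Finset.sum_le_sum fun y _ => ?_))
  rw [abs_mul, abs_mul]
  exact mul_le_mul_of_nonneg_right (hB x y) (by positivity)

/-- A converse of the expander mixing lemma: integer vectors are expanded into ternary vectors at
scales 2^i. Near scales use the discrepancy bound `α`, far scales only the degree. Integer vectors
suffice for traces, and their expansions are finite and exact. -/
theorem abs_bilinear_int_le (hG : IsRegular G d) (hB : ∀ x y, |B x y| ≤ adj G x y) {α : ℝ}
    (hα : 1 ≤ α) (h : ∀ u v : V → ℝ, IsTernary u → IsTernary v →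
      u ⬝ᵥ B *ᵥ v ≤ α * √((u ⬝ᵥ u) * (v ⬝ᵥ v))) {r : ℕ} (hr : d ≤ 2 ^ r) (x y : V → ℤ) :
    |(fun i => (x i : ℝ)) ⬝ᵥ B *ᵥ (fun i => (y i : ℝ))| ≤ α * (r + 2) *
      ((fun i => (x i : ℝ)) ⬝ᵥ (fun i => (x i : ℝ)) + (fun i => (y i : ℝ)) ⬝ᵥ (fun i => (y i : ℝ))) := by
  have habs : ∀ u v : V → ℝ, IsTernary u → IsTernary v →
      |u ⬝ᵥ B *ᵥ v| ≤ α * √((u ⬝ᵥ u) * (v ⬝ᵥ v)) := by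
    intro u v hu hv
    refine abs_le'.mpr ⟨h u v hu hv, ?_⟩
    have hu' : IsTernary (-u) := fun x => by
      rcases hu x with h | h | h <;> simp [h]
    simpa using h (-u) v hu' hv
  -- Any `K` with all entries below `2 ^ K` would do; the bound does not depend on it.
  set K := ∑ i, ((x i).natAbs + (y i).natAbs) with hK
  have hKx : ∀ i, |x i| < 2 ^ K ∧ |y i| < 2 ^ K := by
    intro i
    have h1 : (x i).natAbs + (y i).natAbs ≤ K :=
      Finset.single_le_sum (f := fun i => (x i).natAbs + (y i).natAbs) (fun _ _ => Nat.zero_le _)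
        (Finset.mem_univ i)
    have h2 := K.lt_two_pow_self
    zify at h1 h2
    have h3 := abs_nonneg (x i)
    have h4 := abs_nonneg (y i)
    constructor <;> omega
  choose a ha1 ha2 ha3 using fun i => exists_signed_digits K (x i) (hKx i).1
  choose b hb1 hb2 hb3 using fun i => exists_signed_digits K (y i) (hKx i).2
  set u : ℕ → V → ℝ := fun i v => a v i with hu
  set w : ℕ → V → ℝ := fun i v => b v i with hw
  have tern : ∀ c : V → ℕ → ℤ, (∀ v i, c v i = 0 ∨ c v i = 1 ∨ c v i = -1) → ∀ i,
      IsTernary fun v => (c v i : ℝ) := by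
    intro c hc i v
    rcases hc v i with h | h | h <;> simp [h]
  have htu : ∀ i, IsTernary (u i) := tern a ha1
  have htw : ∀ i, IsTernary (w i) := tern b hb1
  have hsq : ∀ (z : V → ℤ) (c : V → ℕ → ℤ),
      (∀ v, ∑ i ∈ Finset.range K, 4 ^ i * c v i ^ 2 ≤ z v ^ 2) →
      ∑ i ∈ Finset.range K, (4 : ℝ) ^ i * ((fun v => (c v i : ℝ)) ⬝ᵥ fun v => (c v i : ℝ)) ≤
        (fun i => (z i : ℝ)) ⬝ᵥ fun i => (z i : ℝ) := by
    intro z c hc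
    simp only [dotProduct, Finset.mul_sum]
    rw [Finset.sum_comm]
    refine Finset.sum_le_sum fun v _ => ?_
    have := hc v
    rify at this
    simpa [pow_two] using this
  have hsum : ∀ (z : V → ℤ) (c : V → ℕ → ℤ),
      (∀ v, z v = ∑ i ∈ Finset.range K, 2 ^ i * c v i) →
      (fun i => (z i : ℝ)) = ∑ i ∈ Finset.range K, (2 : ℝ) ^ i • fun v => (c v i : ℝ) := by
    intro z c hc
    ext v
    rw [hc v]
    simp
  have hxy : (fun i => (x i : ℝ)) ⬝ᵥ B *ᵥ (fun i => (y i : ℝ)) =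
      ∑ i ∈ Finset.range K, ∑ j ∈ Finset.range K, 2 ^ i * 2 ^ j * (u i ⬝ᵥ B *ᵥ w j) := by
    rw [hsum x a ha2, hsum y b hb2, sum_dotProduct]
    refine Finset.sum_congr rfl fun i _ => ?_
    rw [Matrix.mulVec_sum, dotProduct_sum]
    refine Finset.sum_congr rfl fun j _ => ?_
    rw [mulVec_smul, dotProduct_smul, smul_dotProduct, smul_eq_mul, smul_eq_mul]
    ring
  set X : ℕ → ℝ := fun i => 4 ^ i * (u i ⬝ᵥ u i) with hX
  set Y : ℕ → ℝ := fun i => 4 ^ i * (w i ⬝ᵥ w i) with hY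
  -- The trivial bound loses a factor `d`, which is at most `2 ^ r` and is paid for by the gap
  -- between the scales; what remains of the gap gives the decay.
  have hfar : ∀ (i j : ℕ) (c : ℝ), 0 ≤ c → i + r ≤ j →
      2 ^ i * 2 ^ j * (d * c) ≤ (1 / 2) ^ (j - r - i) * (4 ^ j * c) := by
    intro i j c hc hij
    obtain ⟨t, rfl⟩ := Nat.exists_eq_add_of_le hij
    have e : i + r + t - r - i = t := by omega
    have h4 : (4 : ℝ) = 2 * 2 := by norm_num
    have hd : (d : ℝ) ≤ 2 ^ r := by exact_mod_cast hr
    rw [e, h4, mul_pow, one_div, inv_pow]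
    have : ((2 : ℝ) ^ t)⁻¹ * (2 ^ (i + r + t) * 2 ^ (i + r + t) * c) =
        2 ^ i * 2 ^ (i + r + t) * (2 ^ r * c) := by
      rw [pow_add, pow_add]
      field_simp
    rw [this]
    gcongr
  have := sum_sum_le_of_digits (K := K) (r := r) (α := α)
    (f := fun i j => |2 ^ i * 2 ^ j * (u i ⬝ᵥ B *ᵥ w j)|) (X := X) (Y := Y) (by linarith)
    (fun i => mul_nonneg (by positivity) (dotProduct_self_nonneg' _))
    (fun i => mul_nonneg (by positivity) (dotProduct_self_nonneg' _)) ?_ ?_ ?_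
  · rw [hxy]
    refine (Finset.abs_sum_le_sum_abs _ _).trans ((Finset.sum_le_sum fun i _ =>
      Finset.abs_sum_le_sum_abs _ _).trans (this.trans ?_))
    refine mul_le_mul (by nlinarith) (add_le_add (hsq x a ha3) (hsq y b hb3)) ?_ (by positivity)
    exact add_nonneg (Finset.sum_nonneg fun i _ => mul_nonneg (by positivity)
      (dotProduct_self_nonneg' _)) (Finset.sum_nonneg fun i _ => mul_nonneg (by positivity)
      (dotProduct_self_nonneg' _))
  · intro i j
    rw [abs_mul, abs_of_pos (by positivity : (0 : ℝ) < 2 ^ i * 2 ^ j)]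
    have h1 := habs _ _ (htu i) (htw j)
    rw [Real.sqrt_mul (dotProduct_self_nonneg' _)] at h1
    have h2 := Real.sq_sqrt (dotProduct_self_nonneg' (u i))
    have h3 := Real.sq_sqrt (dotProduct_self_nonneg' (w j))
    have h4 : ∀ k : ℕ, (4 : ℝ) ^ k = (2 ^ k) ^ 2 := fun k => by
      rw [← pow_mul, mul_comm k, pow_mul]; norm_num
    simp only [hX, hY]
    rw [h4, h4, ← h2, ← h3]
    set p := √(u i ⬝ᵥ u i)
    set q := √(w j ⬝ᵥ w j)
    calc 2 ^ i * 2 ^ j * |u i ⬝ᵥ B *ᵥ w j| ≤ 2 ^ i * 2 ^ j * (α * (p * q)) := by gcongr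
      _ = α / 2 * (2 * (2 ^ i * p) * (2 ^ j * q)) := by ring
      _ ≤ α / 2 * ((2 ^ i * p) ^ 2 + (2 ^ j * q) ^ 2) := by
        gcongr
        exact two_mul_le_add_sq _ _
      _ = _ := by ring
  · intro i j hij
    rw [abs_mul, abs_of_pos (by positivity : (0 : ℝ) < 2 ^ i * 2 ^ j)]
    refine le_trans ?_ (hfar i j _ (dotProduct_self_nonneg' (w j)) hij)
    gcongr
    exact (abs_dotProduct_mulVec_le_edgeCount hB _ _).trans
      (edgeCount_le_right hG (htu i) (htw j))
  · intro i j hij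
    rw [abs_mul, abs_of_pos (by positivity : (0 : ℝ) < 2 ^ i * 2 ^ j), mul_comm ((2 : ℝ) ^ i)]
    refine le_trans ?_ (hfar j i _ (dotProduct_self_nonneg' (u i)) hij)
    gcongr
    exact (abs_dotProduct_mulVec_le_edgeCount hB _ _).trans
      (edgeCount_le_left hG (htu i) (htw j))

end

end TwoLift

namespace TwoLift

open Matrix

/-! ### Traces of powers -/

section

variable {V : Type*} [Fintype V] [DecidableEq V] {B : Matrix V V ℝ}

theorem trace_pow_two_mul (hB : ∀ x y, B x y = B y x) (m : ℕ) :
    (B ^ (2 * m)).trace = ∑ y, ∑ x, (B ^ m) x y ^ 2 := by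
  have ht : ∀ x y, (B ^ m) x y = (B ^ m) y x := fun x y => by
    have h : (Bᵀ) ^ m = B ^ m := by rw [show Bᵀ = B from Matrix.ext fun x y => hB y x]
    rw [← Matrix.transpose_pow] at h
    exact congrFun (congrFun h.symm x) y
  rw [two_mul, pow_add, Matrix.trace]
  refine Finset.sum_congr rfl fun y _ => ?_
  rw [Matrix.diag_apply, Matrix.mul_apply]
  exact Finset.sum_congr rfl fun x _ => by rw [ht y x, pow_two]

theorem trace_pow_two_mul_nonneg (hB : ∀ x y, B x y = B y x) (m : ℕ) :
    0 ≤ (B ^ (2 * m)).trace := by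
  rw [trace_pow_two_mul hB]
  positivity

/-- The matrix maps integer vectors to integer vectors, so a norm bound on these alone can be
iterated. The trace of the even power is the sum of the squared norms of the columns of `B ^ m`, the
images of unit vectors. -/
theorem trace_pow_le (hB : ∀ x y, B x y = B y x) (hint : ∀ x y, ∃ k : ℤ, B x y = k) {b : ℕ}
    (h : ∀ x y : V → ℤ, |(fun i => (x i : ℝ)) ⬝ᵥ B *ᵥ (fun i => (y i : ℝ))| ≤ b / 2 *
      ((fun i => (x i : ℝ)) ⬝ᵥ (fun i => (x i : ℝ)) + (fun i => (y i : ℝ)) ⬝ᵥ (fun i => (y i : ℝ))))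
    (m : ℕ) : (B ^ (2 * m)).trace ≤ Fintype.card V * (b : ℝ) ^ (2 * m) := by
  choose Z hZ using hint
  set Z' : Matrix V V ℤ := Matrix.of Z with hZ'
  have hmul : ∀ y : V → ℤ, B *ᵥ (fun i => (y i : ℝ)) = fun i => (((Z' *ᵥ y) i : ℤ) : ℝ) := by
    intro y
    ext i
    simp [mulVec, dotProduct, hZ, hZ']
  have hstep : ∀ y : V → ℤ, (fun i => (((Z' *ᵥ y) i : ℤ) : ℝ)) ⬝ᵥ (fun i => (((Z' *ᵥ y) i : ℤ) : ℝ)) ≤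
      (b : ℝ) ^ 2 * ((fun i => (y i : ℝ)) ⬝ᵥ (fun i => (y i : ℝ))) := by
    intro y
    -- Testing `B y` against `b y` balances the two squares: b|By|² ≤ (b/2)(|By|² + b²|y|²), hence
    -- |By|² ≤ b²|y|².
    have h1 := (le_abs_self _).trans (h (Z' *ᵥ y) (fun i => b * y i))
    have e : (fun i => ((b * y i : ℤ) : ℝ)) = (b : ℝ) • fun i => (y i : ℝ) := by
      ext i
      simp
    rw [e, mulVec_smul, hmul] at h1
    simp only [dotProduct_smul, smul_dotProduct, smul_eq_mul] at h1
    rcases Nat.eq_zero_or_pos b with rfl | hb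
    · have h2 := (le_abs_self _).trans (h (Z' *ᵥ y) y)
      rw [hmul] at h2
      simpa using h2
    · have hb' : (0 : ℝ) < b := by exact_mod_cast hb
      refine le_of_mul_le_mul_left ?_ hb'
      linarith
  have hpow : ∀ (m : ℕ) (y : V → ℤ),
      ∃ z : V → ℤ, B ^ m *ᵥ (fun i => (y i : ℝ)) = (fun i => (z i : ℝ)) ∧
      (fun i => (z i : ℝ)) ⬝ᵥ (fun i => (z i : ℝ)) ≤
        (b : ℝ) ^ (2 * m) * ((fun i => (y i : ℝ)) ⬝ᵥ (fun i => (y i : ℝ))) := by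
    intro m y
    induction m with
    | zero => exact ⟨y, by simp, by simp⟩
    | succ m ih =>
      obtain ⟨z, h1, h2⟩ := ih
      refine ⟨Z' *ᵥ z, by rw [pow_succ', ← mulVec_mulVec, h1, hmul], (hstep z).trans ?_⟩
      calc (b : ℝ) ^ 2 * _ ≤ (b : ℝ) ^ 2 * _ := mul_le_mul_of_nonneg_left h2 (by positivity)
        _ = _ := by ring
  rw [trace_pow_two_mul hB, ← nsmul_eq_mul, ← Finset.card_univ, ← Finset.sum_const]
  refine Finset.sum_le_sum fun y _ => ?_
  obtain ⟨z, h1, h2⟩ := hpow m (Pi.single y 1)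
  have e : (fun i => ((Pi.single y 1 : V → ℤ) i : ℝ)) = Pi.single y (1 : ℝ) := by
    ext i
    by_cases hi : i = y
    · subst hi; simp
    · simp [hi]
  rw [e, mulVec_single_one] at h1
  rw [e, ← h1, single_dotProduct, Pi.single_eq_same, one_mul, mul_one] at h2
  simpa [dotProduct, pow_two] using h2

/-- For a unit eigenvector v, λ^(2m) = |B^m v|², and by Cauchy–Schwarz this is at most the sum of
all squared entries of B^m, the trace of B^(2m). -/
theorem abs_eigenvalue_le_of_trace (hB : B.IsHermitian) {T : ℝ} (hT : 0 ≤ T) {m : ℕ} (hm : m ≠ 0)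
    (h : (B ^ (2 * m)).trace ≤ T ^ (2 * m)) (i : V) : |hB.eigenvalues i| ≤ T := by
  have hs : ∀ x y, B x y = B y x := fun x y => by
    have := congrFun (congrFun hB y) x
    simpa using this
  obtain ⟨v, h1, h2, -, -, -⟩ := exists_spectral hB
  have hpow : ∀ m : ℕ, B ^ m *ᵥ v i = hB.eigenvalues i ^ m • v i := by
    intro m
    induction m with
    | zero => simp
    | succ m ih => rw [pow_succ', ← mulVec_mulVec, ih, mulVec_smul, h1, smul_smul, pow_succ]
  have h3 : hB.eigenvalues i ^ (2 * m) ≤ (B ^ (2 * m)).trace := by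
    have e : hB.eigenvalues i ^ (2 * m) = (B ^ m *ᵥ v i) ⬝ᵥ (B ^ m *ᵥ v i) := by
      rw [hpow, smul_dotProduct, dotProduct_smul, h2, smul_eq_mul, smul_eq_mul, two_mul, pow_add,
        mul_one]
    rw [e, trace_pow_two_mul hs, Finset.sum_comm]
    refine Finset.sum_le_sum fun x _ => ?_
    have := Finset.sum_mul_sq_le_sq_mul_sq Finset.univ ((B ^ m) x) (v i)
    have h4 : ∑ j, v i j ^ 2 = 1 := by
      rw [← h2 i]
      exact Finset.sum_congr rfl fun j _ => pow_two _
    rw [h4, mul_one] at this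
    rwa [← pow_two]
  have h5 : |hB.eigenvalues i| ^ (2 * m) ≤ T ^ (2 * m) := by
    rw [← abs_pow, abs_of_nonneg (by rw [pow_mul]; positivity)]
    exact h3.trans h
  exact le_of_pow_le_pow_left₀ (by omega) hT h5

end

end TwoLift

namespace TwoLift

open Matrix

/-! ### Random signs -/

section

variable {n d : ℕ} {G : SimpleGraph (Fin n)} {u v : Fin n → ℝ}

theorem sum_lt_add_swap (g : Fin n → Fin n → ℝ) (hg : ∀ x, g x x = 0) :
    (∑ e : Fin n × Fin n, if e.1 < e.2 then g e.1 e.2 + g e.2 e.1 else 0) = ∑ x, ∑ y, g x y := by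
  have h1 : ∀ x y, g x y = (if x < y then g x y else 0) + if y < x then g x y else 0 := by
    intro x y
    rcases lt_trichotomy x y with h | rfl | h
    · simp [h, h.not_gt]
    · simp [hg]
    · simp [h, h.not_gt]
  have h2 : ∀ x y, (if x < y then g x y + g y x else 0) =
      (if x < y then g x y else 0) + if x < y then g y x else 0 := by
    intro x y
    split_ifs <;> simp
  rw [Fintype.sum_prod_type]
  simp only [h2, Finset.sum_add_distrib]
  rw [Finset.sum_comm (f := fun x y => if x < y then g y x else 0)]
  simp only [← Finset.sum_add_distrib, ← h1]

/-- The coefficient of the sign of a pair in the bilinear form. -/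
noncomputable def pairCoeff (G : SimpleGraph (Fin n)) (u v : Fin n → ℝ) (e : Fin n × Fin n) : ℝ :=
  if e.1 < e.2 then adj G e.1 e.2 * (u e.1 * v e.2 + u e.2 * v e.1) else 0

theorem adj_self (x : Fin n) : adj G x x = 0 := by
  classical
  rw [adj_apply, if_neg (G.loopless.irrefl x)]

theorem adj_sq {V : Type*} {G : SimpleGraph V} (x y : V) : adj G x y ^ 2 = adj G x y := by
  classical
  rw [adj_apply]
  split_ifs <;> simp

theorem bilinear_edgeMatrix (p : Fin n → Fin n → ℝ) :
    u ⬝ᵥ edgeMatrix G p *ᵥ v = ∑ e, pairCoeff G u v e * p e.1 e.2 := by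
  rw [dotProduct_mulVec_eq_sum, ← sum_lt_add_swap]
  · refine Finset.sum_congr rfl fun e _ => ?_
    unfold pairCoeff
    by_cases h : e.1 < e.2
    · simp only [if_pos h, edgeMatrix_symm p e.2 e.1]
      simp only [edgeMatrix, Matrix.of_apply, if_pos h]
      ring
    · simp [h]
  · intro x
    simp [edgeMatrix, adj_self]

theorem sum_pairCoeff_sq_le (hu : IsTernary u) (hv : IsTernary v) :
    ∑ e, pairCoeff G u v e ^ 2 ≤ 2 * edgeCount G u v := by
  have h := sum_lt_add_swap (fun x y => adj G x y * (|u x| * |v y|)) fun x => by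
    rw [adj_self, zero_mul]
  unfold edgeCount
  rw [← h, Finset.mul_sum]
  refine Finset.sum_le_sum fun e _ => ?_
  unfold pairCoeff
  split_ifs with he
  · have h1 : ∀ x y, |u x| * |v y| = (u x * v y) ^ 2 := fun x y => by
      rw [← hu.abs_mul_abs x, ← hv.abs_mul_abs y, abs_mul_abs_self, abs_mul_abs_self]
      ring
    rw [mul_pow, adj_sq, adj_symm e.2 e.1, h1, h1]
    have h0 := adj_nonneg (G := G) e.1 e.2
    have h2 := sq_nonneg (u e.1 * v e.2 - u e.2 * v e.1)
    nlinarith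
  · norm_num

/-- The randomly signed adjacency matrix. -/
noncomputable def randomMatrix (G : SimpleGraph (Fin n)) (ε : Fin n × Fin n → Bool) :
    Matrix (Fin n) (Fin n) ℝ := edgeMatrix G fun x y => bsgn (ε (x, y))

theorem abs_bsgn (b : Bool) : |bsgn b| = 1 := by cases b <;> simp [bsgn]

theorem abs_randomMatrix (ε : Fin n × Fin n → Bool) (x y : Fin n) :
    |randomMatrix G ε x y| ≤ adj G x y := by
  simp only [randomMatrix, edgeMatrix, Matrix.of_apply]
  rw [abs_mul, abs_of_nonneg (adj_nonneg x y)]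
  split_ifs <;> simp [abs_bsgn]

theorem randomMatrix_int (ε : Fin n × Fin n → Bool) (x y : Fin n) :
    ∃ k : ℤ, randomMatrix G ε x y = k := by
  classical
  have h : ∀ b, ∃ k : ℤ, bsgn b = k := fun b => by
    cases b
    · exact ⟨-1, by simp [bsgn]⟩
    · exact ⟨1, by simp [bsgn]⟩
  simp only [randomMatrix, edgeMatrix, Matrix.of_apply, adj_apply]
  obtain ⟨k, hk⟩ := h (ε (x, y))
  obtain ⟨k', hk'⟩ := h (ε (y, x))
  rw [hk, hk']
  by_cases h1 : G.Adj x y <;> by_cases h2 : x < y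
  · exact ⟨k, by simp [h1, h2]⟩
  · exact ⟨k', by simp [h1, h2]⟩
  · exact ⟨0, by simp [h1]⟩
  · exact ⟨0, by simp [h1]⟩

/-- Chernoff's method: the signs are independent, so the exponential moment is a product of
hyperbolic cosines, each bounded by exp(t²/2), and the squared coefficients add up to at most twice
`edgeCount`. -/
theorem card_le_exp (hu : IsTernary u) (hv : IsTernary v) {θ : ℝ} (hθ : 0 ≤ θ) (g : ℝ) :
    ((Finset.univ.filter fun ε => g < u ⬝ᵥ randomMatrix G ε *ᵥ v).card : ℝ) ≤
      2 ^ (n * n) * Real.exp (θ ^ 2 * edgeCount G u v - θ * g) := by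
  have h1 : ∑ ε, Real.exp (θ * (u ⬝ᵥ randomMatrix G ε *ᵥ v)) ≤
      2 ^ (n * n) * Real.exp (θ ^ 2 * edgeCount G u v) := by
    have e1 : ∀ ε, Real.exp (θ * (u ⬝ᵥ randomMatrix G ε *ᵥ v)) =
        ∏ e : Fin n × Fin n, Real.exp (θ * pairCoeff G u v e * bsgn (ε e)) := by
      intro ε
      rw [randomMatrix, bilinear_edgeMatrix, Finset.mul_sum, Real.exp_sum]
      exact Finset.prod_congr rfl fun e _ => by rw [mul_assoc]
    simp only [e1]
    rw [sum_prod_bool fun (e : Fin n × Fin n) b => Real.exp (θ * pairCoeff G u v e * bsgn b)]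
    have e2 : (2 : ℝ) ^ (n * n) = ∏ e : Fin n × Fin n, (2 : ℝ) := by simp
    calc _ ≤ ∏ e : Fin n × Fin n, 2 * Real.exp ((θ * pairCoeff G u v e) ^ 2 / 2) := by
          refine Finset.prod_le_prod (fun e _ => by positivity) fun e _ => ?_
          have := Real.cosh_le_exp_half_sq (θ * pairCoeff G u v e)
          rw [Real.cosh_eq] at this
          simp only [bsgn, if_true, Bool.false_eq_true, if_false, mul_one, mul_neg]
          linarith
      _ = 2 ^ (n * n) * Real.exp (∑ e, (θ * pairCoeff G u v e) ^ 2 / 2) := by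
          rw [Finset.prod_mul_distrib, ← e2, Real.exp_sum]
      _ ≤ _ := by
          gcongr
          have := sum_pairCoeff_sq_le (G := G) hu hv
          simp only [mul_pow, ← Finset.sum_div, ← Finset.mul_sum]
          nlinarith [sq_nonneg θ]
  rw [Real.exp_sub, ← mul_div_assoc, le_div_iff₀ (Real.exp_pos _)]
  refine le_trans ?_ h1
  rw [← nsmul_eq_mul, ← Finset.sum_const]
  refine (Finset.sum_le_sum fun ε hε => ?_).trans (Finset.sum_le_sum_of_subset_of_nonneg
    (Finset.subset_univ _) fun ε _ _ => (Real.exp_pos _).le)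
  rw [Finset.mem_filter] at hε
  exact Real.exp_le_exp.mpr (mul_le_mul_of_nonneg_left hε.2.le hθ)

theorem pow_le_exp_logb {d : ℕ} (hd : 0 < d) (k : ℕ) : (d : ℝ) ^ k ≤ Real.exp (Real.logb 2 d * k) := by
  rw [mul_comm, Real.exp_nat_mul]
  refine pow_le_pow_left₀ (by positivity) ?_ k
  have hd' : (0 : ℝ) < d := by exact_mod_cast hd
  have h1 : (1 : ℝ) ≤ d := by exact_mod_cast hd
  rw [← Real.log_le_iff_le_exp hd', Real.logb, le_div_iff₀ (Real.log_pos one_lt_two)]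
  have := Real.log_two_lt_d9
  have h2 := Real.log_nonneg h1
  nlinarith

theorem gamma_nonneg (d : ℕ) : 0 ≤ gamma d := by
  unfold gamma
  positivity

theorem gamma_sq {d : ℕ} (hd : 2 ≤ d) : gamma d ^ 2 = 100 * (d * Real.logb 2 d) := by
  have := logb_nonneg hd
  rw [gamma, mul_pow, Real.sq_sqrt (by positivity)]
  norm_num

theorem card_large_le (hG : IsRegular G d) (hd : 2 ≤ d) (hu : IsTernary u) (hv : IsTernary v) :
    ((Finset.univ.filter fun ε =>
      gamma d * √((u ⬝ᵥ u) * (v ⬝ᵥ v)) < u ⬝ᵥ randomMatrix G ε *ᵥ v).card : ℝ) ≤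
      2 ^ (n * n) / (d : ℝ) ^ (12 * (jointSupport u v).card) := by
  have hd' : (0 : ℝ) < d := by positivity
  have hL := logb_nonneg hd
  set a := u ⬝ᵥ u
  set b := v ⬝ᵥ v
  have ha : 0 ≤ a := dotProduct_self_nonneg' u
  have hb : 0 ≤ b := dotProduct_self_nonneg' v
  rcases (edgeCount_nonneg (G := G) u v).eq_or_lt with h0 | h0
  · rw [Finset.filter_eq_empty_iff.mpr]
    · simp only [Finset.card_empty, Nat.cast_zero]
      positivity
    · intro ε _
      rw [not_lt]
      have h1 := (le_abs_self _).trans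
        (abs_dotProduct_mulVec_le_edgeCount (abs_randomMatrix (G := G) ε) u v)
      have h2 := mul_nonneg (gamma_nonneg d) (Real.sqrt_nonneg (a * b))
      linarith
  set E := edgeCount G u v with hE
  set g := gamma d * √(a * b) with hg
  have hg0 : 0 ≤ g := mul_nonneg (gamma_nonneg d) (Real.sqrt_nonneg _)
  -- The value g/(2E) minimizes θ²E - θg, with minimum -g²/(4E).
  have h1 := card_le_exp (G := G) hu hv (θ := g / (2 * E)) (by positivity) g
  refine h1.trans ?_
  rw [div_eq_mul_inv ((2 : ℝ) ^ (n * n))]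
  refine mul_le_mul_of_nonneg_left ?_ (by positivity)
  have h2 : (g / (2 * E)) ^ 2 * E - g / (2 * E) * g = -(g ^ 2 / (4 * E)) := by
    field_simp
    ring
  rw [← hE, h2, Real.exp_neg]
  refine inv_anti₀ (by positivity) ((pow_le_exp_logb (by omega) _).trans (Real.exp_le_exp.mpr ?_))
  rw [le_div_iff₀ (by positivity), hg, mul_pow, gamma_sq hd, Real.sq_sqrt (mul_nonneg ha hb)]
  have hS : ((jointSupport u v).card : ℝ) ≤ a + b := card_jointSupport_le hu hv
  have hEa : E ≤ d * a := edgeCount_le_left hG hu hv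
  have hEb : E ≤ d * b := edgeCount_le_right hG hu hv
  -- Since E ≤ d·min(a, b), the exponent g²/(4E) = 25 d log(d) ab/E is at least 12.5 log(d)(a + b),
  -- and a + b bounds the size of the joint support. Hence the exponent 12.
  have h3 : E * (a + b) ≤ d * (a * b) + d * (a * b) := by nlinarith
  push_cast
  have h4 : E * ((jointSupport u v).card : ℝ) ≤ 2 * (d * (a * b)) := by nlinarith
  have h5 := mul_le_mul_of_nonneg_left h4 (by linarith : (0 : ℝ) ≤ Real.logb 2 d)
  have h6 : (0 : ℝ) ≤ Real.logb 2 d * (d * (a * b)) := by positivity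
  nlinarith

end

end TwoLift

namespace TwoLift

open Matrix

/-! ### The average trace -/

section

variable {n d : ℕ} {G : SimpleGraph (Fin n)}

theorem isTernary_fstLab (a : ℕ → ℕ → ℕ) (d Q c : ℕ) : IsTernary (fstLab (n := n) a d Q c) :=
  fun _ => sgn_eq _

theorem isTernary_sndLab (a : ℕ → ℕ → ℕ) (d Q c : ℕ) : IsTernary (sndLab (n := n) a d Q c) :=
  fun _ => sgn_eq _

theorem lt_two_pow_lg (hn : 0 < n) : n < 2 ^ lg n := by
  rw [lg_eq hn]
  exact Nat.lt_pow_succ_log_self one_lt_two n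

theorem lg_pos (hn : 0 < n) : 0 < lg n := by
  rw [lg_eq hn]
  omega

theorem le_logb_of_lt_lg (hn : 0 < n) {k : ℕ} (hk : k < lg n) : (k : ℝ) ≤ Real.logb 2 n := by
  rw [lg_eq hn] at hk
  rw [Real.le_logb_iff_rpow_le one_lt_two (by positivity), Real.rpow_natCast]
  exact_mod_cast (Nat.pow_le_pow_right two_pos (Nat.le_of_lt_succ hk)).trans
    (Nat.pow_log_le_self 2 hn.ne')

theorem lt_lg_of_le_logb (hn : 0 < n) {k : ℕ} (hk : (k : ℝ) ≤ Real.logb 2 n) : k < lg n := by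
  rw [lg_eq hn, Nat.lt_succ_iff, Nat.le_log_iff_pow_le one_lt_two hn.ne']
  rw [Real.le_logb_iff_rpow_le one_lt_two (by positivity), Real.rpow_natCast] at hk
  exact_mod_cast hk

/-- The form of the randomly signed matrix is large on some ternary vectors. -/
def IsBad (G : SimpleGraph (Fin n)) (d : ℕ) (ε : Fin n × Fin n → Bool) : Prop :=
  ∃ u v : Fin n → ℝ, IsTernary u ∧ IsTernary v ∧
    gamma d * √((u ⬝ᵥ u) * (v ⬝ᵥ v)) < u ⬝ᵥ randomMatrix G ε *ᵥ v

/-- If all connected supports obeyed the bound, so would all pairs. A connected violation has at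
least `lg n` vertices, because on smaller supports sparsity bounds even the number of edges. -/
theorem IsBad.exists_code (hG : IsRegular G d) (hd : 0 < d) (hn : 0 < n)
    (hS : IsSparse G (gamma d) (Real.logb 2 n)) {ε : Fin n × Fin n → Bool} (h : IsBad G d ε) :
    ∃ k ∈ Finset.Icc (lg n) n, ∃ c ∈ Finset.range (n * (9 * d) ^ (2 * k)),
      ∃ u v : Fin n → ℝ, u = fstLab (mat (graphMem G)) d (2 * k) c ∧
        v = sndLab (mat (graphMem G)) d (2 * k) c ∧ (jointSupport u v).card = k ∧
        gamma d * √((u ⬝ᵥ u) * (v ⬝ᵥ v)) < u ⬝ᵥ randomMatrix G ε *ᵥ v := by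
  obtain ⟨u, v, hu, hv, huv⟩ := h
  by_contra hcon
  refine huv.not_ge ?_
  rw [dotProduct_mulVec_eq_sum]
  refine sum_kernel_le_of_linked (G := G) (k := fun x y a b => randomMatrix G ε x y * (a * b))
    ?_ (by simp) (by simp) (gamma_nonneg d) (N := n) ?_ u v hu hv ?_
  · intro x y a b hxy
    classical
    have := abs_randomMatrix (G := G) ε x y
    rw [adj_apply, if_neg hxy] at this
    rw [abs_eq_zero.mp (le_antisymm this (abs_nonneg _)), zero_mul]
  · intro u v hu hv hN hl hne
    rw [← dotProduct_mulVec_eq_sum]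
    by_contra hlt
    rw [not_le] at hlt
    refine hcon ⟨_, Finset.mem_Icc.mpr ⟨?_, hN⟩, ?_⟩
    · by_contra hk
      have h1 := hS.edgeCount_le hu hv (le_logb_of_lt_lg hn (not_le.mp hk))
      have h2 := (le_abs_self _).trans
        (abs_dotProduct_mulVec_le_edgeCount (abs_randomMatrix (G := G) ε) u v)
      linarith
    · obtain ⟨c, hc, h1, h2⟩ := TwoLift.exists_code graphMem_ne_zero hG hd hu hv hl hne
        (fun x hx => notMem_jointSupport.mp hx) le_rfl
      exact ⟨c, Finset.mem_range.mpr hc, u, v, h1.symm, h2.symm, rfl, hlt⟩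
  · exact (Finset.card_le_univ _).trans_eq (Fintype.card_fin n)

-- For d ≥ 9 there are at most n(9d)^(2k) ≤ d^(5k) codes for supports of k ≥ `lg n` vertices, each
-- bad with probability at most d^(-12k). The fewer than or equal to n values of k cost another
-- factor d^(`lg n`), which leaves ample room.
open Classical in
theorem card_isBad_le (hG : IsRegular G d) (hd : 9 ≤ d) (hn : 0 < n)
    (hS : IsSparse G (gamma d) (Real.logb 2 n)) :
    ((Finset.univ.filter (IsBad G d)).card : ℝ) * (d : ℝ) ^ (2 * lg n) ≤ 2 ^ (n * n) := by
  set a := mat (graphMem G)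
  set T : ℕ → ℕ → Finset (Fin n × Fin n → Bool) := fun k c =>
    Finset.univ.filter fun ε => (jointSupport (V := Fin n) (fstLab a d (2 * k) c) (sndLab a d (2 * k) c)).card = k ∧
      gamma d * √(((fstLab a d (2 * k) c : Fin n → ℝ) ⬝ᵥ fstLab a d (2 * k) c) *
        ((sndLab a d (2 * k) c : Fin n → ℝ) ⬝ᵥ sndLab a d (2 * k) c)) <
      fstLab a d (2 * k) c ⬝ᵥ randomMatrix G ε *ᵥ sndLab a d (2 * k) c with hT
  have hd1 : (1 : ℝ) ≤ d := by exact_mod_cast (by omega : 1 ≤ d)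
  have hd0 : (0 : ℝ) < d := by linarith
  have hTle : ∀ k c, ((T k c).card : ℝ) ≤ 2 ^ (n * n) / (d : ℝ) ^ (12 * k) := by
    intro k c
    by_cases hk : (jointSupport (V := Fin n) (fstLab a d (2 * k) c) (sndLab a d (2 * k) c)).card = k
    · have := card_large_le hG (by omega) (isTernary_fstLab (n := n) a d (2 * k) c)
        (isTernary_sndLab a d (2 * k) c)
      rw [hk] at this
      refine le_trans ?_ this
      refine Nat.cast_le.mpr (Finset.card_le_card fun ε hε => ?_)
      simp only [hT, Finset.mem_filter] at hε ⊢
      exact ⟨hε.1, hε.2.2⟩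
    · rw [hT]
      simp only [hk, false_and, Finset.filter_false, Finset.card_empty, Nat.cast_zero]
      positivity
  have hsub : Finset.univ.filter (IsBad G d) ⊆ (Finset.Icc (lg n) n).biUnion fun k =>
      (Finset.range (n * (9 * d) ^ (2 * k))).biUnion fun c => T k c := by
    intro ε hε
    rw [Finset.mem_filter] at hε
    obtain ⟨k, hk, c, hc, u, v, rfl, rfl, h1, h2⟩ := hε.2.exists_code hG (by omega) hn hS
    rw [Finset.mem_biUnion]
    refine ⟨k, hk, Finset.mem_biUnion.mpr ⟨c, hc, ?_⟩⟩
    rw [hT, Finset.mem_filter]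
    exact ⟨Finset.mem_univ _, h1, h2⟩
  have hcard : ((Finset.univ.filter (IsBad G d)).card : ℝ) ≤
      ∑ k ∈ Finset.Icc (lg n) n, ∑ c ∈ Finset.range (n * (9 * d) ^ (2 * k)), ((T k c).card : ℝ) := by
    have := (Finset.card_le_card hsub).trans (Finset.card_biUnion_le.trans
      (Finset.sum_le_sum fun k _ => Finset.card_biUnion_le))
    exact_mod_cast this
  have hnd : (n : ℝ) ≤ (d : ℝ) ^ lg n := by
    have : n ≤ d ^ lg n := (lt_two_pow_lg hn).le.trans (Nat.pow_le_pow_left (by omega) _)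
    exact_mod_cast this
  have hterm : ∀ k ∈ Finset.Icc (lg n) n,
      ∑ c ∈ Finset.range (n * (9 * d) ^ (2 * k)), ((T k c).card : ℝ) ≤
        2 ^ (n * n) / (d : ℝ) ^ (7 * lg n) := by
    intro k hk
    have hk := (Finset.mem_Icc.mp hk).1
    refine (Finset.sum_le_sum fun c _ => hTle k c).trans ?_
    rw [Finset.sum_const, Finset.card_range, nsmul_eq_mul]
    have h1 : ((n * (9 * d) ^ (2 * k) : ℕ) : ℝ) ≤ (d : ℝ) ^ (5 * k) := by
      have h2 : n ≤ d ^ k := (lt_two_pow_lg hn).le.trans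
        ((Nat.pow_le_pow_left (by omega) _).trans (Nat.pow_le_pow_right (by omega) hk))
      have h3 : (9 * d) ^ (2 * k) ≤ (d * d) ^ (2 * k) :=
        Nat.pow_le_pow_left (Nat.mul_le_mul_right d hd) _
      have h4 := Nat.mul_le_mul h2 h3
      rw [← pow_two, ← pow_mul, ← pow_add, show k + 2 * (2 * k) = 5 * k by ring] at h4
      exact_mod_cast h4
    calc _ ≤ (d : ℝ) ^ (5 * k) * (2 ^ (n * n) / (d : ℝ) ^ (12 * k)) := by gcongr
      _ = 2 ^ (n * n) / (d : ℝ) ^ (7 * k) := by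
        rw [show 12 * k = 5 * k + 7 * k by ring, pow_add]
        field_simp
      _ ≤ _ := by gcongr
  have hsum := hcard.trans (Finset.sum_le_card_nsmul _ _ _ hterm)
  rw [nsmul_eq_mul] at hsum
  have hIcc : ((Finset.Icc (lg n) n).card : ℝ) ≤ (d : ℝ) ^ lg n := by
    refine le_trans ?_ hnd
    have := lg_pos hn
    rw [Nat.card_Icc]
    exact_mod_cast (by omega : n + 1 - lg n ≤ n)
  calc _ ≤ ((d : ℝ) ^ lg n * (2 ^ (n * n) / (d : ℝ) ^ (7 * lg n))) * (d : ℝ) ^ (2 * lg n) := by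
        refine mul_le_mul_of_nonneg_right (hsum.trans ?_) (by positivity)
        gcongr
    _ = 2 ^ (n * n) / (d : ℝ) ^ (4 * lg n) := by
        rw [show 7 * lg n = lg n + 2 * lg n + 4 * lg n by ring, pow_add, pow_add]
        field_simp
    _ ≤ _ := div_le_self (by positivity) (one_le_pow₀ hd1)

theorem trace_randomMatrix_le (hG : IsRegular G d) (ε : Fin n × Fin n → Bool) (m : ℕ) :
    (randomMatrix G ε ^ (2 * m)).trace ≤ n * (d : ℝ) ^ (2 * m) := by
  have := trace_pow_le (edgeMatrix_symm _) (randomMatrix_int (G := G) ε) (b := d)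
    (fun x y => abs_bilinear_le_of_abs_le_adj hG (abs_randomMatrix ε) _ _) m
  rwa [Fintype.card_fin] at this

theorem meanTrace_le_trivial (hG : IsRegular G d) (m : ℕ) :
    meanTrace G (2 * m) ≤ n * (d : ℝ) ^ (2 * m) := by
  rw [meanTrace, div_le_iff₀ (by positivity)]
  refine (Finset.sum_le_card_nsmul _ _ _ fun ε _ => trace_randomMatrix_le hG ε m).trans_eq ?_
  rw [nsmul_eq_mul, Finset.card_univ, Fintype.card_fun, Fintype.card_bool, Fintype.card_prod,
    Fintype.card_fin]
  push_cast
  ring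

/-- Good signings obey the discrepancy bound on ternary vectors, hence the trace bound with `2 * κ`.
Bad ones have trace at most `n * d ^ (2 * lg n)`, but are rare enough to contribute at most `n` to
the mean. -/
theorem meanTrace_le (hG : IsRegular G d) (hd : 9 ≤ d) (hn : 0 < n)
    (hS : IsSparse G (gamma d) (Real.logb 2 n)) (hγ : 1 ≤ gamma d) {r κ : ℕ} (hr : d ≤ 2 ^ r)
    (hκ : gamma d * (r + 2) ≤ κ) :
    meanTrace G (2 * lg n) ≤ n * ((2 * κ : ℕ) ^ (2 * lg n) + 1) := by
  classical
  have hgood : ∀ ε, ¬ IsBad G d ε →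
      (randomMatrix G ε ^ (2 * lg n)).trace ≤ n * ((2 * κ : ℕ) : ℝ) ^ (2 * lg n) := by
    intro ε hε
    have := trace_pow_le (edgeMatrix_symm _) (randomMatrix_int (G := G) ε) (b := 2 * κ)
      (fun x y => (abs_bilinear_int_le hG (abs_randomMatrix ε) hγ (fun u v hu hv => ?_) hr
        x y).trans ?_) (lg n)
    · rwa [Fintype.card_fin] at this
    · by_contra h
      exact hε ⟨u, v, hu, hv, not_le.mp h⟩
    · refine mul_le_mul_of_nonneg_right ?_ (add_nonneg (dotProduct_self_nonneg' _)
        (dotProduct_self_nonneg' _))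
      push_cast
      linarith
  rw [meanTrace, div_le_iff₀ (by positivity)]
  have h1 : ∀ ε, (randomMatrix G ε ^ (2 * lg n)).trace ≤ n * ((2 * κ : ℕ) : ℝ) ^ (2 * lg n) +
      if IsBad G d ε then n * (d : ℝ) ^ (2 * lg n) else 0 := by
    intro ε
    split_ifs with h
    · exact (trace_randomMatrix_le hG ε _).trans (le_add_of_nonneg_left (by positivity))
    · rw [add_zero]
      exact hgood ε h
  refine (Finset.sum_le_sum fun ε _ => h1 ε).trans ?_
  rw [Finset.sum_add_distrib, Finset.sum_const, ← Finset.sum_filter, Finset.sum_const,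
    nsmul_eq_mul, nsmul_eq_mul, Finset.card_univ, Fintype.card_fun, Fintype.card_bool,
    Fintype.card_prod, Fintype.card_fin]
  have h2 := card_isBad_le hG hd hn hS
  have hn0 : (0 : ℝ) ≤ n := n.cast_nonneg
  push_cast
  nlinarith

end

end TwoLift

namespace TwoLift

open Matrix

/-! ### The spectral radius of the greedy signing -/

section

variable {n d : ℕ} {G : SimpleGraph (Fin n)} {u v : Fin n → ℝ}

theorem abs_upperSign_le (s : Signing G) (x y : Fin n) : |upperSign s x y| ≤ 1 := by
  classical
  unfold upperSign
  split_ifs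
  · rw [abs_signedAdj, adj_apply]
    split_ifs <;> simp
  · simp

theorem abs_pair_mul_upperSign_le (hu : IsTernary u) (hv : IsTernary v) (s : Signing G)
    (x y : Fin n) : |(u x * v y + u y * v x) * upperSign s x y| ≤ 2 := by
  have h : ∀ x y, |u x * v y| ≤ 1 := fun x y => by
    rw [abs_mul]
    exact mul_le_one₀ (hu.abs_le_one x) (abs_nonneg _) (hv.abs_le_one y)
  rw [abs_mul]
  have h1 := (abs_add_le (u x * v y) (u y * v x)).trans (add_le_add (h x y) (h y x))
  have h2 := abs_upperSign_le s x y
  nlinarith [abs_nonneg (u x * v y + u y * v x), abs_nonneg (upperSign s x y)]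

theorem pairWeight_nonneg (hu : IsTernary u) (hv : IsTernary v) (s : Signing G) :
    0 ≤ pairWeight u v (upperSign s) := by
  refine Finset.prod_nonneg fun e _ => ?_
  have := (abs_le.mp (abs_pair_mul_upperSign_le hu hv s e.1 e.2)).1
  linarith

theorem trace_greedySigning_le (hG : IsRegular G d) (hn : 0 < n) (hd : 0 < d) :
    (signedAdj (greedySigning G) ^ (2 * lg n)).trace ≤ 1 + meanTrace G (2 * lg n) := by
  have h := greedySigning_inequality hG hn hd
  have h0 : (0 : ℝ) < n * (9 * d) ^ (2 * lg n) := by positivity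
  refine le_of_mul_le_mul_left (le_trans (le_add_of_nonneg_left ?_) h) h0
  exact Finset.sum_nonneg fun c _ => pairWeight_nonneg (isTernary_fstLab _ _ _ _)
    (isTernary_sndLab _ _ _ _) _

theorem quasiBound_eq {d : ℕ} (hd : 2 ≤ d) :
    quasiBound d = √(d * Real.logb 2 d) * Real.logb 2 d := by
  have hL := logb_nonneg hd
  rw [quasiBound, show (d : ℝ) * Real.logb 2 d ^ 3 = (d * Real.logb 2 d) * Real.logb 2 d ^ 2 by ring,
    Real.sqrt_mul (by positivity), Real.sqrt_sq (by linarith)]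

theorem one_le_gamma {d : ℕ} (hd : 2 ≤ d) : 1 ≤ gamma d := by
  have hL := logb_nonneg hd
  have h2 : (2 : ℝ) ≤ d := by exact_mod_cast hd
  have : 1 ≤ √(d * Real.logb 2 d) := by
    rw [Real.one_le_sqrt]
    nlinarith
  rw [gamma]
  linarith

/-- The trace bound is at most the power 2 `lg n` of `8 * κ`, so the eigenvalues are at most `8 *
κ`, and `κ` is at most 41 times `quasiBound d`; 8 · 41 = 328 leaves a margin below 400. -/
theorem abs_quadratic_greedySigning_le (hG : IsRegular G d) (hd : 2 ≤ d)
    (hS : IsSparse G (gamma d) (Real.logb 2 n)) (x : Fin n → ℝ) :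
    |x ⬝ᵥ signedAdj (greedySigning G) *ᵥ x| ≤ 400 * quasiBound d * (x ⬝ᵥ x) := by
  have hq := one_le_quasiBound hd
  have hL := logb_nonneg hd
  rcases Nat.eq_zero_or_pos n with rfl | hn
  · simp [dotProduct]
  -- The union bound needs d ≥ 9. For smaller `d` the trivial bound by the degree suffices, since
  -- `quasiBound d` is at least 1.
  rcases lt_or_ge d 9 with hd9 | hd9
  · have h1 := abs_bilinear_le_of_abs_le_adj hG
      (fun x y => (abs_signedAdj (greedySigning G) x y).le) x x
    have h2 : (d : ℝ) ≤ 9 := by exact_mod_cast hd9.le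
    refine h1.trans ?_
    have := mul_le_mul_of_nonneg_right (show (d : ℝ) ≤ 400 * quasiBound d by linarith)
      (dotProduct_self_nonneg' x)
    linarith
  set L := Real.logb 2 d with hLdef
  set r := Nat.log 2 d + 1 with hr
  set κ := ⌈gamma d * (r + 2)⌉₊ with hκ
  have hr1 : d ≤ 2 ^ r := (Nat.lt_pow_succ_log_self one_lt_two d).le
  have hr2 : (r : ℝ) ≤ L + 1 := by
    have : ((Nat.log 2 d : ℕ) : ℝ) ≤ L := by
      rw [hLdef, Real.le_logb_iff_rpow_le one_lt_two (by positivity), Real.rpow_natCast]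
      exact_mod_cast Nat.pow_log_le_self 2 (by omega)
    rw [hr]
    push_cast
    linarith
  have hγ := one_le_gamma hd
  have hκ1 : 1 ≤ κ := Nat.one_le_ceil_iff.mpr (by positivity)
  -- As L ≥ 1, r + 2 ≤ L + 3 ≤ 4L, which gives 40 times `quasiBound d`; rounding up adds at most one
  -- more.
  have hκ2 : (κ : ℝ) ≤ 41 * quasiBound d := by
    have h1 := (Nat.ceil_lt_add_one (by positivity : 0 ≤ gamma d * (r + 2))).le
    have h2 : gamma d * (r + 2) ≤ gamma d * (4 * L) := by
      gcongr
      linarith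
    have h3 : gamma d * (4 * L) = 40 * quasiBound d := by
      rw [quasiBound_eq hd, gamma]
      ring
    linarith
  have htr := (trace_greedySigning_le hG hn (by omega)).trans (add_le_add_right
    (meanTrace_le hG hd9 hn hS hγ hr1 (Nat.le_ceil _)) 1)
  -- Passing from `2 * κ` to `8 * κ` gains the factor `16 ^ lg n`, which absorbs the factor `3 * n`.
  have hT : (signedAdj (greedySigning G) ^ (2 * lg n)).trace ≤ (8 * κ : ℝ) ^ (2 * lg n) := by
    refine htr.trans ?_
    have h1 : (n : ℝ) ≤ 2 ^ lg n := by exact_mod_cast (lt_two_pow_lg hn).le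
    have h2 : (1 : ℝ) ≤ ((2 * κ : ℕ) : ℝ) ^ (2 * lg n) :=
      one_le_pow₀ (by exact_mod_cast (by omega : 1 ≤ 2 * κ))
    have h3 : (8 * κ : ℝ) ^ (2 * lg n) = 16 ^ lg n * ((2 * κ : ℕ) : ℝ) ^ (2 * lg n) := by
      push_cast
      rw [show (8 * κ : ℝ) = 4 * (2 * κ) by ring, mul_pow, pow_mul 4]
      norm_num
    have h4 : (1 : ℝ) ≤ n := by exact_mod_cast hn
    have h5 : (3 : ℝ) * 2 ^ lg n ≤ 16 ^ lg n := by
      have h6 : (8 : ℝ) ≤ 8 ^ lg n := le_self_pow₀ (by norm_num) (lg_pos hn).ne'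
      have h7 : (16 : ℝ) ^ lg n = 8 ^ lg n * 2 ^ lg n := by rw [← mul_pow]; norm_num
      rw [h7]
      gcongr
      linarith
    rw [h3]
    set t := ((2 * κ : ℕ) : ℝ) ^ (2 * lg n)
    calc 1 + n * (t + 1) ≤ (3 * n) * t := by nlinarith
      _ ≤ (3 * 2 ^ lg n) * t := by gcongr
      _ ≤ _ := by gcongr
  refine (abs_quadratic_le_of_eigenvalues (signedAdj_isHermitian _)
    (abs_eigenvalue_le_of_trace _ (by positivity) (lg_pos hn).ne' hT) x).trans ?_
  refine mul_le_mul_of_nonneg_right ?_ (dotProduct_self_nonneg' x)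
  linarith

end

end TwoLift

namespace TwoLift

open Matrix

/-! ### Sparsity of the 2-lift -/

/-- A lower bound for the logarithm of 1 + z. The factors of `pairWeight` have |z| ≤ 1/2, so their
product can be compared from below with an exponential. -/
theorem exp_sub_sq_le {z : ℝ} (h1 : -(1 / 2) ≤ z) (h2 : z ≤ 1 / 2) : Real.exp (z - z ^ 2) ≤ 1 + z := by
  rcases le_total 0 z with h | h
  · have h3 : |z - z ^ 2| ≤ 1 := abs_le.mpr ⟨by nlinarith, by nlinarith⟩
    have h4 := (abs_le.mp (Real.abs_exp_sub_one_sub_id_le h3)).2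
    nlinarith [mul_nonneg h h, mul_nonneg (mul_nonneg h h) h]
  · have h3 : 0 ≤ z ^ 2 - z := by nlinarith
    have h4 := Real.quadratic_le_exp_of_nonneg h3
    have h5 : z - z ^ 2 = -(z ^ 2 - z) := by ring
    rw [h5, Real.exp_neg, inv_le_iff_one_le_mul₀ (Real.exp_pos _)]
    have h6 : 1 ≤ (1 + z) * (1 + (z ^ 2 - z) + (z ^ 2 - z) ^ 2 / 2) := by
      have e : (1 + z) * (1 + (z ^ 2 - z) + (z ^ 2 - z) ^ 2 / 2) - 1 =
          z ^ 2 / 2 * ((1 + z) * (1 - z) ^ 2 + 2 * z) := by ring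
      have h7 : 0 ≤ (1 + z) * (1 - z) ^ 2 + 2 * z := by nlinarith [sq_nonneg z]
      have := mul_nonneg (by positivity : 0 ≤ z ^ 2 / 2) h7
      linarith
    exact h6.trans (mul_le_mul_of_nonneg_left h4 (by linarith))

theorem le_logb_of_two_pow_le {d k : ℕ} (h : 2 ^ k ≤ d) : (k : ℝ) ≤ Real.logb 2 d := by
  have hd : 0 < d := (by positivity : 0 < 2 ^ k).trans_le h
  rw [Real.le_logb_iff_rpow_le one_lt_two (by positivity), Real.rpow_natCast]
  exact_mod_cast h

/-- The hypothesis says 100 log d < d. Then d > 64, so log d ≥ 6, so d > 600 ≥ 2^9, and therefore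
log d ≥ 9. -/
theorem le_of_gamma_lt {d : ℕ} (hd : 2 ≤ d) (h : gamma d < d) : 512 ≤ d ∧ 9 ≤ Real.logb 2 d := by
  have hL := logb_nonneg hd
  have hd0 : (0 : ℝ) < d := by positivity
  have h1 : 100 * Real.logb 2 d < d := by
    have h2 := gamma_sq hd
    have h3 : gamma d ^ 2 < (d : ℝ) ^ 2 := by
      have := gamma_nonneg d
      gcongr
    rw [h2] at h3
    nlinarith
  have h2 : 2 ^ 6 ≤ d := by
    have : (64 : ℝ) < d := by linarith
    exact_mod_cast this.le
  have h3 := le_logb_of_two_pow_le h2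
  have h4 : 2 ^ 9 ≤ d := by
    have : (512 : ℝ) < d := by
      push_cast at h3
      linarith
    exact_mod_cast this.le
  have h5 := le_logb_of_two_pow_le h4
  exact ⟨by simpa using h4, by exact_mod_cast h5⟩

section

variable {n d : ℕ} {G : SimpleGraph (Fin n)} {u v : Fin n → ℝ}

/-- Apply log(1 + z) ≥ z - z² to each factor. The linear terms sum to a quarter of the form; the
squares carry 1/16 and the squared coefficients sum to at most twice `edgeCount`, whence 1/8. -/
theorem exp_le_pairWeight (hu : IsTernary u) (hv : IsTernary v) (s : Signing G) :
    Real.exp ((u ⬝ᵥ signedAdj s *ᵥ v) / 4 - edgeCount G u v / 8) ≤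
      pairWeight u v (upperSign s) := by
  classical
  have e : ∀ e : Fin n × Fin n, (u e.1 * v e.2 + u e.2 * v e.1) * upperSign s e.1 e.2 =
      pairCoeff G u v e * signedAdj s e.1 e.2 := by
    intro e
    unfold pairCoeff upperSign
    split_ifs
    · by_cases h : G.Adj e.1 e.2
      · rw [adj_apply, if_pos h, one_mul]
      · rw [signedAdj_apply_of_not_adj s h, mul_zero, mul_zero]
    · simp
  have hsum : (u ⬝ᵥ signedAdj s *ᵥ v) = ∑ e, pairCoeff G u v e * signedAdj s e.1 e.2 := by
    rw [← bilinear_edgeMatrix fun x y => signedAdj s x y, edgeMatrix_signedAdj]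
  have hle : ∑ e, (pairCoeff G u v e * signedAdj s e.1 e.2) ^ 2 ≤ 2 * edgeCount G u v := by
    refine (Finset.sum_le_sum fun e _ => ?_).trans (sum_pairCoeff_sq_le hu hv)
    rw [mul_pow]
    refine mul_le_of_le_one_right (sq_nonneg _) ?_
    rw [← sq_abs, abs_signedAdj, adj_sq, adj_apply]
    split_ifs <;> simp
  have h1 : (u ⬝ᵥ signedAdj s *ᵥ v) / 4 - edgeCount G u v / 8 ≤
      ∑ e : Fin n × Fin n, ((u e.1 * v e.2 + u e.2 * v e.1) * upperSign s e.1 e.2 / 4 -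
        ((u e.1 * v e.2 + u e.2 * v e.1) * upperSign s e.1 e.2 / 4) ^ 2) := by
    simp only [e, Finset.sum_sub_distrib, div_pow, ← Finset.sum_div, ← hsum]
    linarith
  refine (Real.exp_le_exp.mpr h1).trans ?_
  rw [Real.exp_sum]
  refine Finset.prod_le_prod (fun e _ => (Real.exp_pos _).le) fun e _ => exp_sub_sq_le ?_ ?_
  · have := (abs_le.mp (abs_pair_mul_upperSign_le hu hv s e.1 e.2)).1
    linarith
  · have := (abs_le.mp (abs_pair_mul_upperSign_le hu hv s e.1 e.2)).2
    linarith

/-- The edges at `z` are the only ones lost. On either side their number is at most both `d` and the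
size of the other support, hence at most the geometric mean of these two. -/
theorem edgeCount_le_erase (hG : IsRegular G d) (hu : IsTernary u) (hv : IsTernary v) (z : Fin n)
    (ha : 1 ≤ u ⬝ᵥ u) (hb : 1 ≤ v ⬝ᵥ v) :
    edgeCount G u v ≤ edgeCount G (fun x => if x ≠ z then u x else 0)
      (fun x => if x ≠ z then v x else 0) + 2 * √(d * ((u ⬝ᵥ u) * (v ⬝ᵥ v))) := by
  have key : ∀ w : Fin n → ℝ, IsTernary w → 1 ≤ w ⬝ᵥ w → ∀ c : ℝ, 1 ≤ c →
      ∑ y, adj G z y * |w y| ≤ √(d * (c * (w ⬝ᵥ w))) := by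
    intro w hw hw1 c hc
    have h1 : ∑ y, adj G z y * |w y| ≤ d := by
      rw [← sum_adj hG z]
      exact Finset.sum_le_sum fun y _ =>
        mul_le_of_le_one_right (adj_nonneg _ _) (hw.abs_le_one y)
    have h2 : ∑ y, adj G z y * |w y| ≤ w ⬝ᵥ w := by
      classical
      rw [hw.dotProduct_self]
      refine Finset.sum_le_sum fun y _ => mul_le_of_le_one_left (abs_nonneg _) ?_
      rw [adj_apply]
      split_ifs <;> simp
    have h0 : 0 ≤ ∑ y, adj G z y * |w y| :=
      Finset.sum_nonneg fun y _ => mul_nonneg (adj_nonneg _ _) (abs_nonneg _)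
    refine Real.le_sqrt_of_sq_le ?_
    rw [pow_two]
    refine mul_le_mul h1 (h2.trans ?_) h0 (h0.trans h1)
    nlinarith
  have h1 := key v hv hb _ ha
  have h2 := key u hu ha _ hb
  rw [mul_comm (v ⬝ᵥ v)] at h2
  have h3 : edgeCount G u v ≤ ∑ x, ∑ y,
      (adj G x y * (|if x ≠ z then u x else 0| * |if y ≠ z then v y else 0|) +
        ((if x = z then adj G z y * |v y| else 0) + if y = z then adj G z x * |u x| else 0)) := by
    refine Finset.sum_le_sum fun x _ => Finset.sum_le_sum fun y _ => ?_
    have h0 := adj_nonneg (G := G) x y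
    have hux := hu.abs_le_one x
    have hvy := hv.abs_le_one y
    have h4 : adj G x y * (|u x| * |v y|) ≤ adj G x y * |v y| :=
      mul_le_mul_of_nonneg_left (mul_le_of_le_one_left (abs_nonneg _) hux) h0
    have h5 : adj G x y * (|u x| * |v y|) ≤ adj G x y * |u x| :=
      mul_le_mul_of_nonneg_left (mul_le_of_le_one_right (abs_nonneg _) hvy) h0
    have h6 : 0 ≤ adj G x y * |u x| := mul_nonneg h0 (abs_nonneg _)
    by_cases hx : x = z
    · subst hx
      by_cases hy : y = x
      · subst hy
        simp only [if_true]
        simp only [ne_eq, not_true_eq_false, if_false, abs_zero, mul_zero, zero_add]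
        linarith
      · simpa [hy] using h4
    · by_cases hy : y = z
      · subst hy
        simpa [hx, adj_symm y x] using h5
      · simp [hx, hy]
  refine h3.trans ?_
  simp only [Finset.sum_add_distrib]
  have e1 : ∑ x, ∑ y, (if x = z then adj G z y * |v y| else 0) = ∑ y, adj G z y * |v y| := by
    rw [Finset.sum_comm]
    simp
  have e2 : ∑ x, ∑ y, (if y = z then adj G z x * |u x| else 0) = ∑ x, adj G z x * |u x| := by
    simp
  rw [e1, e2]
  unfold edgeCount
  linarith

theorem dotProduct_self_ite_le (u : Fin n → ℝ) (p : Fin n → Prop) [DecidablePred p] :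
    (fun x => if p x then u x else 0) ⬝ᵥ (fun x => if p x then u x else 0) ≤ u ⬝ᵥ u := by
  refine Finset.sum_le_sum fun x _ => ?_
  by_cases h : p x
  · simp [h]
  · simp [h, mul_self_nonneg]

theorem IsTernary.one_le_dotProduct_self {V : Type*} [Fintype V] {u : V → ℝ} (hu : IsTernary u)
    (h : 0 < u ⬝ᵥ u) : 1 ≤ u ⬝ᵥ u := by
  rw [hu.dotProduct_self] at h ⊢
  obtain ⟨x, -, hx⟩ := Finset.exists_ne_zero_of_sum_ne_zero h.ne'
  have h1 : |u x| = 1 := by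
    rcases hu x with h | h | h <;> simp_all
  rw [← h1]
  exact Finset.single_le_sum (f := fun x => |u x|) (fun x _ => abs_nonneg _) (Finset.mem_univ x)

/-- The trace of an even power is nonnegative and all products are too, so one product is at most
the whole initial potential, for which the trivial bound on the mean trace is enough. For d ≥ 81 one
has (9d)² ≤ d³, and the remaining factor 2n² is below d^(2 `lg n`). -/
theorem pairWeight_le (hG : IsRegular G d) (hn : 0 < n) (hd : 81 ≤ d) {c : ℕ}
    (hc : c < n * (9 * d) ^ (2 * lg n)) :
    pairWeight (fstLab (mat (graphMem G)) d (2 * lg n) c) (sndLab (mat (graphMem G)) d (2 * lg n) c)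
      (upperSign (greedySigning G)) < (d : ℝ) ^ (7 * lg n) := by
  have h := greedySigning_inequality hG hn (by omega)
  have h1 := Finset.single_le_sum (f := fun c => pairWeight
    (fstLab (mat (graphMem G)) d (2 * lg n) c) (sndLab (mat (graphMem G)) d (2 * lg n) c)
      (upperSign (greedySigning G))) (fun c _ => pairWeight_nonneg (isTernary_fstLab _ _ _ _)
    (isTernary_sndLab _ _ _ _) _) (Finset.mem_range.mpr hc)
  have h2 := trace_pow_two_mul_nonneg (signedAdj_symm (greedySigning G)) (lg n)
  have h3 := meanTrace_le_trivial hG (lg n)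
  have hN : (0 : ℝ) ≤ n * (9 * d) ^ (2 * lg n) := by positivity
  have hd1 : (1 : ℝ) ≤ d := by exact_mod_cast (by omega : 1 ≤ d)
  have hn1 : (1 : ℝ) ≤ n := by exact_mod_cast hn
  have h4 : (n : ℝ) * (9 * d) ^ (2 * lg n) * (1 + meanTrace G (2 * lg n)) ≤
      n * (9 * d) ^ (2 * lg n) * (2 * (n * (d : ℝ) ^ (2 * lg n))) := by
    refine mul_le_mul_of_nonneg_left ?_ hN
    have : 1 ≤ n * (d : ℝ) ^ (2 * lg n) := one_le_mul_of_one_le_of_one_le hn1 (one_le_pow₀ hd1)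
    linarith
  have h5 : (n : ℝ) * (9 * d) ^ (2 * lg n) * (2 * (n * (d : ℝ) ^ (2 * lg n))) <
      (d : ℝ) ^ (7 * lg n) := by
    have h6 : (9 * d) ^ (2 * lg n) ≤ d ^ (3 * lg n) := by
      rw [pow_mul, pow_mul d]
      refine Nat.pow_le_pow_left ?_ _
      calc (9 * d) ^ 2 = 81 * d ^ 2 := by ring
        _ ≤ d * d ^ 2 := Nat.mul_le_mul_right _ hd
        _ = d ^ 3 := by ring
    have h7 : 2 * (n * n) < d ^ (2 * lg n) := by
      have h8 := lt_two_pow_lg hn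
      have h9 := lg_pos hn
      calc 2 * (n * n) < 2 * (2 ^ lg n * 2 ^ lg n) := by
            have := Nat.mul_lt_mul'' h8 h8
            omega
        _ ≤ 2 ^ lg n * (2 ^ lg n * 2 ^ lg n) := Nat.mul_le_mul_right _
            (Nat.le_self_pow h9.ne' 2)
        _ = 8 ^ lg n := by rw [← mul_pow, ← mul_pow]; norm_num
        _ ≤ (d ^ 2) ^ lg n := Nat.pow_le_pow_left (by nlinarith) _
        _ = _ := by rw [pow_mul]
    have h10 : n * (9 * d) ^ (2 * lg n) * (2 * (n * d ^ (2 * lg n))) < d ^ (7 * lg n) := calc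
      _ = (2 * (n * n)) * ((9 * d) ^ (2 * lg n) * d ^ (2 * lg n)) := by ring
      _ < d ^ (2 * lg n) * (d ^ (3 * lg n) * d ^ (2 * lg n)) :=
        Nat.mul_lt_mul_of_lt_of_le h7 (Nat.mul_le_mul_right _ h6)
          (Nat.mul_pos (pow_pos (by omega) _) (pow_pos (by omega) _))
      _ = _ := by rw [← pow_add, ← pow_add]; congr 1; ring
    exact_mod_cast h10
  have h6 := mul_nonneg hN h2
  have h7 : (0 : ℝ) ≤ n * (9 * d) ^ (2 * lg n) * (signedAdj (greedySigning G) ^ (2 * lg n)).trace := h6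
  linarith

/-- Sparsity of G covers supports with fewer than `lg n` vertices, so at `lg n` vertices E can
exceed γ√(ab) only slightly. A violation then forces the signed form to be almost as large as E, and
the product attached to (u, v) exceeds what the greedy choice allows. -/
theorem fiberwise_linked_le (hG : IsRegular G d) (hd : 2 ≤ d) (hn : 0 < n) (hγ : gamma d < d)
    (hS : IsSparse G (gamma d) (Real.logb 2 n)) (hu : IsTernary u) (hv : IsTernary v)
    (hcard : (jointSupport u v).card = lg n) (hl : Linked G (jointSupport u v)) :
    (edgeCount G u v + u ⬝ᵥ signedAdj (greedySigning G) *ᵥ v) / 2 ≤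
      gamma d * √((u ⬝ᵥ u) * (v ⬝ᵥ v)) := by
  by_contra hlt
  rw [not_le] at hlt
  obtain ⟨hd512, hL⟩ := le_of_gamma_lt hd hγ
  have hpos := lg_pos hn
  have hne : (jointSupport u v).Nonempty := Finset.card_pos.mp (by omega)
  set L := Real.logb 2 d with hLdef
  set a := u ⬝ᵥ u with ha
  set b := v ⬝ᵥ v with hb
  set g := gamma d * √(a * b) with hg
  set E := edgeCount G u v with hE
  set Z := u ⬝ᵥ signedAdj (greedySigning G) *ᵥ v with hZ
  have hd0 : (0 : ℝ) < d := by positivity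
  have ha0 : 0 ≤ a := dotProduct_self_nonneg' u
  have hb0 : 0 ≤ b := dotProduct_self_nonneg' v
  have hg0 : 0 ≤ g := mul_nonneg (gamma_nonneg d) (Real.sqrt_nonneg _)
  have hZE : Z ≤ E := (le_abs_self _).trans (abs_dotProduct_mulVec_le_edgeCount
    (fun x y => (abs_signedAdj (greedySigning G) x y).le) u v)
  have hEg : g < E := by linarith
  have hEa : E ≤ d * a := edgeCount_le_left hG hu hv
  have hEb : E ≤ d * b := edgeCount_le_right hG hu hv
  have ha1 : 1 ≤ a := hu.one_le_dotProduct_self (by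
    by_contra h
    have : a = 0 := le_antisymm (not_lt.mp h) ha0
    rw [this, mul_zero] at hEa
    linarith)
  have hb1 : 1 ≤ b := hv.one_le_dotProduct_self (by
    by_contra h
    have : b = 0 := le_antisymm (not_lt.mp h) hb0
    rw [this, mul_zero] at hEb
    linarith)
  have hgsq : g ^ 2 = 100 * (d * L) * (a * b) := by
    rw [hg, mul_pow, gamma_sq hd, Real.sq_sqrt (by positivity)]
  -- the two supports are small compared with `g`
  have hsmall : ∀ a b : ℝ, 1 ≤ a → 1 ≤ b → g ^ 2 = 100 * (d * L) * (a * b) → g < d * a →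
      100 * L * b ≤ g := by
    intro a b ha1 hb1 hsq hga
    have h1 : 100 * (d * L) * (a * b) < (d * a) * (d * a) := by
      rw [← hsq, pow_two]
      exact mul_self_lt_mul_self hg0 hga
    have h2 : 100 * L * b < d * a := by
      have h3 : 0 < d * a := by positivity
      refine lt_of_mul_lt_mul_left ?_ h3.le
      linarith
    refine le_of_pow_le_pow_left₀ two_ne_zero hg0 ?_
    rw [hsq]
    have h4 : 0 ≤ 100 * L * b := by positivity
    nlinarith
  have h1 := hsmall a b ha1 hb1 hgsq (hEg.trans_le hEa)
  have h2 := hsmall b a hb1 ha1 (by rw [hgsq]; ring) (hEg.trans_le hEb)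
  have hm : 50 * L * lg n ≤ g := by
    have h3 : ((lg n : ℕ) : ℝ) ≤ a + b := by
      rw [← hcard]
      exact card_jointSupport_le hu hv
    have h4 := mul_le_mul_of_nonneg_left h3 (by linarith : 0 ≤ 50 * L)
    linarith
  -- removing a vertex
  have hEle : E ≤ 16 / 15 * g := by
    obtain ⟨z, hz⟩ := hne
    have h3 := edgeCount_le_erase hG hu hv z ha1 hb1
    have h4 := hS.edgeCount_le (hu.indicator (· ≠ z)) (hv.indicator (· ≠ z))
      (le_logb_of_lt_lg hn ((Finset.card_lt_card (s := jointSupport _ _) (t := jointSupport u v)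
        ((Finset.ssubset_iff_of_subset fun x hx => ?_).mpr ⟨z, hz, ?_⟩)).trans_eq hcard))
    · have h5 : √(((fun x => if x ≠ z then u x else 0) ⬝ᵥ fun x => if x ≠ z then u x else 0) *
          ((fun x => if x ≠ z then v x else 0) ⬝ᵥ fun x => if x ≠ z then v x else 0)) ≤ √(a * b) :=
        Real.sqrt_le_sqrt (mul_le_mul (dotProduct_self_ite_le u _) (dotProduct_self_ite_le v _)
          (dotProduct_self_nonneg' _) ha0)
      have h6 := h4.trans (mul_le_mul_of_nonneg_left h5 (gamma_nonneg d))
      -- Because log d ≥ 9, g² = 100 d log(d) ab is at least 900 dab.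
      have h7 : √(d * (a * b)) ≤ g / 30 := by
        refine Real.sqrt_le_iff.mpr ⟨by positivity, ?_⟩
        rw [div_pow, hgsq]
        have : 0 ≤ d * (a * b) := by positivity
        nlinarith
      linarith
    · rw [mem_jointSupport] at hx ⊢
      by_cases h : x = z
      · simp [h] at hx
      · simpa [h] using hx
    · rw [notMem_jointSupport]
      simp
  -- the weight of the pair
  have hexp := exp_le_pairWeight hu hv (greedySigning G)
  obtain ⟨c, hc, hcu, hcv⟩ := exists_code graphMem_ne_zero hG (by omega) hu hv hl hne
    (fun x hx => notMem_jointSupport.mp hx) hcard.le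
  have hlt' := pairWeight_le hG hn (by omega) hc
  rw [hcu, hcv] at hlt'
  -- The violation reads Z > 2g - E, so the exponent exceeds g/2 - 3E/8 ≥ g/2 - 2g/5 = g/10, and g ≥
  -- 50 L `lg n`.
  have h3 : 5 * L * lg n ≤ Z / 4 - E / 8 := by linarith
  -- The exponential is natural while `L` is a binary logarithm; 7 log 2 < 5 with the natural
  -- logarithm of 2.
  have h4 : (d : ℝ) ^ (7 * lg n) ≤ Real.exp (5 * L * lg n) := by
    rw [← Real.exp_log hd0, ← Real.exp_nat_mul]
    refine Real.exp_le_exp.mpr ?_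
    have h5 : Real.log d = L * Real.log 2 := by
      rw [hLdef, Real.logb, div_mul_cancel₀ _ (Real.log_pos one_lt_two).ne']
    rw [h5]
    push_cast
    have h6 := Real.log_two_lt_d9
    have h7 : 0 ≤ L * lg n := by positivity
    nlinarith
  have h5 := h4.trans ((Real.exp_le_exp.mpr h3).trans hexp)
  linarith

/-- If d ≤ γ(d), the degree bound suffices. Otherwise only connected supports matter, and those with
fewer than `lg n` vertices follow from sparsity of G, since the left side never exceeds `edgeCount`.
-/
theorem fiberwise_le (hG : IsRegular G d) (hd : 2 ≤ d) (hn : 0 < n)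
    (hS : IsSparse G (gamma d) (Real.logb 2 n)) (hu : IsTernary u) (hv : IsTernary v)
    (hcard : (jointSupport u v).card ≤ lg n) :
    (edgeCount G u v + u ⬝ᵥ signedAdj (greedySigning G) *ᵥ v) / 2 ≤
      gamma d * √((u ⬝ᵥ u) * (v ⬝ᵥ v)) := by
  classical
  have hle : ∀ u v : Fin n → ℝ,
      (edgeCount G u v + u ⬝ᵥ signedAdj (greedySigning G) *ᵥ v) / 2 ≤ edgeCount G u v := by
    intro u v
    have := (le_abs_self _).trans (abs_dotProduct_mulVec_le_edgeCount
      (fun x y => (abs_signedAdj (greedySigning G) x y).le) u v)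
    linarith
  rcases le_or_gt (d : ℝ) (gamma d) with hγ | hγ
  · exact (hle u v).trans ((edgeCount_le_sqrt hG hu hv).trans
      (mul_le_mul_of_nonneg_right hγ (Real.sqrt_nonneg _)))
  have e : ∀ u v : Fin n → ℝ, (edgeCount G u v + u ⬝ᵥ signedAdj (greedySigning G) *ᵥ v) / 2 =
      ∑ x, ∑ y, (adj G x y * (|u x| * |v y|) + signedAdj (greedySigning G) x y * (u x * v y)) / 2 := by
    intro u v
    rw [dotProduct_mulVec_eq_sum, edgeCount]
    simp only [← Finset.sum_add_distrib, Finset.sum_div]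
  rw [e]
  refine sum_kernel_le_of_linked (G := G) (k := fun x y a b =>
    (adj G x y * (|a| * |b|) + signedAdj (greedySigning G) x y * (a * b)) / 2)
    ?_ (by simp) (by simp) (gamma_nonneg d) ?_ u v hu hv hcard
  · intro x y a b h
    rw [adj_apply, if_neg h, signedAdj_apply_of_not_adj _ h]
    simp
  · intro u v hu hv hN hl hne
    rw [← e]
    rcases hN.lt_or_eq with h | h
    · exact (hle u v).trans (hS.edgeCount_le hu hv (le_logb_of_lt_lg hn h))
    · exact fiberwise_linked_le hG hd hn hγ hS hu hv h hl

end

end TwoLift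

/-! ### The 2-lift of a sparse graph is sparse -/

namespace TwoLift

open Matrix

section

variable {n d : ℕ} {G : SimpleGraph (Fin n)}

theorem bilinear_lift {V : Type*} [Fintype V] {G : SimpleGraph V} (s : Signing G)
    (u v : V × Bool → ℝ) : u ⬝ᵥ adj (lift s) *ᵥ v = ∑ x, ∑ y,
      (adj G x y * ((u (x, false) + u (x, true)) * (v (y, false) + v (y, true))) +
      signedAdj s x y * ((u (x, false) - u (x, true)) * (v (y, false) - v (y, true)))) / 2 := by
  rw [dotProduct_mulVec_eq_sum, Fintype.sum_prod_type]
  refine Finset.sum_congr rfl fun x _ => ?_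
  simp only [Fintype.sum_bool, Fintype.sum_prod_type, adj_lift_apply, ← Finset.sum_add_distrib]
  refine Finset.sum_congr rfl fun y _ => ?_
  simp only [if_true, reduceCtorEq, if_false]
  ring

/-- The allowed support has at most `lg n` vertices, one more than sparsity of G covers. If two of
them share a fiber, the projection is smaller and G suffices for any signing. If it meets every
fiber at most once, each vertex has a layer, read as a sign, and the form of the lift is (E + Z)/2
for ternary vectors on G. -/
theorem isSparse_lift_greedySigning (hG : IsRegular G d) (hd : 2 ≤ d)
    (hS : IsSparse G (gamma d) (Real.logb 2 n)) :
    IsSparse (lift (greedySigning G)) (gamma d) (1 + Real.logb 2 n) := by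
  classical
  rcases Nat.eq_zero_or_pos n with rfl | hn
  · exact isSparse_of_isEmpty _ _ _
  intro u v hu hv hcard
  have hnorm : ∀ u : Fin n × Bool → ℝ, ‖WithLp.toLp 2 u‖ = √(u ⬝ᵥ u) := fun u => by
    rw [dotProduct_self_eq_norm_sq, Real.sqrt_sq (norm_nonneg _)]
  rw [hnorm, hnorm, mul_assoc, ← Real.sqrt_mul (dotProduct_self_nonneg' _)]
  set S := jointSupport u v with hSdef
  -- An integer of size at most 1 + log n is at most 1 + ⌊log n⌋.
  have hScard : S.card ≤ lg n := by
    have h1 : (Function.support u ∪ Function.support v).ncard = S.card := by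
      rw [← Set.ncard_coe_finset]
      congr 1
      ext x
      simp [hSdef, mem_jointSupport]
    rw [h1] at hcard
    by_contra h
    have h2 := lt_lg_of_le_logb hn (k := S.card - 1) (by
      rw [Nat.cast_sub (by omega)]
      push_cast
      linarith)
    omega
  set P := S.image Prod.fst with hP
  have hPS : P.card ≤ S.card := Finset.card_image_le
  have hout : ∀ x, x ∉ P → ∀ i, u (x, i) = 0 ∧ v (x, i) = 0 := by
    intro x hx i
    refine notMem_jointSupport.mp fun h => hx ?_
    exact Finset.mem_image.mpr ⟨_, h, rfl⟩
  have h01 : ∀ u : Fin n × Bool → ℝ, (∀ x, u x = 0 ∨ u x = 1) → u ⬝ᵥ u =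
      ∑ x, (u (x, false) + u (x, true)) := by
    intro u hu
    rw [dotProduct, Fintype.sum_prod_type]
    refine Finset.sum_congr rfl fun x _ => ?_
    rw [Fintype.sum_bool]
    rcases hu (x, false) with h | h <;> rcases hu (x, true) with h' | h' <;> simp [h, h']
  rw [bilinear_lift]
  rcases lt_or_ge P.card (lg n) with hlt | hge
  · -- the projected supports are small: count the doubly covered vertices apart
    set f : (Fin n × Bool → ℝ) → Fin n → ℝ := fun u x =>
      u (x, false) + u (x, true) - u (x, false) * u (x, true) with hf
    set g : (Fin n × Bool → ℝ) → Fin n → ℝ := fun u x => u (x, false) * u (x, true) with hg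
    have tf : ∀ u : Fin n × Bool → ℝ, (∀ x, u x = 0 ∨ u x = 1) → IsTernary (f u) := by
      intro u hu x
      rcases hu (x, false) with h | h <;> rcases hu (x, true) with h' | h' <;> simp [hf, h, h']
    have tg : ∀ u : Fin n × Bool → ℝ, (∀ x, u x = 0 ∨ u x = 1) → IsTernary (g u) := by
      intro u hu x
      rcases hu (x, false) with h | h <;> rcases hu (x, true) with h' | h' <;> simp [hg, h, h']
    have hw : ∀ u : Fin n × Bool → ℝ, (∀ x, u x = 0 ∨ u x = 1) →
        u ⬝ᵥ u = f u ⬝ᵥ f u + g u ⬝ᵥ g u := by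
      intro u hu
      rw [h01 u hu, dotProduct, dotProduct, ← Finset.sum_add_distrib]
      refine Finset.sum_congr rfl fun x _ => ?_
      rcases hu (x, false) with h | h <;> rcases hu (x, true) with h' | h' <;>
        norm_num [hf, hg, h, h']
    have c1 : (jointSupport (f u) (f v)).card ≤ P.card := by
      refine Finset.card_le_card fun x hx => ?_
      by_contra h
      refine notMem_jointSupport.mpr ?_ hx
      simp [hf, hout x h]
    have c2 : (jointSupport (g u) (g v)).card ≤ P.card := by
      refine Finset.card_le_card fun x hx => ?_
      by_contra h
      refine notMem_jointSupport.mpr ?_ hx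
      simp [hg, hout x h]
    have h1 := hS.edgeCount_le (tf u hu) (tf v hv) (le_logb_of_lt_lg hn (c1.trans_lt hlt))
    have h2 := hS.edgeCount_le (tg u hu) (tg v hv) (le_logb_of_lt_lg hn (c2.trans_lt hlt))
    -- Here `f` marks the fibers that are met and `g` those that are covered twice. Over an edge of
    -- G lie two disjoint edges, so two full fibers give 2 = 1 + 1 and any other pair of fibers at
    -- most one edge.
    have h3 : (∑ x, ∑ y,
        (adj G x y * ((u (x, false) + u (x, true)) * (v (y, false) + v (y, true))) +
        signedAdj (greedySigning G) x y *
          ((u (x, false) - u (x, true)) * (v (y, false) - v (y, true)))) / 2) ≤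
        edgeCount G (f u) (f v) + edgeCount G (g u) (g v) := by
      unfold edgeCount
      rw [← Finset.sum_add_distrib]
      refine Finset.sum_le_sum fun x _ => ?_
      rw [← Finset.sum_add_distrib]
      refine Finset.sum_le_sum fun y _ => ?_
      have h4 := abs_le.mp (abs_signedAdj (greedySigning G) x y).le
      generalize signedAdj (greedySigning G) x y = t at h4
      generalize adj G x y = r at h4
      rcases hu (x, false) with h | h <;> rcases hu (x, true) with h' | h' <;>
        rcases hv (y, false) with k | k <;> rcases hv (y, true) with k' | k' <;>
        norm_num [hf, hg, h, h', k, k'] <;> linarith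
    refine h3.trans ((add_le_add h1 h2).trans ?_)
    rw [hw u hu, hw v hv, ← mul_add]
    exact mul_le_mul_of_nonneg_left (sqrt_mul_add_sqrt_mul_le (dotProduct_self_nonneg' _)
      (dotProduct_self_nonneg' _) (dotProduct_self_nonneg' _) (dotProduct_self_nonneg' _))
      (gamma_nonneg d)
  · -- the supports meet each fiber at most once
    have hinj : Set.InjOn Prod.fst (S : Set (Fin n × Bool)) :=
      Finset.card_image_iff.mp (le_antisymm hPS (hScard.trans hge))
    have hone : ∀ x, (u (x, false) = 0 ∧ v (x, false) = 0) ∨ (u (x, true) = 0 ∧ v (x, true) = 0) := by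
      intro x
      by_contra h
      push Not at h
      have m1 : (x, false) ∈ S := by
        rw [hSdef, mem_jointSupport]
        by_contra h'
        push Not at h'
        exact h.1 h'.1 h'.2
      have m2 : (x, true) ∈ S := by
        rw [hSdef, mem_jointSupport]
        by_contra h'
        push Not at h'
        exact h.2 h'.1 h'.2
      have := hinj m1 m2 rfl
      simp at this
    set f : (Fin n × Bool → ℝ) → Fin n → ℝ := fun u x => u (x, false) - u (x, true) with hf
    have tf : ∀ u : Fin n × Bool → ℝ, (∀ x, u x = 0 ∨ u x = 1) → IsTernary (f u) := by
      intro u hu x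
      rcases hu (x, false) with h | h <;> rcases hu (x, true) with h' | h' <;> simp [hf, h, h']
    have habs : ∀ u : Fin n × Bool → ℝ, (∀ x, u x = 0 ∨ u x = 1) →
        (∀ x, u (x, false) = 0 ∨ u (x, true) = 0) → ∀ x,
        |f u x| = u (x, false) + u (x, true) := by
      intro u hu h0 x
      rcases hu (x, false) with h | h <;> rcases hu (x, true) with h' | h' <;>
        rcases h0 x with k | k <;> simp_all
    have au := habs u hu fun x => (hone x).imp And.left And.left
    have av := habs v hv fun x => (hone x).imp And.right And.right
    have c1 : (jointSupport (f u) (f v)).card ≤ P.card := by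
      refine Finset.card_le_card fun x hx => ?_
      by_contra h
      refine notMem_jointSupport.mpr ?_ hx
      simp [hf, hout x h]
    have h1 := fiberwise_le hG hd hn hS (tf u hu) (tf v hv) (c1.trans (hPS.trans hScard))
    rw [(tf u hu).dotProduct_self, (tf v hv).dotProduct_self] at h1
    rw [h01 u hu, h01 v hv]
    simp only [edgeCount, au, av, dotProduct_mulVec_eq_sum, ← Finset.sum_add_distrib,
      Finset.sum_div] at h1
    exact h1

theorem greedySigning_spec : ∃ C : ℝ, 1 ≤ C ∧ ∀ (d n : ℕ) (G : SimpleGraph (Fin n)), 2 ≤ d →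
    IsRegular G d → IsSparse G (gamma d) (Real.logb 2 n) →
    (∀ x, |x ⬝ᵥ signedAdj (greedySigning G) *ᵥ x| ≤ C * quasiBound d * (x ⬝ᵥ x)) ∧
    IsSparse (lift (greedySigning G)) (gamma d) (1 + Real.logb 2 n) :=
  ⟨400, by norm_num, fun _ _ _ hd hG hS => ⟨abs_quadratic_greedySigning_le hG hd hS,
    isSparse_lift_greedySigning hG hd hS⟩⟩

end

end TwoLift

/-! ### The complete graph and the final assembly -/

namespace TwoLift

open Matrix

/-- The form is at most the product of the two support sizes. Both are at most log(d + 1) ≤ 2 log d,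
which is below γ(d), so one factor √(|u||v|) can be traded for γ(d). -/
theorem isSparse_top {d : ℕ} (hd : 2 ≤ d) :
    IsSparse (⊤ : SimpleGraph (Fin (d + 1))) (gamma d) (Real.logb 2 (d + 1 : ℕ)) := by
  classical
  intro u v hu hv huv
  have h1 : u ⬝ᵥ adj (⊤ : SimpleGraph (Fin (d + 1))) *ᵥ v ≤
      ‖WithLp.toLp 2 u‖ ^ 2 * ‖WithLp.toLp 2 v‖ ^ 2 := by
    rw [← sum_eq_norm_sq hu, ← sum_eq_norm_sq hv, Finset.sum_mul_sum, dotProduct_mulVec_eq_sum]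
    refine Finset.sum_le_sum fun x _ => Finset.sum_le_sum fun y _ => ?_
    rw [adj_apply]
    rcases hu x with h | h <;> rcases hv y with h' | h' <;> split_ifs <;> simp [h, h']
  set a := ‖WithLp.toLp 2 u‖
  set b := ‖WithLp.toLp 2 v‖
  have ha : 0 ≤ a := norm_nonneg _
  have hb : 0 ≤ b := norm_nonneg _
  set t := Real.logb 2 (d + 1 : ℕ) with ht
  have hat : a ^ 2 ≤ t := by
    rw [norm_sq_eq_ncard hu]
    exact (Nat.cast_le.mpr (Set.ncard_le_ncard Set.subset_union_left (Set.toFinite _))).trans huv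
  have hbt : b ^ 2 ≤ t := by
    rw [norm_sq_eq_ncard hv]
    exact (Nat.cast_le.mpr (Set.ncard_le_ncard Set.subset_union_right (Set.toFinite _))).trans huv
  have h2 : a * b ≤ t := by nlinarith [sq_nonneg (a - b)]
  have h3 : t ≤ gamma d := by
    have hl := logb_nonneg hd
    have hl' := logb_le_self (d := d)
    have : t ≤ 2 * Real.logb 2 d := by
      have e := Real.logb_pow 2 (d : ℝ) 2
      push_cast at e
      rw [ht, ← e]
      · refine Real.logb_le_logb_of_le one_lt_two (by positivity) ?_
        have : d + 1 ≤ d ^ 2 := by nlinarith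
        exact_mod_cast this
    refine this.trans ?_
    unfold gamma
    have : Real.logb 2 d ≤ √(d * Real.logb 2 d) := by
      refine Real.le_sqrt_of_sq_le ?_
      rw [pow_two]
      exact mul_le_mul_of_nonneg_right hl' (by linarith)
    linarith [Real.sqrt_nonneg (d * Real.logb 2 d)]
  calc _ ≤ a ^ 2 * b ^ 2 := h1
    _ = (a * b) * (a * b) := by ring
    _ ≤ gamma d * (a * b) := mul_le_mul_of_nonneg_right (h2.trans h3) (by positivity)
    _ = _ := by ring

end TwoLift

open TwoLift in
theorem corollary3p1 :
    ∃ C : ℝ, 0 < C ∧ ∃ M : Prog,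
      -- one algorithm for all degrees, in time polynomial in `n` for each degree
      (∀ d : ℕ, 2 ≤ d → ∃ p : Polynomial ℕ, ∀ (n : ℕ) (G : SimpleGraph (Fin n)),
        IsRegular G d → IsSparse G (gamma d) (Real.logb 2 n) →
        ∃ s : Signing G,
          M.OutputsWithin (encodeGraph G) (encodeSigning s) (p.eval n) ∧
          spectralRadius ℝ (signedAdj s) ≤ ENNReal.ofReal (C * quasiBound d) ∧
          IsSparse (lift s) (gamma d) (1 + Real.logb 2 n)) ∧
      -- iterating it from any sparse base graph
      (∃ B : Prog, ∀ d : ℕ, 2 ≤ d → ∃ p : Polynomial ℕ,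
        ∀ (n₀ : ℕ) (G₀ : SimpleGraph (Fin n₀)),
        IsRegular G₀ d → IsSparse G₀ (gamma d) (Real.logb 2 n₀) →
        ∀ k : ℕ, ∃ G : SimpleGraph (Fin (2 ^ k * n₀)),
          IteratedLift M G₀ k G ∧
          B.OutputsWithin (k :: encodeGraph G₀) (encodeGraph G) (p.eval (2 ^ k * n₀)) ∧
          IsRegular G d ∧
          IsSparse G (gamma d) (Real.logb 2 (2 ^ k * n₀ : ℕ)) ∧
          secondEigenvalue G ≤ max (secondEigenvalue G₀) (C * quasiBound d)) ∧
      -- the resulting construction of arbitrarily large graphs, from the complete graph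
      (∃ D : Prog, ∀ d : ℕ, 2 ≤ d → ∃ p : Polynomial ℕ, ∀ k : ℕ,
        ∃ G : SimpleGraph (Fin (2 ^ k * (d + 1))),
          IteratedLift M (⊤ : SimpleGraph (Fin (d + 1))) k G ∧
          D.OutputsWithin [d, k] (encodeGraph G) (p.eval (2 ^ k * (d + 1))) ∧
          IsRegular G d ∧
          secondEigenvalue G ≤ C * quasiBound d) := by
  obtain ⟨C, hC, H⟩ := greedySigning_spec
  obtain ⟨M, c, h, hM⟩ := exists_signing_prog
  obtain ⟨B, c', h', hB⟩ := exists_iterate_prog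
  obtain ⟨D, c'', h'', hD⟩ := exists_start_prog
  have hMout : ∀ d : ℕ, 2 ≤ d → ∀ (n : ℕ) (G : SimpleGraph (Fin n)), IsRegular G d →
      M.Outputs (encodeGraph G) (encodeSigning (greedySigning G)) := fun d hd n G hG =>
    ⟨_, hM G hG (by omega) le_rfl⟩
  have hstep : ∀ d : ℕ, 2 ≤ d → ∀ a : ℝ, ∀ (n : ℕ) (G : SimpleGraph (Fin n)), IsRegular G d →
      IsSparse G (gamma d) (Real.logb 2 n) ∧ secondEigenvalue G ≤ max a (C * quasiBound d) →
      IsSparse (liftGraph (greedySigning G)) (gamma d) (Real.logb 2 (2 * n : ℕ)) ∧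
        secondEigenvalue (liftGraph (greedySigning G)) ≤ max a (C * quasiBound d) := by
    rintro d hd a n G hG ⟨h1, h2⟩
    obtain ⟨h3, h4⟩ := H d n G hd hG h1
    refine ⟨?_, (secondEigenvalue_liftGraph_le hG _ h3).trans (max_le h2 (le_max_right _ _))⟩
    -- For `n = 0` the logarithm has the default value 0 and doubling does not add 1; but the empty
    -- graph is sparse for all parameters.
    rcases Nat.eq_zero_or_pos n with rfl | hn
    · exact @isSparse_of_isEmpty _ _ Fin.isEmpty' _ _ _
    · obtain ⟨e⟩ := liftGraph_iso (greedySigning G)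
      have hlog : Real.logb 2 (2 * n : ℕ) = 1 + Real.logb 2 n := by
        push_cast
        rw [Real.logb_mul two_ne_zero (by positivity), Real.logb_self_eq_one one_lt_two]
      rw [hlog]
      exact h4.of_iso e
  refine ⟨C, by linarith, M, fun d hd => ?_, ⟨B, fun d hd => ?_⟩, ⟨D, fun d hd => ?_⟩⟩
  · obtain ⟨p, hp⟩ := exists_poly c h d
    refine ⟨p, fun n G hG hS => ?_⟩
    obtain ⟨h1, h2⟩ := H d n G hd hG hS
    obtain ⟨t, ht, σ⟩ := hM G hG (by omega) le_rfl
    exact ⟨greedySigning G, ⟨t, ht.trans (hp n), σ⟩, spectralRadius_le_of_quadratic h1, h2⟩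
  · obtain ⟨p, hp⟩ := exists_poly c' h' d
    refine ⟨p, fun n₀ G₀ hG₀ hS k => ?_⟩
    obtain ⟨G, h1, h2, ⟨h3, h4⟩, h5⟩ := exists_iteratedLift hG₀ (hMout d hd)
      (P := fun n G => IsSparse G (gamma d) (Real.logb 2 n) ∧
        secondEigenvalue G ≤ max (secondEigenvalue G₀) (C * quasiBound d))
      ⟨hS, le_max_left _ _⟩ (hstep d hd _) (encodes_shiftMem (k := k) G₀) k _ rfl
    obtain ⟨t, ht, σ⟩ := hB hG₀ (by omega) rfl h5 le_rfl
    exact ⟨G, h1, ⟨t, ht.trans (hp _), σ⟩, h2, h3, h4⟩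
  · obtain ⟨p, hp⟩ := exists_poly c'' h'' d
    refine ⟨p, fun k => ?_⟩
    have hq := one_le_quasiBound hd
    have h0 : secondEigenvalue (⊤ : SimpleGraph (Fin (d + 1))) ≤ C * quasiBound d :=
      (secondEigenvalue_top_le d).trans (by nlinarith)
    -- λ of the complete graph is at most 1, already below the bound, so 0 can take its place in the
    -- maximum.
    obtain ⟨G, h1, h2, ⟨h3, h4⟩, h5⟩ := exists_iteratedLift (isRegular_top d) (hMout d hd)
      (P := fun n G => IsSparse G (gamma d) (Real.logb 2 n) ∧
        secondEigenvalue G ≤ max 0 (C * quasiBound d))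
      ⟨isSparse_top hd, h0.trans (le_max_right _ _)⟩ (hstep d hd _)
      (encodes_startMem (d := d) (k := k)) k _ rfl
    obtain ⟨t, ht, σ⟩ := hD (by omega) rfl h5 le_rfl
    exact ⟨G, h1, ⟨t, ht.trans (hp _), σ⟩, h2, h4.trans (max_le (by nlinarith) le_rfl)⟩
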